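/- Let $A\in L(\mathbb C^n,\mathbb C^n)$ with $m(A):=\min\{\Re\langle Az,z\rangle:\|z\|=1\}>0$ (Euclidean norm), let $k_+(A):=\max\{\Re\lambda:\lambda\in\sigma(A)\}$ and $n_0:=\lfloor k_+(A)/m(A)\rfloor$, and let $B^n$ be the open unit ball of $\mathbb C^n$. Let $h:B^n\times[0,\infty)\to\mathbb C^n$ be an infinitesimal generator: for each $t\ge0$, $h(\cdot,t)$ is holomorphic on $B^n$, $h(0,t)=0$, $Dh(0,t)=A$ and $\Re\langle h(z,t),z\rangle>0$ for $z\ne0$; for each $z$, $h(z,\cdot)$ is measurable. Write $h(z,t)=Az+\sum_{k\ge2}H_k(z^k,t)$ for its homogeneous expansion. Let $v(z,s,t)\in B^n$ ($z\in B^n$, $t\ge s\ge0$) be the solution of $\partial v/\partial t=-h(v,t)$ for a.e. $t\ge s$, $v(z,s,s)=z$. All solutions of differential equations are understood to be locally absolutely continuous in $t$, locally uniformly in $z\in B^n$ where they depend on $z$. Let $\mathcal P^k(\mathbb C^n)$ be the space of homogeneous polynomial mappings $Q(z^k)$ of degree $k$ from $\mathbb C^n$ to $\mathbb C^n$, identified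 with symmetric $k$-linear mappings $Q$ and normed by the operator norm. For $2\le k\le n_0$ let $F_k:[0,\infty)\to\mathcal P^k(\mathbb C^n)$ be solutions of the coefficient equations $$\frac{dF_k}{dt}(z^k,t)=kF_k(Az,z^{k-1},t)-AF_k(z^k,t)+H_k(z^k,t)+\sum_{j=2}^{k-1}jF_j\big(H_{k-j+1}(z^{k-j+1},t),z^{j-1},t\big)\quad\text{for a.e. }t\ge0,$$ each polynomially bounded, i.e. $\|F_k(t)\|\le P_k(t)$ for $t\ge0$ with $P_k$ a polynomial. Then: (i) For every $s\ge0$ the limit $$g(z,s)=\lim_{t\to\infty}e^{tA}\Big(v(z,s,t)+\sum_{k=2}^{n_0}F_k\big(v(z,s,t)^k,t\big)\Big)$$ exists locally uniformly in $z\in B^n$. The mapping $g$ is a Loewner chain ($g(\cdot,t)$ is holomorphic and injective on $B^n$, and for $0\le s\le t$ there is a holomorphic self-map $w$ of $B^n$ with $w(0)=0$ and $g(\cdot,s)=g(w(\cdot),t)$); it solves $\frac{\partial g}{\partial t}(z,t)=Dg(z,t)h(z,t)$ for a.e. $t\ge0$ and all $z\in B^n$; and it is polynomially bounded: for every compact $K\subset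 B^n$ there are a constant $C_K$ and a polynomial $P$ with $\|e^{-tA}g(z,t)\|\le C_KP(t)$ for $z\in K$, $t\ge0$. (ii) For every polynomial $F$ and every $\epsilon>0$ there is a polynomial $Q=Q_{\epsilon,A,F}$ of the same degree as $F$ (constants, including $0$, being of degree $0$), depending only on $\epsilon$, $A$ and $F$, such that whenever, in addition, $\|F_k(t)\|\le F(t)$ for $2\le k\le n_0$, $t\ge0$, then $$\|e^{-tA}g(z,t)\|\le\frac{Q(t)}{(1-\|z\|)^{2k_+(A)/m(A)+\epsilon}},\qquad z\in B^n,\ t\ge0.$$ (iii) $g$ has an expansion $g(z,t)=e^{tA}\big(z+\sum_{k=2}^\infty G_k(z^k,t)\big)$ with $G_k(\cdot,t)\in\mathcal P^k(\mathbb C^n)$, and in every such expansion $G_k=F_k$ for $k=2,\dots,n_0$. -/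

import Mathlib

open Set Filter Topology MeasureTheory

namespace Loewner

noncomputable section

/-- `ℂⁿ` with its Euclidean norm. -/
abbrev Cn (n : ℕ) : Type := EuclideanSpace ℂ (Fin n)

/-- The open unit ball `Bⁿ`. -/
abbrev unitBall (n : ℕ) : Set (Cn n) := Metric.ball 0 1

/-- `m(A) = min {Re ⟨A z, z⟩ : ‖z‖ = 1}`. -/
def lowerIndex {n : ℕ} (A : Cn n →L[ℂ] Cn n) : ℝ :=
  sInf {x : ℝ | ∃ z : Cn n, ‖z‖ = 1 ∧ x = (inner ℂ z (A z)).re}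

/-- `k₊(A) = max {Re μ : μ ∈ σ(A)}`. -/
def upperIndex {n : ℕ} (A : Cn n →L[ℂ] Cn n) : ℝ :=
  sSup (Complex.re '' spectrum ℂ A)

/-- `n₀ = [k₊(A) / m(A)]`. -/
def criticalDegree {n : ℕ} (A : Cn n →L[ℂ] Cn n) : ℕ :=
  ⌊upperIndex A / lowerIndex A⌋₊

/-- The operator `e^{tA}`. -/
def expOp {n : ℕ} (A : Cn n →L[ℂ] Cn n) (t : ℝ) : Cn n →L[ℂ] Cn n :=
  NormedSpace.exp (t • A)

/-- The space of homogeneous polynomial mappings of degree `k` from `ℂⁿ` to `ℂⁿ`, each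
represented by its symmetric `k`-linear mapping, with the operator norm. -/
def HomPoly (n k : ℕ) : Submodule ℂ (Cn n [×k]→L[ℂ] Cn n) where
  carrier := {Q | ∀ (σ : Equiv.Perm (Fin k)) (x : Fin k → Cn n), Q (fun i => x (σ i)) = Q x}
  add_mem' := by
    intro P Q hP hQ σ x
    simp [hP σ x, hQ σ x]
  zero_mem' := by
    intro σ x
    simp
  smul_mem' := by
    intro c Q hQ σ x
    simp [hQ σ x]

/-- The value `Q(z^k)` of the polynomial. -/
def homDiag {n k : ℕ} (Q : HomPoly n k) (z : Cn n) : Cn n :=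
  Q.1 (fun _ => z)

/-- The value `Q(w, z^{k-1})` of the symmetric multilinear mapping (for `k ≥ 1`). -/
def homPolar {n k : ℕ} (Q : HomPoly n k) (w z : Cn n) : Cn n :=
  Q.1 (fun i => if (i : ℕ) = 0 then w else z)

/-- The value at `z` of the degree-`k` term of the Taylor expansion of `f` at `0`. -/
def taylorTerm {n : ℕ} (f : Cn n → Cn n) (k : ℕ) (z : Cn n) : Cn n :=
  ((k.factorial : ℂ)⁻¹) • iteratedFDeriv ℂ k f 0 (fun _ => z)

/-- The class `N_A`. -/
structure IsClassN {n : ℕ} (A : Cn n →L[ℂ] Cn n) (h : Cn n → Cn n) : Prop where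
  holo : DifferentiableOn ℂ h (unitBall n)
  map_zero : h 0 = 0
  re_pos : ∀ z ∈ unitBall n, z ≠ 0 → 0 < (inner ℂ z (h z)).re
  deriv_zero : fderiv ℂ h 0 = A

/-- Infinitesimal generators: the class `H_A(Bⁿ)`. Only times `t ≥ 0` matter; measurability
is Lebesgue measurability. -/
structure IsGenerator {n : ℕ} (A : Cn n →L[ℂ] Cn n) (h : Cn n → ℝ → Cn n) : Prop where
  classN : ∀ t : ℝ, 0 ≤ t → IsClassN A (fun z => h z t)
  measurable : ∀ z ∈ unitBall n, AEMeasurable (h z) (volume.restrict (Ici (0 : ℝ)))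

/-- `f(z, ·)` is locally absolutely continuous on `[s, ∞)`, locally uniformly with respect to
`z ∈ Bⁿ`. A member `I` of `disjWithin s T` is a list of `I.1` disjoint subintervals of `[s, T]`,
the `i`-th one having end points `(I.2 i).1` and `(I.2 i).2`. -/
def IsLocallyAC {n : ℕ} (f : Cn n → ℝ → Cn n) (s : ℝ) : Prop :=
  ∀ K ⊆ unitBall n, IsCompact K → ∀ T : ℝ, s ≤ T → ∀ ε > 0, ∃ δ > 0,
    ∀ I ∈ AbsolutelyContinuousOnInterval.disjWithin s T,
      ∑ i ∈ Finset.range I.1, dist (I.2 i).1 (I.2 i).2 < δ →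
      ∀ z ∈ K, ∑ i ∈ Finset.range I.1, dist (f z (I.2 i).1) (f z (I.2 i).2) < ε

/-- `v = v(z, s, t)` solves `∂v/∂t = -h(v, t)` for a.e. `t ≥ s`, `v(z, s, s) = z`. -/
structure IsTransitionSolution {n : ℕ} (h : Cn n → ℝ → Cn n) (v : Cn n → ℝ → ℝ → Cn n) :
    Prop where
  mem_ball : ∀ z ∈ unitBall n, ∀ s t : ℝ, 0 ≤ s → s ≤ t → v z s t ∈ unitBall n
  initial : ∀ z ∈ unitBall n, ∀ s : ℝ, 0 ≤ s → v z s s = z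
  locallyAC : ∀ s : ℝ, 0 ≤ s → IsLocallyAC (fun z t => v z s t) s
  ode : ∀ z ∈ unitBall n, ∀ s : ℝ, 0 ≤ s →
    ∀ᵐ t : ℝ, s ≤ t → HasDerivAt (fun τ => v z s τ) (-(h (v z s t) t)) t

/-- `f` solves the Loewner chain equation `∂f/∂t = Df(z, t) h(z, t)` for a.e. `t ≥ 0` and all
`z ∈ Bⁿ`. -/
structure IsLoewnerSolution {n : ℕ} (h f : Cn n → ℝ → Cn n) : Prop where
  holo : ∀ t : ℝ, 0 ≤ t → DifferentiableOn ℂ (fun z => f z t) (unitBall n)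
  locallyAC : IsLocallyAC f 0
  pde : ∀ᵐ t : ℝ, 0 ≤ t → ∀ z ∈ unitBall n,
    HasDerivAt (fun τ => f z τ) (fderiv ℂ (fun w => f w t) z (h z t)) t

/-- Loewner chains: `f(·, t)` is univalent, and `f(·, s)` is subordinate to `f(·, t)`. -/
structure IsLoewnerChain {n : ℕ} (f : Cn n → ℝ → Cn n) : Prop where
  holo : ∀ t : ℝ, 0 ≤ t → DifferentiableOn ℂ (fun z => f z t) (unitBall n)
  inj : ∀ t : ℝ, 0 ≤ t → InjOn (fun z => f z t) (unitBall n)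
  subord : ∀ s t : ℝ, 0 ≤ s → s ≤ t → ∃ w : Cn n → Cn n,
    DifferentiableOn ℂ w (unitBall n) ∧ MapsTo w (unitBall n) (unitBall n) ∧ w 0 = 0 ∧
      ∀ z ∈ unitBall n, f z s = f (w z) t

/-- `{e^{-tA} f(·, t)}` is locally polynomially bounded. -/
def IsPolyBounded {n : ℕ} (A : Cn n →L[ℂ] Cn n) (f : Cn n → ℝ → Cn n) : Prop :=
  ∀ K ⊆ unitBall n, IsCompact K → ∃ (C : ℝ) (P : Polynomial ℝ),
    ∀ z ∈ K, ∀ t : ℝ, 0 ≤ t → ‖expOp A (-t) (f z t)‖ ≤ C * P.eval t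

/-- `B_k(Q)(z^k) = k Q(Az, z^{k-1}) - A Q(z^k)`. -/
def coeffB {n k : ℕ} (A : Cn n →L[ℂ] Cn n) (Q : HomPoly n k) (z : Cn n) : Cn n :=
  (k : ℂ) • homPolar Q (A z) z - A (homDiag Q z)

/-- `N_k(z^k, t) = H_k(z^k, t) + ∑_{j=2}^{k-1} j F_j(H_{k-j+1}(z^{k-j+1}, t), z^{j-1}, t)`, where
`H_k(·, t)` is the degree-`k` Taylor term of `h(·, t)`. -/
def coeffN {n : ℕ} (h : Cn n → ℝ → Cn n) (F : ∀ k : ℕ, ℝ → HomPoly n k) (k : ℕ) (t : ℝ)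
    (z : Cn n) : Cn n :=
  taylorTerm (fun w => h w t) k z +
    ∑ j ∈ Finset.Ico 2 k,
      (j : ℂ) • homPolar (F j t) (taylorTerm (fun w => h w t) (k - j + 1) z) z

/-- `F_k : [0, ∞) → P^k(ℂⁿ)`, `2 ≤ k ≤ N`, are locally absolutely continuous solutions of the
coefficient equations `dF_k/dt = B_k F_k + N_k`, a.e. `t ≥ 0`. -/
def IsCoeffSolution {n : ℕ} (A : Cn n →L[ℂ] Cn n) (h : Cn n → ℝ → Cn n) (N : ℕ)
    (F : ∀ k : ℕ, ℝ → HomPoly n k) : Prop :=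
  ∀ k : ℕ, 2 ≤ k → k ≤ N →
    (∀ T : ℝ, 0 ≤ T → AbsolutelyContinuousOnInterval (F k) 0 T) ∧
    ∀ᵐ t : ℝ, 0 ≤ t → DifferentiableAt ℝ (F k) t ∧
      ∀ z : Cn n, homDiag (deriv (F k) t) z = coeffB A (F k t) z + coeffN h F k t z

/-- Each of the `F_k`, `2 ≤ k ≤ N`, is polynomially bounded. -/
def IsCoeffPolyBounded {n : ℕ} (N : ℕ) (F : ∀ k : ℕ, ℝ → HomPoly n k) : Prop :=
  ∀ k : ℕ, 2 ≤ k → k ≤ N → ∃ P : Polynomial ℝ, ∀ t : ℝ, 0 ≤ t → ‖F k t‖ ≤ P.eval t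

/-- The polynomial `P` is a bound for `F_k`, `2 ≤ k ≤ N`. -/
def IsCoeffBound {n : ℕ} (N : ℕ) (F : ∀ k : ℕ, ℝ → HomPoly n k) (P : Polynomial ℝ) : Prop :=
  ∀ k : ℕ, 2 ≤ k → k ≤ N → ∀ t : ℝ, 0 ≤ t → ‖F k t‖ ≤ P.eval t

/-- For every `s ≥ 0`,
`g(z, s) = lim_{t → ∞} e^{tA} (v(z, s, t) + ∑_{k=2}^{N} F_k(v(z, s, t)^k, t))`,
locally uniformly in `z ∈ Bⁿ`. -/
def IsLimitChain {n : ℕ} (A : Cn n →L[ℂ] Cn n) (v : Cn n → ℝ → ℝ → Cn n) (N : ℕ)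
    (F : ∀ k : ℕ, ℝ → HomPoly n k) (g : Cn n → ℝ → Cn n) : Prop :=
  ∀ s : ℝ, 0 ≤ s → TendstoLocallyUniformlyOn
    (fun (t : ℝ) (z : Cn n) =>
      expOp A t (v z s t + ∑ k ∈ Finset.Icc 2 N, homDiag (F k t) (v z s t)))
    (fun z => g z s) atTop (unitBall n)

/-- `g(z, t) = e^{tA} (z + ∑_{k=2}^∞ G_k(z^k, t))` for `z ∈ Bⁿ`, `t ≥ 0`. -/
def HasExpansion {n : ℕ} (A : Cn n →L[ℂ] Cn n) (g : Cn n → ℝ → Cn n)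
    (G : ∀ k : ℕ, ℝ → HomPoly n k) : Prop :=
  ∀ t : ℝ, 0 ≤ t → ∀ z ∈ unitBall n, ∃ S : Cn n,
    HasSum (fun k : ℕ => homDiag (G (k + 2) t) z) S ∧ g z t = expOp A t (z + S)

end

end Loewner

/-! Put Φ(t) = e^{tA}(v + ∑ F_k(v^k, t)) with v = v(z, s, t). Differentiating along the flow, the
coefficient equations cancel every Taylor term of `h` of degree at most n₀, so Φ'(t) = e^{tA} R(t,
v), where R consists of Taylor tails and is O((1 + t)^d ‖v‖^{n₀+1}) for ‖v‖ ≤ 1/2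
(`flowRemainder_eq`, `exists_norm_flowRemainder_le`). Harnack's inequality on complex lines makes v
decay like e^{-m(t-s)} (`IsFlowLine.decay`), and Gelfand's formula bounds e^{tA} by a multiple of
e^{(k₊+η)t} (`exists_norm_expOp_le`). Since k₊ < m(n₀ + 1), Φ' is exponentially small and Φ
converges (`exists_norm_chainApprox_sub_le`). Starting points outside the half ball are first
carried into it by the flow.

The same estimate, integrated from time s, shows that e^{-sA} g(·, s) agrees with z + ∑ F_k(z^k, s)
up to O(‖z‖^{n₀+1}); this identifies the coefficients. Measuring the time needed to reach the half
ball turns exponential growth in time into the power of 1/(1 - ‖z‖) in (ii), with constants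
independent of the generator (`exists_growth_bound`).

The semigroup property of v passes to the limit as g(v(z, s, t), t) = g(z, s), which is the
subordination. Univalence holds because g(·, t) is injective on a ball whose radius shrinks only
polynomially in t, whereas the flow contracts exponentially. The differential equation comes from
differentiating the constant t ↦ g(v(z, s, t), t). Countably many flow lines give a single null set
of times, and Cauchy estimates for the increments of g extend the equation to all points. -/

namespace Loewner

/-! ### Absolutely continuous curves: composition, mean value and Grönwall inequalities. -/

section AbsoluteContinuity

theorem _root_.LipschitzOnWith.comp_absolutelyContinuousOnInterval {X Y : Type*} [PseudoMetricSpace X]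
    [PseudoMetricSpace Y] {Ψ : X → Y} {K : NNReal} {S : Set X} (hΨ : LipschitzOnWith K Ψ S)
    {f : ℝ → X} {a b : ℝ} (hf : AbsolutelyContinuousOnInterval f a b)
    (hmaps : MapsTo f (uIcc a b) S) :
    AbsolutelyContinuousOnInterval (fun t => Ψ (f t)) a b := by
  rw [absolutelyContinuousOnInterval_iff] at hf ⊢
  intro ε hε
  obtain ⟨δ, hδ, H⟩ := hf (ε / (K + 1)) (by positivity)
  refine ⟨δ, hδ, fun I hI hlen => ?_⟩
  have h1 := H I hI hlen
  have h2 : ∑ i ∈ Finset.range I.1, dist (Ψ (f (I.2 i).1)) (Ψ (f (I.2 i).2)) ≤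
      ∑ i ∈ Finset.range I.1, (K + 1) * dist (f (I.2 i).1) (f (I.2 i).2) := by
    refine Finset.sum_le_sum fun i hi => ?_
    have := hΨ.dist_le_mul _ (hmaps (hI.1 i hi).1) _ (hmaps (hI.1 i hi).2)
    have h0 : 0 ≤ dist (f (I.2 i).1) (f (I.2 i).2) := dist_nonneg
    linarith
  rw [← Finset.mul_sum] at h2
  refine h2.trans_lt ?_
  rwa [lt_div_iff₀' (by positivity)] at h1

theorem _root_.LocallyLipschitzOn.comp_absolutelyContinuousOnInterval {X Y : Type*} [MetricSpace X]
    [MetricSpace Y] {Ψ : X → Y} {S : Set X} (hΨ : LocallyLipschitzOn S Ψ)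
    {f : ℝ → X} {a b : ℝ} (hf : AbsolutelyContinuousOnInterval f a b)
    (hfc : ContinuousOn f (uIcc a b)) (hmaps : MapsTo f (uIcc a b) S) :
    AbsolutelyContinuousOnInterval (fun t => Ψ (f t)) a b := by
  obtain ⟨K, hK⟩ := (hΨ.mono hmaps.image_subset).exists_lipschitzOnWith_of_compact
    (isCompact_uIcc.image_of_continuousOn hfc)
  exact LipschitzOnWith.comp_absolutelyContinuousOnInterval hK hf (mapsTo_image _ _)

/-- A function of class `C¹` around the range of an absolutely continuous curve preserves
absolute continuity. -/
theorem comp_absolutelyContinuousOnInterval_of_contDiffAt {X Y : Type*} [NormedAddCommGroup X]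
    [NormedSpace ℝ X] [NormedAddCommGroup Y] [NormedSpace ℝ Y] {Ψ : X → Y} {f : ℝ → X} {a b : ℝ}
    (hf : AbsolutelyContinuousOnInterval f a b)
    (hΨ : ∀ t ∈ uIcc a b, ContDiffAt ℝ 1 Ψ (f t)) :
    AbsolutelyContinuousOnInterval (fun t => Ψ (f t)) a b := by
  refine LocallyLipschitzOn.comp_absolutelyContinuousOnInterval (S := f '' uIcc a b) ?_ hf
    hf.continuousOn (mapsTo_image _ _)
  rintro _ ⟨t, ht, rfl⟩
  obtain ⟨K, S, hS, hK⟩ := (hΨ t ht).exists_lipschitzOnWith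
  exact ⟨K, S, mem_nhdsWithin_of_mem_nhds hS, hK⟩

theorem _root_.AbsolutelyContinuousOnInterval.prodMk {X Y : Type*} [PseudoMetricSpace X]
    [PseudoMetricSpace Y] {f : ℝ → X} {g : ℝ → Y} {a b : ℝ}
    (hf : AbsolutelyContinuousOnInterval f a b) (hg : AbsolutelyContinuousOnInterval g a b) :
    AbsolutelyContinuousOnInterval (fun t => (f t, g t)) a b := by
  rw [absolutelyContinuousOnInterval_iff] at hf hg ⊢
  intro ε hε
  obtain ⟨δ, hδ, H⟩ := hf (ε / 2) (by positivity)
  obtain ⟨δ', hδ', H'⟩ := hg (ε / 2) (by positivity)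
  refine ⟨min δ δ', lt_min hδ hδ', fun I hI hlen => ?_⟩
  have h1 := H I hI (hlen.trans_le (min_le_left _ _))
  have h2 := H' I hI (hlen.trans_le (min_le_right _ _))
  have h3 : ∑ i ∈ Finset.range I.1,
      dist (f (I.2 i).1, g (I.2 i).1) (f (I.2 i).2, g (I.2 i).2) ≤
      ∑ i ∈ Finset.range I.1,
        (dist (f (I.2 i).1) (f (I.2 i).2) + dist (g (I.2 i).1) (g (I.2 i).2)) := by
    refine Finset.sum_le_sum fun i _ => ?_
    rw [Prod.dist_eq]
    exact max_le_add_of_nonneg dist_nonneg dist_nonneg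
  rw [Finset.sum_add_distrib] at h3
  linarith

theorem _root_.AbsolutelyContinuousOnInterval.norm {F : Type*} [SeminormedAddCommGroup F] {f : ℝ → F}
    {a b : ℝ} (hf : AbsolutelyContinuousOnInterval f a b) :
    AbsolutelyContinuousOnInterval (fun t => ‖f t‖) a b :=
  LipschitzOnWith.comp_absolutelyContinuousOnInterval (lipschitzWith_one_norm.lipschitzOnWith)
    hf (mapsTo_univ _ _)

theorem _root_.ContDiff.absolutelyContinuousOnInterval {f : ℝ → ℝ} (hf : ContDiff ℝ 1 f) (a b : ℝ) :
    AbsolutelyContinuousOnInterval f a b :=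
  hf.contDiffOn.absolutelyContinuousOnInterval

/-- An absolutely continuous function with nonpositive derivative almost everywhere decreases. -/
theorem _root_.AbsolutelyContinuousOnInterval.le_of_ae_hasDerivAt_nonpos {f : ℝ → ℝ} {a b : ℝ}
    (hf : AbsolutelyContinuousOnInterval f a b) (hab : a ≤ b)
    (h : ∀ᵐ t : ℝ, t ∈ Ioo a b → ∀ f', HasDerivAt f f' t → f' ≤ 0) : f b ≤ f a := by
  have h1 := hf.integral_deriv_eq_sub
  have h2 := hf.ae_differentiableAt
  have h3 : ∫ t in a..b, deriv f t ≤ 0 := by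
    rw [intervalIntegral.integral_of_le hab, integral_Ioc_eq_integral_Ioo]
    refine setIntegral_nonpos_of_ae_restrict ?_
    rw [EventuallyLE, ae_restrict_iff' measurableSet_Ioo]
    filter_upwards [h, h2] with t ht ht2 hmem
    refine ht hmem _ (ht2 ?_).hasDerivAt
    rw [uIcc_of_le hab]
    exact Ioo_subset_Icc_self hmem
  linarith

/-- The reverse triangle inequality for slopes. The norm is not differentiable at the origin, but
along an absolutely continuous curve ‖f‖ is absolutely continuous, hence differentiable almost
everywhere; this bounds its derivative with no case distinction at zeros of f. -/
theorem abs_le_norm_of_hasDerivAt_norm {F : Type*} [NormedAddCommGroup F] [NormedSpace ℝ F]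
    {f : ℝ → F} {f' : F} {x t : ℝ} (hf : HasDerivAt f f' t)
    (hn : HasDerivAt (fun τ => ‖f τ‖) x t) : |x| ≤ ‖f'‖ := by
  have h1 := (hasDerivAt_iff_tendsto_slope.1 hf).norm
  have h2 := (hasDerivAt_iff_tendsto_slope.1 hn).norm
  refine le_of_tendsto_of_tendsto h2 h1 (Eventually.of_forall fun τ => ?_)
  simp only [slope, vsub_eq_sub, norm_smul, norm_inv, Real.norm_eq_abs]
  gcongr
  simpa using abs_norm_sub_norm_le (f τ) (f t)

/-- Mean value inequality for absolutely continuous curves. -/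
theorem _root_.AbsolutelyContinuousOnInterval.norm_sub_le {F : Type*} [NormedAddCommGroup F]
    [NormedSpace ℝ F] {f : ℝ → F} {B B' : ℝ → ℝ} {a b : ℝ}
    (hf : AbsolutelyContinuousOnInterval f a b) (hab : a ≤ b) (hB : ContDiff ℝ 1 B)
    (hB' : ∀ t, HasDerivAt B (B' t) t)
    (h : ∀ᵐ t : ℝ, t ∈ Ioo a b → ∃ f', HasDerivAt f f' t ∧ ‖f'‖ ≤ B' t) :
    ‖f b - f a‖ ≤ B b - B a := by
  have hconst : AbsolutelyContinuousOnInterval (fun _ : ℝ => f a) a b := by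
    rw [absolutelyContinuousOnInterval_iff]
    exact fun ε hε => ⟨1, one_pos, fun I _ _ => by simpa using hε⟩
  have h1 := (hf.sub hconst).norm.sub (ContDiff.absolutelyContinuousOnInterval hB a b)
  have h2 := h1.le_of_ae_hasDerivAt_nonpos hab (by
    filter_upwards [h] with t ht hmem x hx
    obtain ⟨f', hf', hle⟩ := ht hmem
    have h3 : HasDerivAt (fun τ => ‖f τ - f a‖) (x + B' t) t := by
      have := hx.add (hB' t)
      refine this.congr_of_eventuallyEq (Eventually.of_forall fun τ => ?_)
      simp
    have h4 := abs_le_norm_of_hasDerivAt_norm (hf'.sub_const (f a)) h3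
    have := le_abs_self (x + B' t)
    linarith)
  simp only [Pi.sub_apply, sub_self, norm_zero] at h2
  linarith

/-- Grönwall inequality for absolutely continuous curves. -/
theorem _root_.AbsolutelyContinuousOnInterval.norm_le_gronwall {F : Type*} [NormedAddCommGroup F]
    [NormedSpace ℝ F] {f : ℝ → F} {L c a b : ℝ} (hL : 0 ≤ L) (hc : 0 ≤ c)
    (hf : AbsolutelyContinuousOnInterval f a b) (hab : a ≤ b)
    (h : ∀ᵐ t : ℝ, t ∈ Ioo a b → ∃ f', HasDerivAt f f' t ∧ ‖f'‖ ≤ L * ‖f t‖ + c) :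
    ‖f b‖ ≤ Real.exp (L * (b - a)) * (‖f a‖ + c * (b - a)) := by
  -- The nonincreasing quantity is e^{-L(t-a)} ‖f(t)‖ - c(t-a); the factor multiplying c in its
  -- derivative is at most 1 and is discarded.
  have hexp : ContDiff ℝ 1 (fun t : ℝ => Real.exp (-(L * (t - a)))) := by fun_prop
  have hlin : ContDiff ℝ 1 (fun t : ℝ => c * (t - a)) := by fun_prop
  have h1 := ((ContDiff.absolutelyContinuousOnInterval hexp a b).mul hf.norm).sub
    (ContDiff.absolutelyContinuousOnInterval hlin a b)
  have h2 := h1.le_of_ae_hasDerivAt_nonpos hab (by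
    filter_upwards [h, hf.norm.ae_differentiableAt] with t ht hdiff hmem x hx
    obtain ⟨f', hf', hle⟩ := ht hmem
    have hd := (hdiff (by rw [uIcc_of_le hab]; exact Ioo_subset_Icc_self hmem)).hasDerivAt
    set y := deriv (fun t => ‖f t‖) t
    have hy : y ≤ L * ‖f t‖ + c :=
      (le_abs_self y).trans ((abs_le_norm_of_hasDerivAt_norm hf' hd).trans hle)
    have he : HasDerivAt (fun t : ℝ => Real.exp (-(L * (t - a))))
        (Real.exp (-(L * (t - a))) * (-(L * 1))) t :=
      ((((hasDerivAt_id t).sub_const a).const_mul L).neg).exp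
    have hl : HasDerivAt (fun t : ℝ => c * (t - a)) (c * 1) t :=
      ((hasDerivAt_id t).sub_const a).const_mul c
    have hx' := hx.unique ((he.mul hd).sub hl)
    have hpos := Real.exp_pos (-(L * (t - a)))
    have hle1 : Real.exp (-(L * (t - a))) ≤ 1 := by
      rw [Real.exp_le_one_iff]
      have := mul_nonneg hL (sub_nonneg.2 hmem.1.le)
      linarith
    rw [hx']
    nlinarith [mul_le_mul_of_nonneg_left hy hpos.le, mul_le_mul_of_nonneg_right hle1 hc])
  simp only [Pi.sub_apply, Pi.mul_apply, sub_self, mul_zero, neg_zero, Real.exp_zero, one_mul,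
    sub_zero] at h2
  have h3 : Real.exp (-(L * (b - a))) * ‖f b‖ ≤ ‖f a‖ + c * (b - a) := by linarith
  rw [Real.exp_neg, inv_mul_le_iff₀ (Real.exp_pos _)] at h3
  exact h3

/-- Reverse Grönwall inequality for absolutely continuous curves. -/
theorem _root_.AbsolutelyContinuousOnInterval.norm_ge_gronwall {F : Type*} [NormedAddCommGroup F]
    [NormedSpace ℝ F] {f : ℝ → F} {L a b : ℝ}
    (hf : AbsolutelyContinuousOnInterval f a b) (hab : a ≤ b)
    (h : ∀ᵐ t : ℝ, t ∈ Ioo a b → ∃ f', HasDerivAt f f' t ∧ ‖f'‖ ≤ L * ‖f t‖) :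
    ‖f a‖ ≤ Real.exp (L * (b - a)) * ‖f b‖ := by
  have hexp : ContDiff ℝ 1 (fun t : ℝ => Real.exp (L * (t - a))) := by fun_prop
  have h1 := ((ContDiff.absolutelyContinuousOnInterval hexp a b).mul hf.norm).neg
  have h2 := h1.le_of_ae_hasDerivAt_nonpos hab (by
    filter_upwards [h, hf.norm.ae_differentiableAt] with t ht hdiff hmem x hx
    obtain ⟨f', hf', hle⟩ := ht hmem
    have hd := (hdiff (by rw [uIcc_of_le hab]; exact Ioo_subset_Icc_self hmem)).hasDerivAt
    set y := deriv (fun t => ‖f t‖) t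
    have hy : -y ≤ L * ‖f t‖ :=
      (neg_le_abs y).trans ((abs_le_norm_of_hasDerivAt_norm hf' hd).trans hle)
    have he : HasDerivAt (fun t : ℝ => Real.exp (L * (t - a)))
        (Real.exp (L * (t - a)) * (L * 1)) t :=
      (((hasDerivAt_id t).sub_const a).const_mul L).exp
    have hx' := hx.unique (he.mul hd).neg
    have hpos := Real.exp_pos (L * (t - a))
    rw [hx']
    nlinarith [mul_le_mul_of_nonneg_left hy hpos.le])
  simpa using h2

end AbsoluteContinuity

/-! ### Holomorphic maps between finite-dimensional spaces: Cauchy estimates, Weierstrass,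
smoothness. -/

section SeveralComplexVariables

variable {E F : Type*} [NormedAddCommGroup E] [NormedSpace ℂ E] [NormedAddCommGroup F]
  [NormedSpace ℂ F]

/-- A map that is linear up to second order, with arbitrarily small error, is differentiable. -/
theorem differentiableAt_of_approx_linear [FiniteDimensional ℂ E] [FiniteDimensional ℂ F]
    {f : E → F} {z : E} {K C ρ : ℝ} (hρ : 0 < ρ)
    (h : ∀ ε > 0, ∃ L : E →L[ℂ] F, ‖L‖ ≤ K ∧
      ∀ e, ‖e‖ < ρ → ‖f (z + e) - f z - L e‖ ≤ C * ‖e‖ ^ 2 + ε) :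
    DifferentiableAt ℂ f z := by
  have hpos : ∀ k : ℕ, (0 : ℝ) < 1 / ((k : ℝ) + 1) := fun k => by positivity
  choose L hLK hL using fun k : ℕ => h (1 / ((k : ℝ) + 1)) (hpos k)
  have : ProperSpace (E →L[ℂ] F) := FiniteDimensional.proper ℂ _
  -- The uniform bound K keeps the approximate derivatives in a compact set of operators; a limit
  -- point is the derivative.
  obtain ⟨L₀, -, φ, hφ, hlim⟩ := (isCompact_closedBall (0 : E →L[ℂ] F) K).tendsto_subseq
    (x := L) (fun k => by simpa using hLK k)
  have key : ∀ e, ‖e‖ < ρ → ‖f (z + e) - f z - L₀ e‖ ≤ C * ‖e‖ ^ 2 := by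
    intro e he
    have h1 : Tendsto (fun k => ‖f (z + e) - f z - L (φ k) e‖) atTop
        (𝓝 ‖f (z + e) - f z - L₀ e‖) := by
      have : Tendsto (fun k => (L (φ k)) e) atTop (𝓝 (L₀ e)) :=
        ((ContinuousLinearMap.apply ℂ F e).continuous.tendsto L₀).comp hlim
      exact (tendsto_const_nhds.sub this).norm
    have h2 : Tendsto (fun k => C * ‖e‖ ^ 2 + 1 / (((φ k : ℕ) : ℝ) + 1)) atTop
        (𝓝 (C * ‖e‖ ^ 2 + 0)) :=
      tendsto_const_nhds.add
        ((tendsto_one_div_add_atTop_nhds_zero_nat (𝕜 := ℝ)).comp hφ.tendsto_atTop)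
    rw [add_zero] at h2
    exact le_of_tendsto_of_tendsto h1 h2 (Eventually.of_forall fun k => hL (φ k) e he)
  refine ⟨L₀, hasFDerivAt_iff_isLittleO_nhds_zero.2 ?_⟩
  have hO : (fun e : E => f (z + e) - f z - L₀ e) =O[𝓝 0] fun e => ‖e‖ ^ 2 := by
    refine Asymptotics.IsBigO.of_bound C ?_
    filter_upwards [Metric.ball_mem_nhds (0 : E) hρ] with e he
    simpa using key e (by simpa using he)
  exact hO.trans_isLittleO (Asymptotics.isLittleO_norm_pow_id one_lt_two)

theorem norm_fderiv_le_of_ball {f : E → F} {c : E} {R M : ℝ} (hR : 0 < R)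
    (hd : DifferentiableOn ℂ f (Metric.ball c R)) (hM : ∀ z ∈ Metric.ball c R, ‖f z‖ ≤ M) :
    ‖fderiv ℂ f c‖ ≤ 2 * M / R := by
  refine Complex.norm_fderiv_le_div_of_mapsTo_ball hd (fun z hz => ?_) hR
  rw [mem_closedBall_iff_norm]
  have h1 := hM z hz
  have h2 := hM c (Metric.mem_ball_self hR)
  have := norm_sub_le (f z) (f c)
  linarith

/-- The second-order remainder is bounded by 2M + 2M on the ball and vanishes to higher than first
order at the centre, so the Schwarz lemma with higher-order vanishing gives the quadratic factor. -/
theorem norm_sub_sub_fderiv_le {f : E → F} {c e : E} {R M : ℝ} (he : ‖e‖ < R)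
    (hd : DifferentiableOn ℂ f (Metric.ball c R)) (hM : ∀ z ∈ Metric.ball c R, ‖f z‖ ≤ M) :
    ‖f (c + e) - f c - fderiv ℂ f c e‖ ≤ 4 * M * (‖e‖ / R) ^ 2 := by
  have hR : 0 < R := (norm_nonneg e).trans_lt he
  have hc := Metric.mem_ball_self (x := c) hR
  have hdc : DifferentiableAt ℂ f c := hd.differentiableAt (Metric.ball_mem_nhds c hR)
  have hfd := norm_fderiv_le_of_ball hR hd hM
  have hM0 : 0 ≤ M := (norm_nonneg _).trans (hM c hc)
  have key := Complex.dist_le_mul_div_pow_of_mapsTo_ball_of_isLittleO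
    (f := fun w => f w - f c - fderiv ℂ f c (w - c)) (c := c) (z := c + e) (R₁ := R)
    (R₂ := 4 * M) (n := 1) (hd := by
      refine (hd.sub_const _).sub ?_
      exact ((fderiv ℂ f c).differentiable.comp (differentiable_id.sub_const c)).differentiableOn)
    (h_maps := fun w hw => by
      have h1 := hM w hw
      have h2 := hM c hc
      have h3 : ‖fderiv ℂ f c (w - c)‖ ≤ 2 * M := by
        refine ((fderiv ℂ f c).le_opNorm _).trans ?_
        rw [mem_ball_iff_norm] at hw
        calc ‖fderiv ℂ f c‖ * ‖w - c‖ ≤ (2 * M / R) * R := by gcongr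
          _ = 2 * M := by field_simp
      have h4 := norm_sub_le (f w - f c) (fderiv ℂ f c (w - c))
      have h5 := norm_sub_le (f w) (f c)
      simp only [sub_self, map_zero, mem_closedBall_iff_norm, sub_zero]
      linarith)
    (hn := by
      simp only [sub_self, map_zero, sub_zero, pow_one]
      exact hdc.hasFDerivAt.isLittleO.norm_right)
    (hz := by simpa using he)
  simpa [dist_eq_norm] using key

theorem norm_sub_le_of_closedBall {f : E → F} {c : E} {r ρ M : ℝ} (hρ : 0 < ρ)
    (hd : DifferentiableOn ℂ f (Metric.ball c (r + ρ)))
    (hM : ∀ z ∈ Metric.ball c (r + ρ), ‖f z‖ ≤ M) {x y : E} (hx : x ∈ Metric.closedBall c r)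
    (hy : y ∈ Metric.closedBall c r) : ‖f y - f x‖ ≤ 2 * M / ρ * ‖y - x‖ := by
  have hsub : ∀ z ∈ Metric.closedBall c r, Metric.ball z ρ ⊆ Metric.ball c (r + ρ) := by
    intro z hz w hw
    rw [Metric.mem_ball] at hw ⊢
    rw [Metric.mem_closedBall] at hz
    linarith [dist_triangle w z c]
  refine (convex_closedBall c r).norm_image_sub_le_of_norm_fderiv_le (𝕜 := ℂ) (fun z hz => ?_)
    (fun z hz => ?_) hx hy
  · exact hd.differentiableAt (Filter.mem_of_superset (Metric.ball_mem_nhds z hρ) (hsub z hz))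
  · exact norm_fderiv_le_of_ball hρ (hd.mono (hsub z hz)) fun w hw => hM w (hsub z hz hw)

/-- Weierstrass theorem: a locally uniform limit of holomorphic maps is holomorphic. -/
theorem differentiableOn_of_tendstoLocallyUniformlyOn [FiniteDimensional ℂ E]
    [FiniteDimensional ℂ F] {ι : Type*} {l : Filter ι} [l.NeBot] {U : Set E} (hU : IsOpen U)
    {f : ι → E → F} {g : E → F} (hlim : TendstoLocallyUniformlyOn f g l U)
    (hf : ∀ᶠ i in l, DifferentiableOn ℂ (f i) U) : DifferentiableOn ℂ g U := by
  intro z hz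
  have : ProperSpace E := FiniteDimensional.proper ℂ E
  obtain ⟨R, hR, hRU⟩ := Metric.nhds_basis_closedBall.mem_iff.1 (hU.mem_nhds hz)
  have hunif := (tendstoLocallyUniformlyOn_iff_forall_isCompact hU).1 hlim _ hRU
    (isCompact_closedBall z R)
  rw [Metric.tendstoUniformlyOn_iff] at hunif
  obtain ⟨i₀, hi₀, hd₀⟩ := ((hunif 1 one_pos).and hf).exists
  obtain ⟨M, hM⟩ := (isCompact_closedBall z R).exists_bound_of_continuousOn
    (hd₀.continuousOn.mono hRU)
  refine DifferentiableAt.differentiableWithinAt ?_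
  refine differentiableAt_of_approx_linear (K := 2 * (M + 2) / R) (C := 4 * (M + 2) / R ^ 2)
    hR fun ε hε => ?_
  obtain ⟨i, ⟨hi, hi1⟩, hd⟩ :=
    (((hunif (ε / 2) (by positivity)).and (hunif 1 one_pos)).and hf).exists
  -- A bound common to all late indices: pass from `f i` to `g` and from `g` to the fixed `f i₀`, at
  -- cost 1 each.
  have hbd : ∀ w ∈ Metric.ball z R, ‖f i w‖ ≤ M + 2 := by
    intro w hw
    have hw := Metric.ball_subset_closedBall hw
    have h1 := hi₀ w hw
    have h2 := hi1 w hw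
    have h3 := hM w hw
    rw [dist_eq_norm] at h1 h2
    have : f i w = f i₀ w + (g w - f i₀ w) - (g w - f i w) := by abel
    rw [this]
    have h4 := norm_sub_le (f i₀ w + (g w - f i₀ w)) (g w - f i w)
    have h5 := norm_add_le (f i₀ w) (g w - f i₀ w)
    linarith
  have hdb : DifferentiableOn ℂ (f i) (Metric.ball z R) :=
    hd.mono (Metric.ball_subset_closedBall.trans hRU)
  refine ⟨fderiv ℂ (f i) z, norm_fderiv_le_of_ball hR hdb hbd, fun e he => ?_⟩
  have h1 := norm_sub_sub_fderiv_le he hdb hbd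
  have h2 := hi (z + e) (by simpa using he.le)
  have h3 := hi z (Metric.mem_closedBall_self hR.le)
  rw [dist_eq_norm] at h2 h3
  have h4 : g (z + e) - g z - fderiv ℂ (f i) z e =
      (f i (z + e) - f i z - fderiv ℂ (f i) z e) + (g (z + e) - f i (z + e))
        - (g z - f i z) := by abel
  rw [h4]
  have h5 := norm_sub_le ((f i (z + e) - f i z - fderiv ℂ (f i) z e) +
    (g (z + e) - f i (z + e))) (g z - f i z)
  have h6 := norm_add_le (f i (z + e) - f i z - fderiv ℂ (f i) z e) (g (z + e) - f i (z + e))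
  have h7 : 4 * (M + 2) * (‖e‖ / R) ^ 2 = 4 * (M + 2) / R ^ 2 * ‖e‖ ^ 2 := by
    rw [div_pow]; ring
  linarith

/-- Difference quotients with step 1/(k+1) are holomorphic and, by the quadratic remainder bound,
converge locally uniformly to the directional derivative; Weierstrass applies. Iterating this gives
every C^m. -/
theorem differentiableOn_fderiv_apply [FiniteDimensional ℂ E] [FiniteDimensional ℂ F] {U : Set E}
    (hU : IsOpen U) {f : E → F} (hf : DifferentiableOn ℂ f U) (e : E) :
    DifferentiableOn ℂ (fun z => fderiv ℂ f z e) U := by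
  intro z₀ hz₀
  have : ProperSpace E := FiniteDimensional.proper ℂ E
  obtain ⟨R', hR', hRU'⟩ := Metric.nhds_basis_closedBall.mem_iff.1 (hU.mem_nhds hz₀)
  obtain ⟨M, hM⟩ := (isCompact_closedBall z₀ R').exists_bound_of_continuousOn
    (hf.continuousOn.mono hRU')
  obtain ⟨R, hR, rfl⟩ : ∃ R, 0 < R ∧ R' = 2 * R := ⟨R' / 2, by positivity, by ring⟩
  have hsub : ∀ z ∈ Metric.ball z₀ R, Metric.ball z R ⊆ Metric.closedBall z₀ (2 * R) := by
    intro z hz w hw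
    rw [Metric.mem_ball] at hz hw
    rw [Metric.mem_closedBall]
    linarith [dist_triangle w z z₀]
  have hη : Tendsto (fun k : ℕ => 1 / ((k : ℝ) + 1)) atTop (𝓝 0) :=
    tendsto_one_div_add_atTop_nhds_zero_nat
  have hsmall : ∀ δ > 0, ∀ᶠ k : ℕ in atTop, 1 / ((k : ℝ) + 1) * ‖e‖ < δ := by
    intro δ hδ
    have := hη.mul_const ‖e‖
    rw [zero_mul] at this
    exact this.eventually_lt_const hδ
  have hnorm : ∀ k : ℕ, ‖((1 / ((k : ℝ) + 1) : ℝ) : ℂ) • e‖ = 1 / ((k : ℝ) + 1) * ‖e‖ := by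
    intro k
    rw [norm_smul, Complex.norm_real, Real.norm_of_nonneg (by positivity)]
  have hz₀' : z₀ ∈ Metric.ball z₀ R := Metric.mem_ball_self hR
  have key : DifferentiableOn ℂ (fun z => fderiv ℂ f z e) (Metric.ball z₀ R) := by
    refine differentiableOn_of_tendstoLocallyUniformlyOn (l := (atTop : Filter ℕ))
      Metric.isOpen_ball
      (f := fun k z => ((1 / ((k : ℝ) + 1) : ℝ) : ℂ)⁻¹ •
        (f (z + ((1 / ((k : ℝ) + 1) : ℝ) : ℂ) • e) - f z)) ?_ ?_
    · refine TendstoUniformlyOn.tendstoLocallyUniformlyOn ?_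
      rw [Metric.tendstoUniformlyOn_iff]
      intro ε hε
      have hlim : Tendsto (fun k : ℕ => 1 / ((k : ℝ) + 1) * (4 * M * (‖e‖ / R) ^ 2)) atTop
          (𝓝 0) := by simpa using hη.mul_const (4 * M * (‖e‖ / R) ^ 2)
      filter_upwards [hsmall R hR, hlim.eventually_lt_const hε] with k hk hk2 z hz
      set η : ℝ := 1 / ((k : ℝ) + 1) with hηdef
      have hηpos : 0 < η := by positivity
      have h1 := norm_sub_sub_fderiv_le (f := f) (c := z) (e := (η : ℂ) • e) (R := R) (M := M)
        (by rw [hnorm]; exact hk) (hf.mono ((hsub z hz).trans hRU'))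
        (fun w hw => hM w (hsub z hz hw))
      rw [hnorm] at h1
      have hη0 : (η : ℂ) ≠ 0 := by exact_mod_cast hηpos.ne'
      have h2 : fderiv ℂ f z e - (η : ℂ)⁻¹ • (f (z + (η : ℂ) • e) - f z) =
          -((η : ℂ)⁻¹ • (f (z + (η : ℂ) • e) - f z - fderiv ℂ f z ((η : ℂ) • e))) := by
        rw [map_smul, smul_sub _ _ ((η : ℂ) • fderiv ℂ f z e), inv_smul_smul₀ hη0]
        abel
      rw [dist_eq_norm, h2, norm_neg, norm_smul, norm_inv, Complex.norm_real,
        Real.norm_of_nonneg hηpos.le]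
      refine lt_of_le_of_lt ?_ hk2
      rw [inv_mul_le_iff₀ hηpos]
      refine h1.trans_eq ?_
      rw [mul_div_assoc]; ring
    · filter_upwards [hsmall R hR] with k hk
      have hmono := hf.mono hRU'
      refine DifferentiableOn.const_smul ?_ _
      refine DifferentiableOn.sub ?_ (hmono.mono fun z hz => ?_)
      · refine hmono.comp (differentiable_id.add_const _).differentiableOn fun z hz => ?_
        refine hsub z hz ?_
        rw [mem_ball_iff_norm]
        simpa only [id_eq, add_sub_cancel_left, hnorm] using hk
      · exact hsub z hz (Metric.mem_ball_self hR)
  exact ((key z₀ hz₀').differentiableAt (Metric.ball_mem_nhds z₀ hR)).differentiableWithinAt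

theorem contDiffOn_of_differentiableOn [FiniteDimensional ℂ E] [FiniteDimensional ℂ F]
    {U : Set E} (hU : IsOpen U) {f : E → F} (hf : DifferentiableOn ℂ f U) (m : ℕ) :
    ContDiffOn ℂ m f U := by
  induction m generalizing f with
  | zero => exact contDiffOn_zero.2 hf.continuousOn
  | succ m ih =>
    push_cast
    rw [contDiffOn_succ_iff_fderiv_of_isOpen hU]
    refine ⟨hf, fun h => absurd h (by simp), ?_⟩
    rw [contDiffOn_clm_apply]
    exact fun e => ih (differentiableOn_fderiv_apply hU hf e)

/-- The reduction to one variable: Taylor expansions on the ball are read off from the slices ζ ↦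
f(ζz). -/
theorem iteratedDeriv_smul_line [FiniteDimensional ℂ E] [FiniteDimensional ℂ F] {U : Set E}
    (hU : IsOpen U) (h0 : (0 : E) ∈ U) {f : E → F} (hf : DifferentiableOn ℂ f U) (k : ℕ) (z : E) :
    iteratedDeriv k (fun ζ : ℂ => f (ζ • z)) 0 = iteratedFDeriv ℂ k f 0 (fun _ => z) := by
  have hc : ContDiffAt ℂ k f ((ContinuousLinearMap.toSpanSingleton ℂ z) 0) := by
    rw [map_zero]
    exact (contDiffOn_of_differentiableOn hU hf k).contDiffAt (hU.mem_nhds h0)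
  have h1 : (fun ζ : ℂ => f (ζ • z)) = f ∘ (ContinuousLinearMap.toSpanSingleton ℂ z) := by
    ext ζ; simp
  rw [iteratedDeriv_eq_iteratedFDeriv, h1]
  have hopen : IsOpen ((ContinuousLinearMap.toSpanSingleton ℂ z) ⁻¹' U) :=
    hU.preimage (ContinuousLinearMap.continuous _)
  have h2 := ContinuousLinearMap.iteratedFDerivWithin_comp_right
    (ContinuousLinearMap.toSpanSingleton ℂ z) (contDiffOn_of_differentiableOn hU hf k)
    hU.uniqueDiffOn hopen.uniqueDiffOn (x := 0) (by simpa using h0) (i := k) le_rfl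
  rw [iteratedFDerivWithin_of_isOpen k hopen (by simpa using h0),
    iteratedFDerivWithin_of_isOpen k hU (by simpa using h0)] at h2
  rw [h2]
  simp

end SeveralComplexVariables

/-! ### Taylor expansion on the ball and its tails. -/

section Taylor

variable {n : ℕ} {f : Cn n → Cn n}

theorem hasSum_taylorTerm (hf : DifferentiableOn ℂ f (unitBall n)) {z : Cn n}
    (hz : z ∈ unitBall n) : HasSum (fun k => taylorTerm f k z) (f z) := by
  rw [mem_ball_zero_iff] at hz
  -- With r > 1 the slice is holomorphic on an open disc containing ζ = 1, where the series is
  -- evaluated.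
  obtain ⟨r, hr1, hr⟩ : ∃ r : ℝ, 1 < r ∧ r * ‖z‖ < 1 := by
    rcases eq_or_ne z 0 with rfl | hz0
    · exact ⟨2, by norm_num, by simp⟩
    · have hpos : 0 < ‖z‖ := norm_pos_iff.2 hz0
      obtain ⟨r, h1, h2⟩ := exists_between ((one_lt_inv₀ hpos).2 hz)
      exact ⟨r, h1, by rwa [lt_inv_comm₀ (by linarith) hpos, ← one_div,
        lt_div_iff₀' (by linarith)] at h2⟩
  have hmaps : MapsTo (fun ζ : ℂ => ζ • z) (Metric.ball 0 r) (unitBall n) := by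
    intro ζ hζ
    rw [mem_ball_zero_iff] at hζ ⊢
    rw [norm_smul]
    exact (mul_le_mul_of_nonneg_right hζ.le (norm_nonneg z)).trans_lt hr
  have h1 := Complex.hasSum_taylorSeries_on_ball (f := fun ζ : ℂ => f (ζ • z)) (c := 0) (r := r)
    (hf.comp (differentiable_id.smul_const z).differentiableOn hmaps) (z := 1)
    (by simpa using hr1)
  simp only [sub_zero, one_pow, one_smul] at h1
  have h2 : (fun k => taylorTerm f k z) = fun k : ℕ => (k.factorial : ℂ)⁻¹ •
      iteratedDeriv k (fun ζ : ℂ => f (ζ • z)) 0 := by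
    funext k
    rw [iteratedDeriv_smul_line Metric.isOpen_ball (Metric.mem_ball_self one_pos) hf k z]
    rfl
  rw [h2]
  exact h1

theorem norm_taylorTerm_le (hf : DifferentiableOn ℂ f (unitBall n)) {M R ρ : ℝ} (hR : R ≤ 1)
    (hM : ∀ w ∈ Metric.ball (0 : Cn n) R, ‖f w‖ ≤ M) {z : Cn n} (hρ : 0 < ρ)
    (hz : ρ * ‖z‖ < R) (k : ℕ) : ‖taylorTerm f k z‖ ≤ M * (ρ⁻¹) ^ k := by
  have hmaps : MapsTo (fun ζ : ℂ => ζ • z) (Metric.closedBall 0 ρ) (Metric.ball 0 R) := by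
    intro ζ hζ
    rw [mem_closedBall_zero_iff] at hζ
    rw [mem_ball_zero_iff, norm_smul]
    exact (mul_le_mul_of_nonneg_right hζ (norm_nonneg z)).trans_lt hz
  have hd : DifferentiableOn ℂ (fun ζ : ℂ => f (ζ • z)) (Metric.closedBall 0 ρ) :=
    hf.comp (differentiable_id.smul_const z).differentiableOn
      (hmaps.mono_right (Metric.ball_subset_ball hR))
  have h1 := Complex.norm_iteratedDeriv_le_of_forall_mem_sphere_norm_le (c := 0) (C := M) k hρ
    (f := fun ζ : ℂ => f (ζ • z)) (hd.diffContOnCl_ball Subset.rfl)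
    (fun ζ hζ => hM _ (hmaps (Metric.sphere_subset_closedBall hζ)))
  rw [iteratedDeriv_smul_line Metric.isOpen_ball (Metric.mem_ball_self one_pos) hf k z] at h1
  rw [taylorTerm, norm_smul, norm_inv, Complex.norm_natCast,
    inv_mul_le_iff₀ (by exact_mod_cast k.factorial_pos)]
  refine h1.trans_eq ?_
  rw [inv_pow, mul_div_assoc, div_eq_mul_inv]

/-- The Taylor remainder of a holomorphic map bounded by `M` on the ball of radius `3/4`. -/
theorem norm_sub_sum_taylorTerm_le (hf : DifferentiableOn ℂ f (unitBall n)) {M : ℝ}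
    (hM : ∀ w ∈ Metric.ball (0 : Cn n) (3 / 4), ‖f w‖ ≤ M) {z : Cn n} (hz : ‖z‖ ≤ 1 / 2)
    {N : ℕ} (hN : 0 < N) :
    ‖f z - ∑ k ∈ Finset.range N, taylorTerm f k z‖ ≤ 4 * M * (3 / 2 * ‖z‖) ^ N := by
  have hzb : z ∈ unitBall n := by rw [mem_ball_zero_iff]; linarith
  have hM0 : 0 ≤ M := (norm_nonneg _).trans (hM 0 (Metric.mem_ball_self (by norm_num)))
  have hs := (hasSum_nat_add_iff' N).2 (hasSum_taylorTerm hf hzb)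
  rcases eq_or_ne z 0 with rfl | hz0
  · have : (fun k => taylorTerm f (k + N) 0) = fun _ => 0 := by
      funext k
      have h0 : (fun _ : Fin (k + N) => (0 : Cn n)) = 0 := rfl
      have : Nonempty (Fin (k + N)) := ⟨⟨0, by omega⟩⟩
      rw [taylorTerm, h0, ContinuousMultilinearMap.map_zero, smul_zero]
    rw [this] at hs
    rw [hs.unique hasSum_zero, norm_zero]
    positivity
  have hpos : 0 < ‖z‖ := norm_pos_iff.2 hz0
  -- Slices are taken on the circle of radius ρ = 1/q, for which ρ‖z‖ = 2/3 < 3/4; and q ≤ 3/4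
  -- bounds the geometric tail by the factor 4.
  set q : ℝ := 3 / 2 * ‖z‖ with hq
  have hq0 : 0 < q := by positivity
  have hq1 : q ≤ 3 / 4 := by linarith
  have hb : ∀ k, ‖taylorTerm f k z‖ ≤ M * q ^ k := by
    intro k
    have := norm_taylorTerm_le hf (R := 3 / 4) (by norm_num) hM (z := z) (ρ := q⁻¹)
      (by positivity) (by rw [hq]; field_simp; norm_num) k
    rwa [inv_inv] at this
  have hg : HasSum (fun k => M * q ^ (k + N)) (M * q ^ N * (1 - q)⁻¹) := by
    have := (hasSum_geometric_of_lt_one hq0.le (by linarith : q < 1)).mul_left (M * q ^ N)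
    have h2 : (fun k => M * q ^ (k + N)) = fun k => M * q ^ N * q ^ k := by
      funext k; ring
    rwa [h2]
  refine (hs.norm_le_of_bounded hg fun k => hb (k + N)).trans ?_
  have : (1 - q)⁻¹ ≤ 4 := by
    rw [inv_le_comm₀ (by linarith) (by norm_num)]; norm_num; linarith
  calc M * q ^ N * (1 - q)⁻¹ ≤ M * q ^ N * 4 := by gcongr
    _ = 4 * M * q ^ N := by ring

theorem taylorTerm_zero (f : Cn n → Cn n) (z : Cn n) : taylorTerm f 0 z = f 0 := by
  simp [taylorTerm]

theorem taylorTerm_one (f : Cn n → Cn n) (z : Cn n) : taylorTerm f 1 z = fderiv ℂ f 0 z := by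
  simp [taylorTerm, iteratedFDeriv_one_apply]

end Taylor

/-! ### Harnack-type inequalities for functions of positive real part. -/

section PositiveRealPart

/-- Schwarz lemma for functions with positive real part, through the Cayley transform. -/
theorem norm_sub_le_of_re_pos {p : ℂ → ℂ} (hp : DifferentiableOn ℂ p (Metric.ball 0 1))
    (hre : ∀ ζ ∈ Metric.ball (0 : ℂ) 1, 0 < (p ζ).re) {ζ : ℂ} (hζ : ‖ζ‖ < 1) :
    ‖p ζ - p 0‖ ≤ ‖ζ‖ * ‖p ζ + starRingEnd ℂ (p 0)‖ := by
  have h0 : 0 < (p 0).re := hre 0 (Metric.mem_ball_self one_pos)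
  have hne : ∀ w ∈ Metric.ball (0 : ℂ) 1, p w + starRingEnd ℂ (p 0) ≠ 0 := by
    intro w hw h
    have := congrArg Complex.re h
    simp only [Complex.add_re, Complex.conj_re, Complex.zero_re] at this
    linarith [hre w hw]
  have hq : DifferentiableOn ℂ (fun w => (p w - p 0) / (p w + starRingEnd ℂ (p 0)))
      (Metric.ball 0 1) := (hp.sub_const _).div (hp.add_const _) hne
  have hmaps : MapsTo (fun w => (p w - p 0) / (p w + starRingEnd ℂ (p 0)))
      (Metric.ball 0 1) (Metric.closedBall 0 1) := by
    intro w hw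
    have hpos : 0 < ‖p w + starRingEnd ℂ (p 0)‖ := norm_pos_iff.2 (hne w hw)
    rw [mem_closedBall_zero_iff, norm_div, div_le_one hpos,
      ← sq_le_sq₀ (norm_nonneg _) (norm_nonneg _), Complex.sq_norm, Complex.sq_norm,
      Complex.normSq_apply, Complex.normSq_apply]
    simp only [Complex.sub_re, Complex.sub_im, Complex.add_re, Complex.add_im, Complex.conj_re,
      Complex.conj_im]
    nlinarith [mul_pos h0 (hre w hw)]
  have key := Complex.norm_le_norm_of_mapsTo_ball hq hmaps (by simp) hζ
  rwa [norm_div, div_le_iff₀ (norm_pos_iff.2 (hne ζ (by simpa using hζ)))] at key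

theorem norm_le_of_re_pos {p : ℂ → ℂ} (hp : DifferentiableOn ℂ p (Metric.ball 0 1))
    (hre : ∀ ζ ∈ Metric.ball (0 : ℂ) 1, 0 < (p ζ).re) {ζ : ℂ} (hζ : ‖ζ‖ < 1) :
    ‖p ζ‖ * (1 - ‖ζ‖) ≤ ‖p 0‖ * (1 + ‖ζ‖) := by
  have h1 := norm_sub_le_of_re_pos hp hre hζ
  have h2 := norm_sub_norm_le (p ζ) (p 0)
  have h3 := norm_add_le (p ζ) (starRingEnd ℂ (p 0))
  rw [RCLike.norm_conj] at h3
  nlinarith [mul_le_mul_of_nonneg_left h3 (norm_nonneg ζ)]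

theorem le_re_of_re_pos {p : ℂ → ℂ} (hp : DifferentiableOn ℂ p (Metric.ball 0 1))
    (hre : ∀ ζ ∈ Metric.ball (0 : ℂ) 1, 0 < (p ζ).re) {ζ : ℂ} (hζ : ‖ζ‖ < 1) :
    (p 0).re * (1 - ‖ζ‖) ≤ (p ζ).re * (1 + ‖ζ‖) := by
  have h1 := norm_sub_le_of_re_pos hp hre hζ
  have h0 : 0 < (p 0).re := hre 0 (Metric.mem_ball_self one_pos)
  have hx : 0 < (p ζ).re := hre ζ (by simpa using hζ)
  have hr := norm_nonneg ζ
  generalize ‖ζ‖ = r at h1 hζ hr ⊢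
  rw [← sq_le_sq₀ (norm_nonneg _) (by positivity), mul_pow, Complex.sq_norm, Complex.sq_norm,
    Complex.normSq_apply, Complex.normSq_apply] at h1
  simp only [Complex.sub_re, Complex.sub_im, Complex.add_re, Complex.add_im, Complex.conj_re,
    Complex.conj_im] at h1
  -- The imaginary parts of p(ζ) - p(0) and of p(ζ) + conj p(0) coincide, so they enter the squared
  -- inequality with coefficient 1 - r² ≥ 0 and can be dropped.
  have h2 : 0 ≤ (1 - r ^ 2) * ((p ζ).im - (p 0).im) ^ 2 :=
    mul_nonneg (by nlinarith) (sq_nonneg _)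
  have h3 : ((p 0).re - (p ζ).re) ^ 2 ≤ (r * ((p ζ).re + (p 0).re)) ^ 2 := by nlinarith
  have h4 := abs_le_of_sq_le_sq h3 (by positivity)
  have := (le_abs_self _).trans h4
  linarith

end PositiveRealPart

/-! ### Estimates for the class N_A that depend only on A. -/

section ClassN

variable {n : ℕ} {A : Cn n →L[ℂ] Cn n} {h : Cn n → Cn n}

theorem lowerIndex_le (A : Cn n →L[ℂ] Cn n) {u : Cn n} (hu : ‖u‖ = 1) :
    lowerIndex A ≤ (inner ℂ u (A u)).re := by
  refine csInf_le ⟨-‖A‖, ?_⟩ ⟨u, hu, rfl⟩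
  rintro x ⟨z, hz, rfl⟩
  have h1 := Complex.abs_re_le_norm (inner ℂ z (A z))
  have h2 := norm_inner_le_norm (𝕜 := ℂ) z (A z)
  have h3 := A.le_opNorm z
  rw [hz] at h2 h3
  linarith [neg_abs_le (inner ℂ z (A z)).re]

/-- The slice `ζ ↦ ⟨h(ζ u), u⟩ / ζ` of a map of class `N_A`. -/
theorem IsClassN.exists_slice (hh : IsClassN A h) {u : Cn n} (hu : ‖u‖ = 1) :
    ∃ p : ℂ → ℂ, DifferentiableOn ℂ p (Metric.ball 0 1) ∧
      (0 < (inner ℂ u (A u)).re → ∀ ζ ∈ Metric.ball (0 : ℂ) 1, 0 < (p ζ).re) ∧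
      p 0 = inner ℂ u (A u) ∧
      ∀ ζ : ℂ, inner ℂ (ζ • u) (h (ζ • u)) = ((‖ζ‖ ^ 2 : ℝ) : ℂ) * p ζ := by
  set φ : ℂ → ℂ := fun ζ => innerSL ℂ u (h (ζ • u)) with hφ
  have hmaps : MapsTo (fun ζ : ℂ => ζ • u) (Metric.ball 0 1) (unitBall n) := by
    intro ζ hζ
    rw [mem_ball_zero_iff] at hζ ⊢
    rwa [norm_smul, hu, mul_one]
  have hd : DifferentiableOn ℂ φ (Metric.ball 0 1) :=
    (innerSL ℂ u).differentiable.comp_differentiableOn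
      (hh.holo.comp (differentiable_id.smul_const u).differentiableOn hmaps)
  have hφ0 : φ 0 = 0 := by simp [hφ, hh.map_zero]
  have hderiv : HasDerivAt φ (innerSL ℂ u (A u)) 0 := by
    have h1 : HasFDerivAt h A ((0 : ℂ) • u) := by
      rw [zero_smul, ← hh.deriv_zero]
      exact (hh.holo.differentiableAt
        (Metric.isOpen_ball.mem_nhds (Metric.mem_ball_self one_pos))).hasFDerivAt
    have h2 : HasDerivAt (fun ζ : ℂ => ζ • u) u 0 := by
      simpa using (hasDerivAt_id (0 : ℂ)).smul_const u
    exact (innerSL ℂ u).hasFDerivAt.comp_hasDerivAt 0 (h1.comp_hasDerivAt 0 h2)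
  -- `dslope` fills the removable singularity at 0 with the derivative ⟨Au, u⟩; the factor ‖ζ‖² is ζ
  -- from the slope times conj ζ from the conjugate-linear slot of the inner product.
  have hval : ∀ ζ : ℂ, inner ℂ (ζ • u) (h (ζ • u)) = ((‖ζ‖ ^ 2 : ℝ) : ℂ) * dslope φ 0 ζ := by
    intro ζ
    rcases eq_or_ne ζ 0 with rfl | hζ
    · simp
    · rw [dslope_of_ne _ hζ, slope_def_field, hφ0, sub_zero, sub_zero, inner_smul_left]
      have : ((‖ζ‖ ^ 2 : ℝ) : ℂ) = starRingEnd ℂ ζ * ζ := by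
        rw [Complex.conj_mul']; push_cast; rfl
      rw [this]
      simp only [hφ, innerSL_apply_apply]
      field_simp
  refine ⟨dslope φ 0, ?_, ?_, ?_, hval⟩
  · exact (Complex.differentiableOn_dslope (Metric.ball_mem_nhds 0 one_pos)).2 hd
  · intro hpos ζ hζ
    rcases eq_or_ne ζ 0 with rfl | hζ0
    · rw [dslope_same, hderiv.deriv]
      exact hpos
    · have hu0 : u ≠ 0 := by rintro rfl; simp at hu
      have h1 := hh.re_pos (ζ • u) (hmaps hζ) (smul_ne_zero hζ0 hu0)
      rw [hval ζ, Complex.re_ofReal_mul] at h1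
      exact (mul_pos_iff_of_pos_left (by positivity)).1 h1
  · rw [dslope_same, hderiv.deriv]
    rfl

theorem exists_unit_smul {z : Cn n} (hz : z ≠ 0) :
    ∃ u : Cn n, ‖u‖ = 1 ∧ ((‖z‖ : ℝ) : ℂ) • u = z := by
  have h0 : ((‖z‖ : ℝ) : ℂ) ≠ 0 := by exact_mod_cast norm_ne_zero_iff.2 hz
  refine ⟨((‖z‖ : ℝ) : ℂ)⁻¹ • z, ?_, smul_inv_smul₀ h0 z⟩
  rw [norm_smul, norm_inv, Complex.norm_real, norm_norm,
    inv_mul_cancel₀ (norm_ne_zero_iff.2 hz)]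

/-- Harnack's lower bound at ζ = ‖z‖ for the slice through z, whose value at 0 has real part at
least m(A). This is the source of the contraction rate m(A) of the flow. -/
theorem IsClassN.le_re_inner (hA : 0 < lowerIndex A) (hh : IsClassN A h) {z : Cn n}
    (hz : z ∈ unitBall n) :
    lowerIndex A * ‖z‖ ^ 2 * (1 - ‖z‖) ≤ (inner ℂ z (h z)).re * (1 + ‖z‖) := by
  rcases eq_or_ne z 0 with rfl | hz0
  · simp
  rw [mem_ball_zero_iff] at hz
  obtain ⟨u, hu, hzu⟩ := exists_unit_smul hz0
  obtain ⟨p, hp, hre, hp0, hval⟩ := hh.exists_slice hu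
  have hm := lowerIndex_le A hu
  have hnorm : ‖((‖z‖ : ℝ) : ℂ)‖ = ‖z‖ := by simp
  have h1 := le_re_of_re_pos hp (hre (hA.trans_le hm)) (ζ := ((‖z‖ : ℝ) : ℂ)) (by rwa [hnorm])
  have h2 := hval ((‖z‖ : ℝ) : ℂ)
  rw [hnorm, hzu] at h2
  rw [hp0, hnorm] at h1
  rw [h2, Complex.re_ofReal_mul]
  have h3 : lowerIndex A * (1 - ‖z‖) ≤ (p ((‖z‖ : ℝ) : ℂ)).re * (1 + ‖z‖) :=
    (mul_le_mul_of_nonneg_right hm (by linarith)).trans h1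
  nlinarith [mul_le_mul_of_nonneg_left h3 (sq_nonneg ‖z‖)]

theorem IsClassN.norm_inner_le (hA : 0 < lowerIndex A) (hh : IsClassN A h) {z : Cn n}
    (hz : z ∈ unitBall n) :
    ‖inner ℂ z (h z)‖ * (1 - ‖z‖) ≤ 2 * ‖A‖ := by
  rcases eq_or_ne z 0 with rfl | hz0
  · simp
  rw [mem_ball_zero_iff] at hz
  obtain ⟨u, hu, hzu⟩ := exists_unit_smul hz0
  obtain ⟨p, hp, hre, hp0, hval⟩ := hh.exists_slice hu
  have hm := lowerIndex_le A hu
  have hnorm : ‖((‖z‖ : ℝ) : ℂ)‖ = ‖z‖ := by simp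
  have h1 := norm_le_of_re_pos hp (hre (hA.trans_le hm)) (ζ := ((‖z‖ : ℝ) : ℂ)) (by rwa [hnorm])
  have h2 := hval ((‖z‖ : ℝ) : ℂ)
  rw [hnorm, hzu] at h2
  rw [hp0, hnorm] at h1
  have h3 : ‖inner ℂ u (A u)‖ ≤ ‖A‖ := by
    have h4 := norm_inner_le_norm (𝕜 := ℂ) u (A u)
    have h5 := A.le_opNorm u
    rw [hu] at h4 h5
    linarith
  have hz2 : ‖z‖ ^ 2 ≤ 1 := by nlinarith [norm_nonneg z]
  rw [h2, norm_mul, Complex.norm_real, Real.norm_of_nonneg (by positivity), mul_assoc]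
  calc ‖z‖ ^ 2 * (‖p ((‖z‖ : ℝ) : ℂ)‖ * (1 - ‖z‖))
      ≤ 1 * (‖inner ℂ u (A u)‖ * (1 + ‖z‖)) := by
        refine mul_le_mul hz2 h1 ?_ zero_le_one
        exact mul_nonneg (norm_nonneg _) (by linarith)
    _ ≤ 1 * (‖A‖ * 2) := by gcongr; linarith
    _ = 2 * ‖A‖ := by ring

/-- So far only the component ⟨h(z), z⟩ is controlled. Let e be the direction of h(z). The function
Φ(l) = l⟨h(z+le), z⟩ + ρ²⟨h(z+le), e⟩ is holomorphic in l; on |l| = ρ one has ρ² = l·conj l, so Φ(l)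
= l⟨h(z+le), z+le⟩ is controlled there, while Φ(0) = ρ²‖h(z)‖. The maximum principle compares the
two. -/
theorem IsClassN.norm_le (hA : 0 < lowerIndex A) (hh : IsClassN A h) {r : ℝ} (hr : r < 1)
    {z : Cn n} (hz : ‖z‖ ≤ r) : ‖h z‖ ≤ 8 * ‖A‖ / (1 - r) ^ 2 := by
  rcases eq_or_ne (h z) 0 with h0 | h0
  · rw [h0, norm_zero]; positivity
  obtain ⟨e, he, hze⟩ := exists_unit_smul h0
  set ρ : ℝ := (1 - r) / 2 with hρdef
  have hρ : 0 < ρ := by rw [hρdef]; linarith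
  have hw : ∀ l : ℂ, ‖l‖ ≤ ρ → ‖z + l • e‖ ≤ r + ρ := by
    intro l hl
    have := norm_add_le z (l • e)
    rw [norm_smul, he, mul_one] at this
    linarith
  have hmaps : MapsTo (fun l : ℂ => z + l • e) (Metric.closedBall 0 ρ) (unitBall n) := by
    intro l hl
    rw [mem_closedBall_zero_iff] at hl
    rw [mem_ball_zero_iff]
    have := hw l hl
    linarith
  set Φ : ℂ → ℂ := fun l =>
    l * innerSL ℂ z (h (z + l • e)) + (ρ : ℂ) ^ 2 * innerSL ℂ e (h (z + l • e)) with hΦ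
  have hd0 : DifferentiableOn ℂ (fun l : ℂ => h (z + l • e)) (Metric.closedBall 0 ρ) :=
    hh.holo.comp ((differentiable_id.smul_const e).const_add z).differentiableOn hmaps
  have hd : DifferentiableOn ℂ Φ (Metric.closedBall 0 ρ) :=
    (differentiable_id.differentiableOn.mul
      ((innerSL ℂ z).differentiable.comp_differentiableOn hd0)).add
      (((innerSL ℂ e).differentiable.comp_differentiableOn hd0).const_mul _)
  have hbound : ∀ l ∈ frontier (Metric.ball (0 : ℂ) ρ), ‖Φ l‖ ≤ ρ * (4 * ‖A‖ / (1 - r)) := by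
    intro l hl
    rw [frontier_ball _ hρ.ne', mem_sphere_zero_iff_norm] at hl
    have hmem : z + l • e ∈ unitBall n := hmaps (by simp [hl])
    have h1 := hh.norm_inner_le hA hmem
    have h2 : Φ l = l * inner ℂ (z + l • e) (h (z + l • e)) := by
      have h3 : l * starRingEnd ℂ l = (ρ : ℂ) ^ 2 := by rw [Complex.mul_conj', hl]
      simp only [hΦ, innerSL_apply_apply, inner_add_left, inner_smul_left]
      rw [← h3]; ring
    rw [h2, norm_mul, hl]
    refine mul_le_mul_of_nonneg_left ?_ hρ.le
    rw [le_div_iff₀ (by linarith)]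
    have h4 : (1 - r) / 2 ≤ 1 - ‖z + l • e‖ := by
      have := hw l hl.le
      rw [hρdef] at this
      linarith
    nlinarith [mul_le_mul_of_nonneg_left h4 (norm_nonneg (inner ℂ (z + l • e) (h (z + l • e))))]
  have key := Complex.norm_le_of_forall_mem_frontier_norm_le Metric.isBounded_ball
    (hd.diffContOnCl_ball Subset.rfl) hbound (subset_closure (Metric.mem_ball_self hρ))
  have hΦ0 : Φ 0 = (ρ : ℂ) ^ 2 * ((‖h z‖ : ℝ) : ℂ) := by
    simp only [hΦ, zero_mul, zero_smul, add_zero, zero_add, innerSL_apply_apply]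
    congr 1
    nth_rewrite 1 [← hze]
    rw [inner_smul_right, inner_self_eq_norm_sq_to_K, he]
    simp
  rw [hΦ0, norm_mul, norm_pow, Complex.norm_real, Complex.norm_real, norm_norm,
    Real.norm_of_nonneg hρ.le, pow_two, mul_assoc] at key
  have h5 := le_of_mul_le_mul_left key hρ
  have hr1 : 0 < 1 - r := by linarith
  rw [le_div_iff₀ hr1, hρdef] at h5
  rw [le_div_iff₀ (by positivity)]
  nlinarith

/-- One constant L serves every member of the class, hence every time t at once; this compensates
for `h` being merely measurable in t. -/
theorem IsClassN.exists_lipschitz (hA : 0 < lowerIndex A) {r : ℝ} (hr : r < 1) :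
    ∃ L : ℝ, 0 ≤ L ∧ ∀ h : Cn n → Cn n, IsClassN A h →
      ∀ x ∈ Metric.closedBall (0 : Cn n) r, ‖fderiv ℂ h x‖ ≤ L ∧
        ∀ y ∈ Metric.closedBall (0 : Cn n) r, ‖h y - h x‖ ≤ L * ‖y - x‖ ∧
          ‖h y - h x - fderiv ℂ h x (y - x)‖ ≤ L * ‖y - x‖ ^ 2 := by
  set ρ : ℝ := (1 - r) / 2 with hρdef
  have hρ : 0 < ρ := by rw [hρdef]; linarith
  set M : ℝ := 8 * ‖A‖ / (1 - (r + ρ)) ^ 2 with hM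
  have hM0 : 0 ≤ M := by positivity
  refine ⟨2 * M / ρ + 4 * M / ρ ^ 2, by positivity, fun h hh x hx => ?_⟩
  have hb : ∀ w ∈ Metric.ball (0 : Cn n) (r + ρ), ‖h w‖ ≤ M := fun w hw =>
    hh.norm_le hA (by rw [hρdef]; linarith) (mem_ball_zero_iff.1 hw).le
  have hd : DifferentiableOn ℂ h (Metric.ball 0 (r + ρ)) :=
    hh.holo.mono (Metric.ball_subset_ball (by rw [hρdef]; linarith))
  have hsub : Metric.ball x ρ ⊆ Metric.ball 0 (r + ρ) := by
    intro w hw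
    rw [mem_closedBall_zero_iff] at hx
    rw [mem_ball_iff_norm] at hw
    rw [mem_ball_zero_iff]
    have := norm_add_le x (w - x)
    rw [add_sub_cancel] at this
    linarith
  have hfd : ‖fderiv ℂ h x‖ ≤ 2 * M / ρ :=
    norm_fderiv_le_of_ball hρ (hd.mono hsub) fun w hw => hb w (hsub hw)
  have hlip : ∀ y ∈ Metric.closedBall (0 : Cn n) r, ‖h y - h x‖ ≤ 2 * M / ρ * ‖y - x‖ :=
    fun y hy => norm_sub_le_of_closedBall hρ hd hb hx hy
  have hq0 : 0 ≤ 4 * M / ρ ^ 2 := by positivity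
  have hl0 : 0 ≤ 2 * M / ρ := by positivity
  refine ⟨by linarith, fun y hy => ⟨?_, ?_⟩⟩
  · have := hlip y hy
    nlinarith [mul_nonneg hq0 (norm_nonneg (y - x))]
  -- Nearby points use the Schwarz remainder; for distant ones the linear bounds suffice, because ‖y
  -- - x‖ / ρ ≥ 1.
  · rcases lt_or_ge ‖y - x‖ ρ with hlt | hge
    · have h1 := norm_sub_sub_fderiv_le hlt (hd.mono hsub) fun w hw => hb w (hsub hw)
      rw [add_sub_cancel] at h1
      refine h1.trans ?_
      rw [div_pow, mul_div_assoc', mul_div_right_comm]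
      exact mul_le_mul_of_nonneg_right (by linarith) (sq_nonneg _)
    · have h1 := norm_sub_le (h y - h x) (fderiv ℂ h x (y - x))
      have h2 := hlip y hy
      have h3 := (fderiv ℂ h x).le_of_opNorm_le hfd (y - x)
      have h4 : 2 * (2 * M / ρ) * ‖y - x‖ ≤ 4 * M / ρ ^ 2 * ‖y - x‖ ^ 2 := by
        have h5 : 4 * M / ρ ^ 2 * ‖y - x‖ ^ 2 = 2 * (2 * M / ρ) * ‖y - x‖ * (‖y - x‖ / ρ) := by
          field_simp; ring
        rw [h5]
        exact le_mul_of_one_le_right (by positivity) ((one_le_div hρ).2 hge)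
      nlinarith [mul_nonneg hl0 (sq_nonneg ‖y - x‖)]

theorem IsClassN.exists_taylor_bound (hA : 0 < lowerIndex A) :
    ∃ C : ℝ, 0 ≤ C ∧ ∀ h : Cn n → Cn n, IsClassN A h → ∀ z : Cn n, ‖z‖ ≤ 1 / 2 →
      ∀ N : ℕ, 0 < N →
        ‖h z - ∑ k ∈ Finset.range N, taylorTerm h k z‖ ≤ C * (3 / 2 * ‖z‖) ^ N := by
  refine ⟨4 * (8 * ‖A‖ / (1 - 3 / 4) ^ 2), by positivity, fun h hh z hz N hN => ?_⟩
  exact norm_sub_sum_taylorTerm_le hh.holo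
    (fun w hw => hh.norm_le hA (by norm_num) (mem_ball_zero_iff.1 hw).le) hz hN

end ClassN

/-! ### Single trajectories: contraction, dependence on the initial point, uniqueness. -/

section FlowLine

variable {n : ℕ} {A : Cn n →L[ℂ] Cn n} {h : Cn n → ℝ → Cn n} {x y : ℝ → Cn n} {a b : ℝ}

/-- `x` is an absolutely continuous solution of `dx/dt = -h(x, t)` on `[a, b]`, in the unit ball. -/
structure IsFlowLine (h : Cn n → ℝ → Cn n) (x : ℝ → Cn n) (a b : ℝ) : Prop where
  ac : AbsolutelyContinuousOnInterval x a b
  mem_ball : ∀ t ∈ Icc a b, x t ∈ unitBall n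
  ode : ∀ᵐ t : ℝ, t ∈ Ioo a b → HasDerivAt x (-(h (x t) t)) t

theorem IsFlowLine.mono (hx : IsFlowLine h x a b) {c d : ℝ} (hac : a ≤ c) (hcd : c ≤ d)
    (hdb : d ≤ b) : IsFlowLine h x c d where
  ac := hx.ac.mono (by
    rw [uIcc_of_le hcd, uIcc_of_le (hac.trans (hcd.trans hdb))]
    exact Icc_subset_Icc hac hdb)
  mem_ball := fun t ht => hx.mem_ball t (Icc_subset_Icc hac hdb ht)
  ode := by
    filter_upwards [hx.ode] with t ht hmem
    exact ht (Ioo_subset_Ioo hac hdb hmem)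

theorem norm_deriv_mul_norm {f : ℝ → Cn n} {f' : Cn n} {d t : ℝ} (hf : HasDerivAt f f' t)
    (hd : HasDerivAt (fun τ => ‖f τ‖) d t) : ‖f t‖ * d = (inner ℂ (f t) f').re := by
  have h1 : HasDerivAt (fun τ => ‖f τ‖ ^ 2) (2 * (‖f t‖ * d)) t := by
    have := hd.pow 2
    refine (this.congr_deriv ?_)
    simp; ring
  have h2 : HasDerivAt (fun τ => ‖f τ‖ ^ 2) (2 * (inner ℂ (f t) f').re) t := by
    have h3 := Complex.reCLM.hasFDerivAt.comp_hasDerivAt t (hf.inner ℂ hf)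
    have h4 : (Complex.reCLM ∘ fun τ => inner ℂ (f τ) (f τ)) = fun τ => ‖f τ‖ ^ 2 := by
      funext τ
      simp only [Function.comp_apply, Complex.reCLM_apply]
      exact inner_self_eq_norm_sq (𝕜 := ℂ) (f τ)
    rw [h4] at h3
    refine h3.congr_deriv ?_
    rw [map_add, Complex.reCLM_apply, Complex.reCLM_apply]
    have := inner_re_symm (𝕜 := ℂ) (f t) f'
    simp only [RCLike.re_to_complex] at this
    rw [this]; ring
  have := h1.unique h2
  linarith

theorem IsFlowLine.ae_deriv_norm_le (hA : 0 < lowerIndex A) (hh : IsGenerator A h) (ha : 0 ≤ a)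
    (hx : IsFlowLine h x a b) :
    ∀ᵐ t : ℝ, t ∈ Ioo a b → ∀ d, HasDerivAt (fun τ => ‖x τ‖) d t →
      d * (1 + ‖x t‖) ≤ -(lowerIndex A * ‖x t‖ * (1 - ‖x t‖)) := by
  filter_upwards [hx.ode] with t ht hmem d hd
  have hball := hx.mem_ball t (Ioo_subset_Icc_self hmem)
  rcases eq_or_ne (x t) 0 with h0 | h0
  -- At a zero of x the norm has a minimum, so its derivative, if it exists, is 0.
  · have hmin : IsLocalMin (fun τ => ‖x τ‖) t := by
      refine Eventually.of_forall fun τ => ?_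
      simp [h0]
    rw [hmin.hasDerivAt_eq_zero hd]
    simp [h0]
  · have h1 := norm_deriv_mul_norm (ht hmem) hd
    have h2 := (hh.classN t (ha.trans hmem.1.le)).le_re_inner hA hball
    rw [inner_neg_right, Complex.neg_re] at h1
    have hpos : 0 < ‖x t‖ := norm_pos_iff.2 h0
    refine le_of_mul_le_mul_left ?_ hpos
    calc ‖x t‖ * (d * (1 + ‖x t‖)) = ‖x t‖ * d * (1 + ‖x t‖) := by ring
      _ = -((inner ℂ (x t) (h (x t) t)).re * (1 + ‖x t‖)) := by rw [h1]; ring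
      _ ≤ -(lowerIndex A * ‖x t‖ ^ 2 * (1 - ‖x t‖)) := neg_le_neg h2
      _ = ‖x t‖ * -(lowerIndex A * ‖x t‖ * (1 - ‖x t‖)) := by ring

theorem IsFlowLine.norm_le (hA : 0 < lowerIndex A) (hh : IsGenerator A h) (ha : 0 ≤ a)
    (hab : a ≤ b) (hx : IsFlowLine h x a b) : ‖x b‖ ≤ ‖x a‖ := by
  refine hx.ac.norm.le_of_ae_hasDerivAt_nonpos hab ?_
  filter_upwards [hx.ae_deriv_norm_le hA hh ha] with t ht hmem d hd
  have h1 := ht hmem d hd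
  have h2 := hx.mem_ball t (Ioo_subset_Icc_self hmem)
  rw [mem_ball_zero_iff] at h2
  have h3 : 0 ≤ lowerIndex A * ‖x t‖ * (1 - ‖x t‖) :=
    mul_nonneg (mul_nonneg hA.le (norm_nonneg _)) (by linarith)
  by_contra hcon
  have := mul_pos (not_le.1 hcon) (by positivity : 0 < 1 + ‖x t‖)
  linarith

/-- The logarithmic derivative of q/(1-q)² in q is (1+q)/(q(1-q)), so the differential inequality
for q = ‖x‖ says exactly that e^{m(t-a)} q/(1-q)² does not increase. -/
theorem IsFlowLine.decay (hA : 0 < lowerIndex A) (hh : IsGenerator A h) (ha : 0 ≤ a)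
    (hab : a ≤ b) (hx : IsFlowLine h x a b) :
    ‖x b‖ / (1 - ‖x b‖) ^ 2 ≤
      Real.exp (-(lowerIndex A * (b - a))) * (‖x a‖ / (1 - ‖x a‖) ^ 2) := by
  set m := lowerIndex A
  have hlt : ∀ t ∈ Icc a b, ‖x t‖ < 1 := fun t ht => mem_ball_zero_iff.1 (hx.mem_ball t ht)
  have hexp : ContDiff ℝ 1 (fun t : ℝ => Real.exp (m * (t - a))) := by fun_prop
  have hac1 : AbsolutelyContinuousOnInterval (fun t => ‖x t‖ / (1 - ‖x t‖) ^ 2) a b := by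
    refine comp_absolutelyContinuousOnInterval_of_contDiffAt (Ψ := fun q : ℝ => q / (1 - q) ^ 2)
      hx.ac.norm fun t ht => ?_
    rw [uIcc_of_le hab] at ht
    have := hlt t ht
    refine contDiffAt_id.div ((contDiffAt_const.sub contDiffAt_id).pow 2) ?_
    have : (1 - ‖x t‖) ≠ 0 := by linarith
    simpa using this
  have key := ((hexp.absolutelyContinuousOnInterval a b).mul hac1).le_of_ae_hasDerivAt_nonpos hab
    (by
      filter_upwards [hx.ae_deriv_norm_le hA hh ha, hx.ac.norm.ae_differentiableAt]
        with t ht hdiff hmem y hy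
      have hIcc := Ioo_subset_Icc_self hmem
      have hd := (hdiff (by rwa [uIcc_of_le hab])).hasDerivAt
      set d := deriv (fun t => ‖x t‖) t
      have h1 := ht hmem d hd
      have hq := hlt t hIcc
      set q := ‖x t‖ with hqdef
      have hq1 : 0 < 1 - q := by linarith
      have he : HasDerivAt (fun t : ℝ => Real.exp (m * (t - a)))
          (Real.exp (m * (t - a)) * (m * 1)) t :=
        (((hasDerivAt_id t).sub_const a).const_mul m).exp
      have hψ := hd.div ((hd.const_sub 1).pow 2) (by
        simpa only [Pi.pow_apply, ← hqdef] using pow_ne_zero 2 hq1.ne')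
      rw [hy.unique (he.mul hψ)]
      simp only [Pi.pow_apply, ← hqdef]
      have hpos := Real.exp_pos (m * (t - a))
      have hform : Real.exp (m * (t - a)) * (m * 1) * (q / (1 - q) ^ 2) +
          Real.exp (m * (t - a)) * ((d * (1 - q) ^ 2 - q * (((2 : ℕ) : ℝ) * (1 - q) ^ (2 - 1) * -d))
            / ((1 - q) ^ 2) ^ 2) =
          Real.exp (m * (t - a)) / (1 - q) ^ 3 * (m * q * (1 - q) + d * (1 + q)) := by
        field_simp
        push_cast
        ring
      rw [hform]
      refine mul_nonpos_of_nonneg_of_nonpos (by positivity) (by linarith))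
  simp only [Pi.mul_apply, sub_self, mul_zero, Real.exp_zero, one_mul] at key
  rw [Real.exp_neg, ← div_eq_inv_mul, le_div_iff₀ (Real.exp_pos _), mul_comm]
  exact key

/-- Norms decrease along trajectories, so the Lipschitz constant of the ball of radius r stays
valid. The forward estimate gives uniqueness and continuous dependence, the backward one injectivity
of the transition mappings. -/
theorem IsFlowLine.exists_gronwall (hA : 0 < lowerIndex A) {r : ℝ} (hr : r < 1) :
    ∃ L : ℝ, 0 ≤ L ∧ ∀ (h : Cn n → ℝ → Cn n), IsGenerator A h → ∀ (x y : ℝ → Cn n) (a b : ℝ),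
      0 ≤ a → a ≤ b → IsFlowLine h x a b → IsFlowLine h y a b → ‖x a‖ ≤ r → ‖y a‖ ≤ r →
        ‖x b - y b‖ ≤ Real.exp (L * (b - a)) * ‖x a - y a‖ ∧
        ‖x a - y a‖ ≤ Real.exp (L * (b - a)) * ‖x b - y b‖ := by
  obtain ⟨L, hL, HL⟩ := IsClassN.exists_lipschitz (A := A) hA hr
  refine ⟨L, hL, fun h hh x y a b ha hab hx hy hxa hya => ?_⟩
  have hae : ∀ᵐ t : ℝ, t ∈ Ioo a b → ∃ f', HasDerivAt (x - y) f' t ∧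
      ‖f'‖ ≤ L * ‖(x - y) t‖ + 0 := by
    filter_upwards [hx.ode, hy.ode] with t h1 h2 hmem
    refine ⟨_, (h1 hmem).sub (h2 hmem), ?_⟩
    have hxt : ‖x t‖ ≤ r :=
      ((hx.mono le_rfl hmem.1.le hmem.2.le).norm_le hA hh ha hmem.1.le).trans hxa
    have hyt : ‖y t‖ ≤ r :=
      ((hy.mono le_rfl hmem.1.le hmem.2.le).norm_le hA hh ha hmem.1.le).trans hya
    have h3 := (((HL (fun z => h z t) (hh.classN t (ha.trans hmem.1.le)) (y t)
      (mem_closedBall_zero_iff.2 hyt)).2 (x t) (mem_closedBall_zero_iff.2 hxt))).1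
    rw [add_zero, neg_sub_neg, norm_sub_rev]
    exact h3
  constructor
  · have := (hx.ac.sub hy.ac).norm_le_gronwall hL le_rfl hab hae
    simpa using this
  · have := (hx.ac.sub hy.ac).norm_ge_gronwall hab (by simpa only [add_zero] using hae)
    simpa using this

theorem IsFlowLine.unique (hA : 0 < lowerIndex A) (hh : IsGenerator A h) (ha : 0 ≤ a)
    (hab : a ≤ b) (hx : IsFlowLine h x a b) (hy : IsFlowLine h y a b) :
    x a = y a ↔ x b = y b := by
  have h1 := hx.mem_ball a ⟨le_rfl, hab⟩
  have h2 := hy.mem_ball a ⟨le_rfl, hab⟩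
  rw [mem_ball_zero_iff] at h1 h2
  obtain ⟨L, hL, H⟩ := IsFlowLine.exists_gronwall (n := n) (A := A) hA (max_lt h1 h2)
  obtain ⟨h3, h4⟩ := H h hh x y a b ha hab hx hy (le_max_left _ _) (le_max_right _ _)
  constructor
  · intro heq
    rw [heq, sub_self, norm_zero, mul_zero] at h3
    exact sub_eq_zero.1 (norm_le_zero_iff.1 h3)
  · intro heq
    rw [heq, sub_self, norm_zero, mul_zero] at h4
    exact sub_eq_zero.1 (norm_le_zero_iff.1 h4)

end FlowLine

/-! ### The transition mappings: decay, semigroup property, injectivity, holomorphy. -/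

section Transition

variable {n : ℕ} {A : Cn n →L[ℂ] Cn n} {h : Cn n → ℝ → Cn n} {v : Cn n → ℝ → ℝ → Cn n}

theorem IsTransitionSolution.isFlowLine (hv : IsTransitionSolution h v) {z : Cn n}
    (hz : z ∈ unitBall n) {s a b : ℝ} (hs : 0 ≤ s) (hsa : s ≤ a) (hab : a ≤ b) :
    IsFlowLine h (fun t => v z s t) a b := by
  refine IsFlowLine.mono (a := s) (b := b) ⟨?_, ?_, ?_⟩ hsa hab le_rfl
  · rw [absolutelyContinuousOnInterval_iff]
    intro ε hε
    obtain ⟨δ, hδ, H⟩ := hv.locallyAC s hs {z} (by simpa using hz) isCompact_singleton b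
      (hsa.trans hab) ε hε
    exact ⟨δ, hδ, fun I hI hlen => H I hI hlen z rfl⟩
  · exact fun t ht => hv.mem_ball z hz s t hs ht.1
  · filter_upwards [hv.ode z hz s hs] with t ht hmem
    exact ht hmem.1.le

theorem IsTransitionSolution.norm_le (hA : 0 < lowerIndex A) (hh : IsGenerator A h)
    (hv : IsTransitionSolution h v) {z : Cn n} (hz : z ∈ unitBall n) {s t : ℝ} (hs : 0 ≤ s)
    (hst : s ≤ t) : ‖v z s t‖ ≤ ‖z‖ := by
  have := (hv.isFlowLine hz hs le_rfl hst).norm_le hA hh hs hst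
  rwa [hv.initial z hz s hs] at this

theorem IsTransitionSolution.map_zero (hA : 0 < lowerIndex A) (hh : IsGenerator A h)
    (hv : IsTransitionSolution h v) {s t : ℝ} (hs : 0 ≤ s) (hst : s ≤ t) : v 0 s t = 0 := by
  have := hv.norm_le hA hh (Metric.mem_ball_self one_pos) hs hst
  rwa [norm_zero, norm_le_zero_iff] at this

theorem IsTransitionSolution.norm_le_exp (hA : 0 < lowerIndex A) (hh : IsGenerator A h)
    (hv : IsTransitionSolution h v) {z : Cn n} (hz : z ∈ unitBall n) {s t : ℝ} (hs : 0 ≤ s)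
    (hst : s ≤ t) :
    ‖v z s t‖ ≤ Real.exp (-(lowerIndex A * (t - s))) * (‖z‖ / (1 - ‖z‖) ^ 2) := by
  have h1 := (hv.isFlowLine hz hs le_rfl hst).decay hA hh hs hst
  rw [hv.initial z hz s hs] at h1
  refine le_trans ?_ h1
  have h2 := hv.mem_ball z hz s t hs hst
  rw [mem_ball_zero_iff] at h2
  rw [le_div_iff₀ (by have : 0 < 1 - ‖v z s t‖ := by linarith
                      positivity)]
  have h3 := norm_nonneg (v z s t)
  refine mul_le_of_le_one_right h3 ?_
  nlinarith

theorem IsTransitionSolution.semigroup (hA : 0 < lowerIndex A) (hh : IsGenerator A h)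
    (hv : IsTransitionSolution h v) {z : Cn n} (hz : z ∈ unitBall n) {s τ t : ℝ} (hs : 0 ≤ s)
    (hsτ : s ≤ τ) (hτt : τ ≤ t) : v (v z s τ) τ t = v z s t := by
  have hmem := hv.mem_ball z hz s τ hs hsτ
  have hτ := hs.trans hsτ
  have hx := hv.isFlowLine hmem hτ le_rfl hτt
  have hy := hv.isFlowLine hz hs hsτ hτt
  exact (hx.unique hA hh hτ hτt hy).1 (hv.initial _ hmem τ hτ)

theorem IsTransitionSolution.injOn (hA : 0 < lowerIndex A) (hh : IsGenerator A h)
    (hv : IsTransitionSolution h v) {s t : ℝ} (hs : 0 ≤ s) (hst : s ≤ t) :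
    InjOn (fun z => v z s t) (unitBall n) := by
  intro z hz w hw heq
  have hx := hv.isFlowLine hz hs le_rfl hst
  have hy := hv.isFlowLine hw hs le_rfl hst
  have := (hx.unique hA hh hs hst hy).2 heq
  simpa only [hv.initial z hz s hs, hv.initial w hw s hs] using this

theorem IsTransitionSolution.norm_sub_le (hA : 0 < lowerIndex A) (hh : IsGenerator A h)
    (hv : IsTransitionSolution h v) {r : ℝ} (hr : r < 1) {z : Cn n} (hz : ‖z‖ ≤ r) {s a t : ℝ}
    (hs : 0 ≤ s) (hsa : s ≤ a) (hat : a ≤ t) :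
    ‖v z s t - v z s a‖ ≤ 8 * ‖A‖ / (1 - r) ^ 2 * (t - a) := by
  have hzb : z ∈ unitBall n := mem_ball_zero_iff.2 (hz.trans_lt hr)
  have hx := hv.isFlowLine hzb hs hsa hat
  have := hx.ac.norm_sub_le hat (B := fun t => 8 * ‖A‖ / (1 - r) ^ 2 * t)
    (B' := fun _ => 8 * ‖A‖ / (1 - r) ^ 2) (by fun_prop)
    (fun t => by simpa using (hasDerivAt_id t).const_mul (8 * ‖A‖ / (1 - r) ^ 2)) (by
      filter_upwards [hx.ode] with τ h1 hmem
      refine ⟨_, h1 hmem, ?_⟩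
      rw [norm_neg]
      have hsτ := hsa.trans hmem.1.le
      exact (hh.classN τ (hs.trans hsτ)).norm_le hA hr
        ((hv.norm_le hA hh hzb hs hsτ).trans hz))
  rw [mul_sub]
  exact this

/-- The transition mappings are holomorphic. -/
theorem IsTransitionSolution.differentiableOn (hA : 0 < lowerIndex A) (hh : IsGenerator A h)
    (hv : IsTransitionSolution h v) {s t : ℝ} (hs : 0 ≤ s) (hst : s ≤ t) :
    DifferentiableOn ℂ (fun z => v z s t) (unitBall n) := by
  intro z hz
  refine DifferentiableAt.differentiableWithinAt ?_
  obtain ⟨r, hzr, hr⟩ := exists_between (mem_ball_zero_iff.1 hz)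
  obtain ⟨G, hG, HG⟩ := IsFlowLine.exists_gronwall (n := n) (A := A) hA hr
  obtain ⟨L, hL, HL⟩ := IsClassN.exists_lipschitz (A := A) hA hr
  set ρ := r - ‖z‖ with hρdef
  have hρ : 0 < ρ := by rw [hρdef]; linarith
  set K := Real.exp (G * (t - s)) with hK
  have hK0 : 0 < K := Real.exp_pos _
  have hzr' : ‖z‖ ≤ r := hzr.le
  have hnear : ∀ e : Cn n, ‖e‖ < ρ → ‖z + e‖ ≤ r := fun e he => by
    have := norm_add_le z e
    rw [hρdef] at he
    linarith
  have hmem : ∀ w : Cn n, ‖w‖ ≤ r → w ∈ unitBall n := fun w hw =>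
    mem_ball_zero_iff.2 (hw.trans_lt hr)
  -- Each increment Δ(e, ·) solves the linearized equation along v(z, s, ·) up to an error O(‖e‖²).
  -- Since actual increments stand in for solutions of that equation, no linear equation with
  -- measurable coefficients has to be solved.
  set Δ : Cn n → ℝ → Cn n := fun e τ => v (z + e) s τ - v z s τ with hΔ
  have hΔbound : ∀ e : Cn n, ‖e‖ < ρ → ∀ τ ∈ Icc s t, ‖Δ e τ‖ ≤ K * ‖e‖ := by
    intro e he τ hτ
    have hze := hmem _ (hnear e he)
    have h1 := (HG h hh _ _ s τ hs hτ.1 (hv.isFlowLine hze hs le_rfl hτ.1)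
      (hv.isFlowLine hz hs le_rfl hτ.1) (by rw [hv.initial _ hze s hs]; exact hnear e he)
      (by rw [hv.initial _ hz s hs]; exact hzr')).1
    rw [hv.initial _ hze s hs, hv.initial _ hz s hs, add_sub_cancel_left] at h1
    refine h1.trans (mul_le_mul_of_nonneg_right ?_ (norm_nonneg e))
    exact Real.exp_le_exp.2 (mul_le_mul_of_nonneg_left (by linarith [hτ.2]) hG)
  have hΔac : ∀ e : Cn n, ‖e‖ < ρ → AbsolutelyContinuousOnInterval (Δ e) s t := fun e he =>
    (hv.isFlowLine (hmem _ (hnear e he)) hs le_rfl hst).ac.sub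
      (hv.isFlowLine hz hs le_rfl hst).ac
  have hΔode : ∀ e : Cn n, ‖e‖ < ρ → ∀ᵐ τ : ℝ, τ ∈ Ioo s t → ∃ d : Cn n,
      HasDerivAt (Δ e) (-(fderiv ℂ (fun w => h w τ) (v z s τ) (Δ e τ)) + d) τ ∧
        ‖d‖ ≤ L * K ^ 2 * ‖e‖ ^ 2 := by
    intro e he
    have hze := hmem _ (hnear e he)
    filter_upwards [hv.ode z hz s hs, hv.ode (z + e) hze s hs] with τ h1 h2 hτ
    have hτ' := Ioo_subset_Icc_self hτ
    refine ⟨-(h (v (z + e) s τ) τ - h (v z s τ) τ -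
      fderiv ℂ (fun w => h w τ) (v z s τ) (Δ e τ)), ?_, ?_⟩
    · refine ((h2 hτ.1.le).sub (h1 hτ.1.le)).congr_deriv ?_
      abel
    · rw [norm_neg]
      have h3 := ((HL (fun w => h w τ) (hh.classN τ (hs.trans hτ.1.le)) (v z s τ)
        (mem_closedBall_zero_iff.2 ((hv.norm_le hA hh hz hs hτ.1.le).trans hzr'))).2
        (v (z + e) s τ)
        (mem_closedBall_zero_iff.2 ((hv.norm_le hA hh hze hs hτ.1.le).trans (hnear e he)))).2
      refine h3.trans ?_
      have h4 := hΔbound e he τ hτ'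
      calc L * ‖v (z + e) s τ - v z s τ‖ ^ 2 ≤ L * (K * ‖e‖) ^ 2 := by gcongr
        _ = L * K ^ 2 * ‖e‖ ^ 2 := by ring
  set C := Real.exp (L * (t - s)) * (L * K ^ 2 * (t - s)) with hC
  have hC0 : 0 ≤ C := by
    have : 0 ≤ t - s := by linarith
    positivity
  refine differentiableAt_of_approx_linear (K := n * K) (C := C) hρ fun ε hε => ?_
  -- The candidate derivative is the matrix of difference quotients with step η along the standard
  -- basis; η is chosen so small that its own quadratic errors contribute at most ε.
  obtain ⟨η, hη0, hη1, hη2⟩ : ∃ η : ℝ, 0 < η ∧ η < ρ ∧ C * (n * ρ * η) ≤ ε := by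
    have hD : 0 < C * (n * ρ) + 1 := by positivity
    refine ⟨min (ρ / 2) (ε / (C * (n * ρ) + 1)), by positivity,
      (min_le_left _ _).trans_lt (by linarith), ?_⟩
    calc C * (n * ρ * min (ρ / 2) (ε / (C * (n * ρ) + 1)))
        ≤ C * (n * ρ * (ε / (C * (n * ρ) + 1))) := by gcongr; exact min_le_right _ _
      _ = ε * ((C * (n * ρ)) / (C * (n * ρ) + 1)) := by ring
      _ ≤ ε * 1 := by
        gcongr
        rw [div_le_one hD]
        linarith
      _ = ε := mul_one ε
  set β : Fin n → Cn n := fun i => EuclideanSpace.single i (1 : ℂ) with hβ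
  have hβnorm : ∀ i, ‖(η : ℂ) • β i‖ = η := fun i => by
    rw [norm_smul, Complex.norm_real, Real.norm_of_nonneg hη0.le]
    simp [hβ]
  have hβρ : ∀ i, ‖(η : ℂ) • β i‖ < ρ := fun i => by rw [hβnorm]; exact hη1
  have hcoord : ∀ (e : Cn n) i, ‖e i‖ ≤ ‖e‖ := fun e i => PiLp.norm_apply_le e i
  have hsum : ∀ e : Cn n, ∑ i, (e i) • β i = e := fun e => by
    have := (EuclideanSpace.basisFun (Fin n) ℂ).sum_repr e
    simpa [hβ] using this
  have hη0' : (η : ℂ) ≠ 0 := by exact_mod_cast hη0.ne'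
  refine ⟨∑ i, (EuclideanSpace.proj i : Cn n →L[ℂ] ℂ).smulRight
    ((η : ℂ)⁻¹ • Δ ((η : ℂ) • β i) t), ?_, fun e he => ?_⟩
  · refine (norm_sum_le _ _).trans ?_
    calc ∑ i, ‖(EuclideanSpace.proj i : Cn n →L[ℂ] ℂ).smulRight
          ((η : ℂ)⁻¹ • Δ ((η : ℂ) • β i) t)‖ ≤ ∑ i : Fin n, K := by
          refine Finset.sum_le_sum fun i _ => ?_
          refine ContinuousLinearMap.opNorm_le_bound _ hK0.le fun e => ?_
          have h1 := hΔbound _ (hβρ i) t ⟨hst, le_rfl⟩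
          rw [hβnorm] at h1
          rw [ContinuousLinearMap.smulRight_apply, norm_smul, norm_smul, norm_inv,
            Complex.norm_real, Real.norm_of_nonneg hη0.le, mul_comm K]
          have h2 : η⁻¹ * ‖Δ ((η : ℂ) • β i) t‖ ≤ K := by
            rwa [inv_mul_le_iff₀ hη0, mul_comm η]
          exact mul_le_mul (hcoord e i) h2 (by positivity) (norm_nonneg e)
      _ = n * K := by simp
  -- D compares the true increment with its linear interpolation. It starts at 0 and solves the
  -- linearized equation up to O(‖e‖² + η), so Grönwall bounds it.
  · set D : ℝ → Cn n := fun τ => Δ e τ - ∑ i, (e i * (η : ℂ)⁻¹) • Δ ((η : ℂ) • β i) τ with hD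
    have hDac : AbsolutelyContinuousOnInterval D s t := by
      have h1 : ∀ S : Finset (Fin n), AbsolutelyContinuousOnInterval
          (fun τ => ∑ i ∈ S, (e i * (η : ℂ)⁻¹) • Δ ((η : ℂ) • β i) τ) s t := by
        intro S
        induction S using Finset.induction_on with
        | empty =>
          rw [absolutelyContinuousOnInterval_iff]
          exact fun ε hε => ⟨1, one_pos, fun I _ _ => by simpa using hε⟩
        | insert i S hi ih =>
          simp only [Finset.sum_insert hi]
          exact ((hΔac _ (hβρ i)).const_smul (e i * (η : ℂ)⁻¹)).add ih
      exact (hΔac e he).sub (h1 Finset.univ)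
    have hDs : D s = 0 := by
      have h1 : ∀ w : Cn n, ‖w‖ < ρ → Δ w s = w := fun w hw => by
        simp only [hΔ]
        rw [hv.initial _ (hmem _ (hnear w hw)) s hs, hv.initial z hz s hs, add_sub_cancel_left]
      simp only [hD, h1 e he, h1 _ (hβρ _), smul_smul, mul_assoc, inv_mul_cancel₀ hη0', mul_one,
        hsum, sub_self]
    have hDode : ∀ᵐ τ : ℝ, τ ∈ Ioo s t → ∃ f', HasDerivAt D f' τ ∧
        ‖f'‖ ≤ L * ‖D τ‖ + L * K ^ 2 * (‖e‖ ^ 2 + n * ρ * η) := by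
      filter_upwards [hΔode e he, ae_all_iff.2 fun i => hΔode _ (hβρ i)] with τ h1 h2 hτ
      obtain ⟨d, hd, hdb⟩ := h1 hτ
      choose d' hd' hdb' using fun i => h2 i hτ
      refine ⟨_, hd.sub (HasDerivAt.fun_sum fun i _ => (hd' i).const_smul (e i * (η : ℂ)⁻¹)), ?_⟩
      have hrew : -(fderiv ℂ (fun w => h w τ) (v z s τ) (Δ e τ)) + d -
          ∑ i, (e i * (η : ℂ)⁻¹) •
            (-(fderiv ℂ (fun w => h w τ) (v z s τ) (Δ ((η : ℂ) • β i) τ)) + d' i) =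
          -(fderiv ℂ (fun w => h w τ) (v z s τ) (D τ)) +
            (d - ∑ i, (e i * (η : ℂ)⁻¹) • d' i) := by
        simp only [hD, map_sub, map_sum, map_smul, smul_add, smul_neg, Finset.sum_add_distrib,
          Finset.sum_neg_distrib]
        abel
      rw [hrew]
      refine (norm_add_le _ _).trans (add_le_add ?_ ?_)
      · rw [norm_neg]
        refine ContinuousLinearMap.le_of_opNorm_le _ ?_ _
        exact (HL (fun w => h w τ) (hh.classN τ (hs.trans hτ.1.le)) (v z s τ)
          (mem_closedBall_zero_iff.2 ((hv.norm_le hA hh hz hs hτ.1.le).trans hzr'))).1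
      · refine (_root_.norm_sub_le _ _).trans ?_
        rw [mul_add]
        refine add_le_add hdb ((norm_sum_le _ _).trans ?_)
        calc ∑ i, ‖(e i * (η : ℂ)⁻¹) • d' i‖ ≤ ∑ i : Fin n, ρ * η * (L * K ^ 2) := by
              refine Finset.sum_le_sum fun i _ => ?_
              have h3 := hdb' i
              rw [hβnorm] at h3
              rw [norm_smul, norm_mul, norm_inv, Complex.norm_real, Real.norm_of_nonneg hη0.le]
              calc ‖e i‖ * η⁻¹ * ‖d' i‖ ≤ ρ * η⁻¹ * (L * K ^ 2 * η ^ 2) := by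
                    gcongr
                    exact (hcoord e i).trans he.le
                _ = ρ * η * (L * K ^ 2) := by field_simp
          _ = L * K ^ 2 * (n * ρ * η) := by
            rw [Finset.sum_const, Finset.card_univ, Fintype.card_fin, nsmul_eq_mul]; ring
    have h5 := hDac.norm_le_gronwall hL (c := L * K ^ 2 * (‖e‖ ^ 2 + n * ρ * η))
      (by positivity) hst hDode
    have h6 : v (z + e) s t - v z s t - (∑ i, (EuclideanSpace.proj i : Cn n →L[ℂ] ℂ).smulRight
        ((η : ℂ)⁻¹ • Δ ((η : ℂ) • β i) t)) e = D t := by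
      simp [hD, hΔ, mul_smul]
    rw [h6]
    refine h5.trans ?_
    rw [hDs, norm_zero, zero_add]
    have h7 : Real.exp (L * (t - s)) * (L * K ^ 2 * (‖e‖ ^ 2 + n * ρ * η) * (t - s)) =
        C * ‖e‖ ^ 2 + C * (n * ρ * η) := by rw [hC]; ring
    rw [h7]
    linarith

end Transition

/-! ### The spectral gap k₊(A) < m(A)(n₀ + 1) and the growth of e^{tA}. -/

section Spectrum

variable {n : ℕ} (A : Cn n →L[ℂ] Cn n)

theorem mem_spectrum_iff_exists_eigenvector (T : Cn n →L[ℂ] Cn n) (μ : ℂ) :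
    μ ∈ spectrum ℂ T ↔ ∃ x : Cn n, x ≠ 0 ∧ T x = μ • x := by
  rw [ContinuousLinearMap.spectrum_eq, ← Module.End.hasEigenvalue_iff_mem_spectrum]
  constructor
  · intro hμ
    obtain ⟨x, hx⟩ := hμ.exists_hasEigenvector
    exact ⟨x, hx.2, hx.apply_eq_smul⟩
  · rintro ⟨x, hx0, hx⟩
    exact Module.End.hasEigenvalue_of_hasEigenvector
      (Module.End.hasEigenvector_iff.2 ⟨Module.End.mem_eigenspace_iff.2 hx, hx0⟩)

theorem re_le_upperIndex {μ : ℂ} (hμ : μ ∈ spectrum ℂ A) : μ.re ≤ upperIndex A := by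
  refine le_csSup ?_ (mem_image_of_mem _ hμ)
  exact (((spectrum.isCompact (𝕜 := ℂ) A).image Complex.continuous_re)).bddAbove

variable {A}

/-- In dimension 0 there are no unit vectors and `sInf ∅` is 0, so positivity of m(A) excludes this
case. -/
theorem nontrivial_of_lowerIndex_pos (hA : 0 < lowerIndex A) : Nontrivial (Cn n) := by
  by_contra hcon
  rw [not_nontrivial_iff_subsingleton] at hcon
  have : {x : ℝ | ∃ z : Cn n, ‖z‖ = 1 ∧ x = (inner ℂ z (A z)).re} = ∅ := by
    refine eq_empty_of_forall_notMem ?_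
    rintro x ⟨z, hz, -⟩
    rw [Subsingleton.elim z 0, norm_zero] at hz
    exact zero_ne_one hz
  rw [lowerIndex, this, Real.sInf_empty] at hA
  exact lt_irrefl _ hA

theorem lowerIndex_le_upperIndex (hA : 0 < lowerIndex A) : lowerIndex A ≤ upperIndex A := by
  have := nontrivial_of_lowerIndex_pos hA
  obtain ⟨μ, hμ⟩ := spectrum.nonempty A
  obtain ⟨x, hx0, hx⟩ := (mem_spectrum_iff_exists_eigenvector A μ).1 hμ
  obtain ⟨u, hu, hxu⟩ := exists_unit_smul hx0
  have hAu : A u = μ • u := by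
    have h0 : ((‖x‖ : ℝ) : ℂ) ≠ 0 := by exact_mod_cast norm_ne_zero_iff.2 hx0
    rw [← hxu, map_smul, smul_comm] at hx
    exact smul_right_injective _ h0 hx
  have h1 := lowerIndex_le A hu
  rw [hAu, inner_smul_right, inner_self_eq_norm_sq_to_K, hu] at h1
  refine h1.trans (le_trans ?_ (re_le_upperIndex A hμ))
  simp

theorem one_le_criticalDegree (hA : 0 < lowerIndex A) : 1 ≤ criticalDegree A := by
  rw [criticalDegree, Nat.one_le_floor_iff, one_le_div hA]
  exact lowerIndex_le_upperIndex hA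

/-- The gap behind all convergence: the order-(n₀+1) remainder decays like e^{-m(n₀+1)t}, faster
than e^{tA} can grow. -/
theorem upperIndex_lt (hA : 0 < lowerIndex A) :
    upperIndex A < lowerIndex A * (criticalDegree A + 1) := by
  have := Nat.lt_floor_add_one (upperIndex A / lowerIndex A)
  rwa [div_lt_iff₀' hA] at this

variable (A)

theorem exp_apply_eigenvector {x : Cn n} {μ : ℂ} (hx : A x = μ • x) :
    NormedSpace.exp A x = Complex.exp μ • x := by
  have h1 := (NormedSpace.exp_series_hasSum_exp' (𝕂 := ℂ) A).mapL
    (ContinuousLinearMap.apply ℂ (Cn n) x)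
  have h2 : HasSum (fun k : ℕ => ((k.factorial : ℂ)⁻¹ • μ ^ k) • x) (Complex.exp μ • x) := by
    rw [Complex.exp_eq_exp_ℂ]
    exact (NormedSpace.exp_series_hasSum_exp' (𝕂 := ℂ) μ).smul_const x
  refine h1.unique ?_
  have hpow : ∀ k : ℕ, (A ^ k) x = μ ^ k • x := by
    intro k
    induction k with
    | zero => simp
    | succ k ih =>
      rw [pow_succ', mul_apply_eq_comp, ih, map_smul, hx, smul_smul, pow_succ]
  have h3 : (fun k : ℕ => (ContinuousLinearMap.apply ℂ (Cn n) x) ((k.factorial : ℂ)⁻¹ • A ^ k)) =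
      fun k : ℕ => ((k.factorial : ℂ)⁻¹ • μ ^ k) • x := by
    funext k
    rw [map_smul, ContinuousLinearMap.apply_apply, hpow, smul_assoc]
  rw [h3]
  exact h2

/-- An eigenspace of e^A is invariant under A, which commutes with e^A; an eigenvector of A inside
it exhibits the eigenvalue as e^l. -/
theorem exists_exp_of_mem_spectrum_exp {μ : ℂ} (hμ : μ ∈ spectrum ℂ (NormedSpace.exp A)) :
    ∃ l ∈ spectrum ℂ A, μ = Complex.exp l := by
  obtain ⟨x, hx0, hx⟩ := (mem_spectrum_iff_exists_eigenvector _ μ).1 hμ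
  set T : Module.End ℂ (Cn n) := (NormedSpace.exp A : Cn n →L[ℂ] Cn n).toLinearMap with hT
  set W := Module.End.eigenspace T μ with hW
  have hmem : ∀ w : Cn n, w ∈ W ↔ NormedSpace.exp A w = μ • w := fun w => by
    rw [hW, Module.End.mem_eigenspace_iff]; rfl
  have hcomm : ∀ w, NormedSpace.exp A (A w) = A (NormedSpace.exp A w) := by
    intro w
    have : Commute (NormedSpace.exp A) A := (Commute.refl A).exp_left
    exact congrArg (fun S : Cn n →L[ℂ] Cn n => S w) this.eq
  have hinv : ∀ w ∈ W, (A : Cn n →ₗ[ℂ] Cn n) w ∈ W := by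
    intro w hw
    rw [hmem] at hw ⊢
    change NormedSpace.exp A (A w) = μ • A w
    rw [hcomm, hw, map_smul]
  have : Nontrivial W := ⟨⟨⟨x, (hmem x).2 hx⟩, 0, fun h => hx0 (congrArg Subtype.val h)⟩⟩
  obtain ⟨l, hl⟩ := Module.End.exists_eigenvalue ((A : Cn n →ₗ[ℂ] Cn n).restrict hinv)
  obtain ⟨⟨w, hwW⟩, hw⟩ := hl.exists_hasEigenvector
  have hAw : A w = l • w := congrArg Subtype.val hw.apply_eq_smul
  have hw0 : w ≠ 0 := fun h => hw.2 (Subtype.ext h)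
  refine ⟨l, (mem_spectrum_iff_exists_eigenvector A l).2 ⟨w, hw0, hAw⟩, ?_⟩
  have h1 := exp_apply_eigenvector A hAw
  rw [(hmem w).1 hwW] at h1
  exact smul_left_injective ℂ hw0 h1

theorem expOp_zero : expOp A 0 = 1 := by
  have h : (0 : ℝ) • A = 0 := zero_smul ℝ A
  exact (congrArg NormedSpace.exp h).trans NormedSpace.exp_zero

theorem expOp_add (s t : ℝ) : expOp A (s + t) = expOp A s * expOp A t := by
  let _ := NormedAlgebra.restrictScalars ℚ ℂ (Cn n →L[ℂ] Cn n)
  have h : (s + t) • A = s • A + t • A := add_smul s t A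
  have hc : Commute (s • A) (t • A) := by
    refine ContinuousLinearMap.ext fun x => ?_
    change s • A (t • A x) = t • A (s • A x)
    rw [A.map_smul_of_tower, A.map_smul_of_tower, smul_comm]
  exact (congrArg NormedSpace.exp h).trans
    (NormedSpace.exp_add_of_commute hc)

theorem expOp_add_apply (s t : ℝ) (x : Cn n) : expOp A (s + t) x = expOp A s (expOp A t x) := by
  rw [expOp_add]; rfl

theorem expOp_neg_apply (t : ℝ) (x : Cn n) : expOp A (-t) (expOp A t x) = x := by
  rw [← expOp_add_apply, neg_add_cancel, expOp_zero]; rfl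

theorem expOp_apply_neg (t : ℝ) (x : Cn n) : expOp A t (expOp A (-t) x) = x := by
  rw [← expOp_add_apply, add_neg_cancel, expOp_zero]; rfl

theorem expOp_natCast (j : ℕ) : expOp A j = NormedSpace.exp A ^ j := by
  induction j with
  | zero => rw [Nat.cast_zero, expOp_zero, pow_zero]
  | succ j ih =>
    have h : (1 : ℝ) • A = A := one_smul ℝ A
    have h1 : expOp A 1 = NormedSpace.exp A := congrArg NormedSpace.exp h
    rw [Nat.cast_succ, expOp_add, ih, pow_succ, h1]

theorem hasDerivAt_expOp (t : ℝ) : HasDerivAt (expOp A) (expOp A t * A) t :=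
  hasDerivAt_exp_smul_const A t

theorem continuous_expOp : Continuous (expOp A) :=
  continuous_iff_continuousAt.2 fun t => (hasDerivAt_expOp A t).continuousAt

theorem contDiff_expOp : ContDiff ℝ 1 (expOp A) := by
  rw [contDiff_one_iff_deriv]
  refine ⟨fun t => (hasDerivAt_expOp A t).differentiableAt, ?_⟩
  have : deriv (expOp A) = fun t => expOp A t * A := funext fun t => (hasDerivAt_expOp A t).deriv
  rw [this]
  exact (continuous_expOp A).mul continuous_const

variable {A}

/-- By the previous spectral inclusion the spectral radius of e^A is at most e^{k₊} < e^{k₊+ε}.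
Gelfand's formula then bounds large integer powers, and compactness handles small t and fractional
parts. -/
theorem exists_norm_expOp_le (hA : 0 < lowerIndex A) {ε : ℝ} (hε : 0 < ε) :
    ∃ C : ℝ, 1 ≤ C ∧ ∀ t : ℝ, 0 ≤ t → ‖expOp A t‖ ≤ C * Real.exp ((upperIndex A + ε) * t) := by
  have hnt := nontrivial_of_lowerIndex_pos hA
  set k := upperIndex A + ε with hk
  have hk0 : 0 ≤ k := by linarith [lowerIndex_le_upperIndex hA]
  have hrad : spectralRadius ℂ (NormedSpace.exp A) < ENNReal.ofReal (Real.exp k) := by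
    refine lt_of_le_of_lt (iSup₂_le fun μ hμ => ?_) ((ENNReal.ofReal_lt_ofReal_iff
      (Real.exp_pos _)).2 (Real.exp_lt_exp.2 (by linarith : upperIndex A < k)))
    obtain ⟨l, hl, rfl⟩ := exists_exp_of_mem_spectrum_exp A hμ
    rw [← enorm_eq_nnnorm, ← ofReal_norm, Complex.norm_exp]
    exact ENNReal.ofReal_le_ofReal (Real.exp_le_exp.2 (re_le_upperIndex A hl))
  have hev := (spectrum.pow_norm_pow_one_div_tendsto_nhds_spectralRadius
    (NormedSpace.exp A)).eventually_lt_const hrad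
  obtain ⟨N, hN⟩ := eventually_atTop.1 (hev.and (eventually_ge_atTop 1))
  have hpow : ∀ j : ℕ, N ≤ j → ‖expOp A j‖ ≤ Real.exp (k * j) := by
    intro j hj
    obtain ⟨h1, h2⟩ := hN j hj
    rw [ENNReal.ofReal_lt_ofReal_iff (Real.exp_pos _)] at h1
    have hj0 : (j : ℝ) ≠ 0 := by positivity
    have h3 := Real.rpow_le_rpow (by positivity) h1.le (Nat.cast_nonneg j : (0 : ℝ) ≤ j)
    rw [← Real.rpow_mul (norm_nonneg _), one_div, inv_mul_cancel₀ hj0, Real.rpow_one,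
      ← Real.exp_mul, ← expOp_natCast] at h3
    exact h3
  obtain ⟨C₀, hC₀⟩ := (isCompact_Icc (a := (0 : ℝ)) (b := N + 1)).exists_bound_of_continuousOn
    (continuous_expOp A).continuousOn
  refine ⟨max C₀ 1, le_max_right _ _, fun t ht => ?_⟩
  rcases le_or_gt t N with htN | htN
  · refine (hC₀ t ⟨ht, by linarith⟩).trans ((le_max_left C₀ 1).trans ?_)
    exact le_mul_of_one_le_right (zero_le_one.trans (le_max_right _ _))
      (Real.one_le_exp (mul_nonneg hk0 ht))
  · have hfl := Nat.floor_le ht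
    have hfl2 := Nat.lt_floor_add_one t
    have hNfl : N ≤ ⌊t⌋₊ := Nat.le_floor htN.le
    have h1 := hpow _ hNfl
    have hNN : (0 : ℝ) ≤ N := Nat.cast_nonneg N
    have h2 := hC₀ (t - ⌊t⌋₊) ⟨by linarith, by linarith⟩
    have h3 : expOp A t = expOp A (t - ⌊t⌋₊) * expOp A ⌊t⌋₊ := by
      rw [← expOp_add, sub_add_cancel]
    rw [h3]
    refine (norm_mul_le _ _).trans ?_
    refine mul_le_mul (h2.trans (le_max_left _ _)) (h1.trans ?_) (norm_nonneg _)
      (zero_le_one.trans (le_max_right _ _))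
    exact Real.exp_le_exp.2 (mul_le_mul_of_nonneg_left hfl hk0)

end Spectrum

/-! ### Calculus of homogeneous polynomials with moving coefficients and arguments. -/

section Diagonal

variable {E G V : Type*} [NormedAddCommGroup E] [NormedSpace ℂ E] [NormedAddCommGroup G]
  [NormedSpace ℂ G] [NormedAddCommGroup V] [NormedSpace ℂ V] {k : ℕ}

/-- Strict differentiability serves twice: as the product rule, and as local Lipschitz continuity,
which preserves absolute continuity. -/
theorem exists_hasStrictFDerivAt_diag (p : (E [×k]→L[ℂ] G) × E) :
    ∃ L : (E [×k]→L[ℂ] G) × E →L[ℂ] G,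
      HasStrictFDerivAt (fun q : (E [×k]→L[ℂ] G) × E => q.1 (fun _ => q.2)) L p ∧
      ∀ Q w, L (Q, w) = Q (fun _ => p.2) + ∑ i, p.1 (Function.update (fun _ => p.2) i w) := by
  set D : (E [×k]→L[ℂ] G) × E →L[ℂ] (E [×k]→L[ℂ] G) × (Fin k → E) :=
    (ContinuousLinearMap.fst ℂ _ _).prod
      (ContinuousLinearMap.pi fun _ => ContinuousLinearMap.snd ℂ _ _) with hD
  have h1 := (ContinuousMultilinearMap.hasStrictFDerivAt_uncurry (D p)).comp p
    (D.hasStrictFDerivAt (x := p))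
  refine ⟨_, h1, fun Q w => ?_⟩
  simp [hD, ContinuousMultilinearMap.linearDeriv_apply]

theorem hasDerivAt_submodule_val [NormedSpace ℝ V] [IsScalarTower ℝ ℂ V] (S : Submodule ℂ V)
    {Q : ℝ → S} {t : ℝ} (hQ : DifferentiableAt ℝ Q t) :
    HasDerivAt (fun τ => (Q τ : V)) (deriv Q t : S) t :=
  (S.subtypeL.restrictScalars ℝ).hasFDerivAt.comp_hasDerivAt t hQ.hasDerivAt

theorem absolutelyContinuousOnInterval_submodule_val (S : Submodule ℂ V)
    {Q : ℝ → S} {a b : ℝ} (hQ : AbsolutelyContinuousOnInterval Q a b) :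
    AbsolutelyContinuousOnInterval (fun τ => (Q τ : V)) a b := hQ

theorem hasDerivAt_diag [NormedSpace ℝ E] [IsScalarTower ℝ ℂ E] [NormedSpace ℝ G]
    [IsScalarTower ℝ ℂ G] {Q : ℝ → E [×k]→L[ℂ] G} {Q' : E [×k]→L[ℂ] G} {x : ℝ → E} {x' : E}
    {t : ℝ} (hQ : HasDerivAt Q Q' t) (hx : HasDerivAt x x' t) :
    HasDerivAt (fun τ => Q τ (fun _ => x τ))
      (Q' (fun _ => x t) + ∑ i, Q t (Function.update (fun _ => x t) i x')) t := by
  obtain ⟨L, hL, hval⟩ := exists_hasStrictFDerivAt_diag (Q t, x t)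
  have h1 := (hL.hasFDerivAt.restrictScalars ℝ).comp_hasDerivAt t (hQ.prodMk hx)
  exact h1.congr_deriv (hval _ _)

theorem absolutelyContinuousOnInterval_comp_prod {Ψ : V × E → G}
    (hΨ : ∀ p, ∃ L : V × E →L[ℂ] G, HasStrictFDerivAt Ψ L p) {Q : ℝ → V} {x : ℝ → E} {a b : ℝ}
    (hQ : AbsolutelyContinuousOnInterval Q a b) (hx : AbsolutelyContinuousOnInterval x a b) :
    AbsolutelyContinuousOnInterval (fun τ => Ψ (Q τ, x τ)) a b := by
  have h1 : LocallyLipschitzOn univ Ψ := by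
    intro p _
    obtain ⟨L, hL⟩ := hΨ p
    obtain ⟨K, S, hS, hK⟩ := hL.exists_lipschitzOnWith
    exact ⟨K, S, mem_nhdsWithin_of_mem_nhds hS, hK⟩
  exact h1.comp_absolutelyContinuousOnInterval (hQ.prodMk hx)
    (hQ.continuousOn.prodMk hx.continuousOn) (mapsTo_univ _ _)

theorem absolutelyContinuousOnInterval_diag {Q : ℝ → E [×k]→L[ℂ] G} {x : ℝ → E} {a b : ℝ}
    (hQ : AbsolutelyContinuousOnInterval Q a b) (hx : AbsolutelyContinuousOnInterval x a b) :
    AbsolutelyContinuousOnInterval (fun τ => Q τ (fun _ => x τ)) a b :=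
  absolutelyContinuousOnInterval_comp_prod (Ψ := fun q : (E [×k]→L[ℂ] G) × E => q.1 fun _ => q.2)
    (fun p => (exists_hasStrictFDerivAt_diag p).imp fun _ h => h.1) hQ hx

theorem differentiable_diag (Q : E [×k]→L[ℂ] G) : Differentiable ℂ fun z => Q (fun _ => z) := by
  intro z
  obtain ⟨L, hL, -⟩ := exists_hasStrictFDerivAt_diag (Q, z)
  exact DifferentiableAt.comp (f := fun z => (Q, z)) z
    hL.hasFDerivAt.differentiableAt ((differentiableAt_const _).prodMk differentiableAt_id)

end Diagonal

section HomPoly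

variable {n k : ℕ}

theorem norm_homDiag_le (Q : HomPoly n k) (z : Cn n) : ‖homDiag Q z‖ ≤ ‖Q‖ * ‖z‖ ^ k := by
  have := Q.1.le_opNorm (fun _ => z)
  simpa [homDiag] using this

theorem norm_homPolar_le (Q : HomPoly n (k + 1)) (w z : Cn n) :
    ‖homPolar Q w z‖ ≤ ‖Q‖ * (‖w‖ * ‖z‖ ^ k) := by
  have := Q.1.le_opNorm (fun i => if (i : ℕ) = 0 then w else z)
  simpa [homPolar, Fin.prod_univ_succ] using this

theorem homDiag_smul (c : ℂ) (Q : HomPoly n k) (z : Cn n) :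
    homDiag Q (c • z) = c ^ k • homDiag Q z := by
  have := Q.1.map_smul_univ (fun _ => c) (fun _ => z)
  simpa [homDiag] using this

/-- By symmetry the slot i may be exchanged with slot 0. Hence the k terms of the derivative of the
diagonal coincide and give k Q(w, z^{k-1}). -/
theorem update_eq_homPolar (Q : HomPoly n k) (w z : Cn n) (i : Fin k) :
    Q.1 (Function.update (fun _ => z) i w) = homPolar Q w z := by
  have hk : 0 < k := i.pos
  set o : Fin k := ⟨0, hk⟩
  have h1 := Q.2 (Equiv.swap i o) (fun j : Fin k => if (j : ℕ) = 0 then w else z)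
  rw [homPolar, ← h1]
  congr 1
  funext j
  rcases eq_or_ne j i with rfl | hj
  · simp [o]
  · rw [Function.update_of_ne hj]
    have : Equiv.swap i o j ≠ o := by
      intro h
      exact hj ((Equiv.swap i o).injective (h.trans (Equiv.swap_apply_left i o).symm))
    have h2 : ((Equiv.swap i o j : Fin k) : ℕ) ≠ 0 := fun h => this (Fin.ext h)
    rw [if_neg h2]

/-- `Q ↦ Q(w, z^{k-1})` is linear in `w`. -/
noncomputable def homPolarL (Q : HomPoly n (k + 1)) (z : Cn n) : Cn n →L[ℂ] Cn n :=
  Q.1.toContinuousLinearMap (fun _ => z) 0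

theorem homPolarL_apply (Q : HomPoly n (k + 1)) (w z : Cn n) :
    homPolarL Q z w = homPolar Q w z :=
  update_eq_homPolar Q w z 0

theorem homPolar_sub (Q : HomPoly n (k + 1)) (w w' z : Cn n) :
    homPolar Q (w - w') z = homPolar Q w z - homPolar Q w' z := by
  simp only [← homPolarL_apply, map_sub]

theorem homPolar_sum (Q : HomPoly n (k + 1)) {ι : Type*} (S : Finset ι) (f : ι → Cn n)
    (z : Cn n) : homPolar Q (∑ i ∈ S, f i) z = ∑ i ∈ S, homPolar Q (f i) z := by
  simp only [← homPolarL_apply, map_sum]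

theorem homPolar_neg (Q : HomPoly n (k + 1)) (w z : Cn n) :
    homPolar Q (-w) z = -homPolar Q w z := by
  simp only [← homPolarL_apply, map_neg]

theorem hasDerivAt_homDiag {Q : ℝ → HomPoly n k} {x : ℝ → Cn n} {x' : Cn n}
    {t : ℝ} (hQ : DifferentiableAt ℝ Q t) (hx : HasDerivAt x x' t) :
    HasDerivAt (fun τ => homDiag (Q τ) (x τ))
      (homDiag (deriv Q t) (x t) + (k : ℂ) • homPolar (Q t) x' (x t)) t := by
  have h1 := hasDerivAt_diag (hasDerivAt_submodule_val _ hQ) hx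
  refine h1.congr_deriv ?_
  simp only [update_eq_homPolar, Finset.sum_const, Finset.card_univ, Fintype.card_fin,
    Nat.cast_smul_eq_nsmul]
  rfl

theorem absolutelyContinuousOnInterval_homDiag {Q : ℝ → HomPoly n k} {x : ℝ → Cn n} {a b : ℝ}
    (hQ : AbsolutelyContinuousOnInterval Q a b) (hx : AbsolutelyContinuousOnInterval x a b) :
    AbsolutelyContinuousOnInterval (fun τ => homDiag (Q τ) (x τ)) a b :=
  absolutelyContinuousOnInterval_diag (absolutelyContinuousOnInterval_submodule_val _ hQ) hx

theorem differentiable_homDiag (Q : HomPoly n k) : Differentiable ℂ (homDiag Q) :=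
  differentiable_diag Q.1

/-- Polarization: a homogeneous polynomial determines its symmetric multilinear mapping. -/
theorem homPoly_ext {P Q : HomPoly n k} (h : ∀ z, homDiag P z = homDiag Q z) : P = Q := by
  have key : ∀ (R : HomPoly n k) (x : Fin k → Cn n),
      iteratedFDeriv ℂ k (homDiag R) 0 x = (k.factorial : ℂ) • R.1 x := by
    intro R x
    have h1 := R.1.iteratedFDeriv_comp_diagonal 0 x
    have h2 : ∀ σ : Equiv.Perm (Fin k), R.1 (fun i => x (σ i)) = R.1 x := fun σ => R.2 σ x
    simp only [h2, Finset.sum_const, Finset.card_univ, Fintype.card_perm, Fintype.card_fin] at h1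
    rw [Nat.cast_smul_eq_nsmul]
    exact h1
  have hPQ : homDiag P = homDiag Q := funext h
  refine Subtype.ext (ContinuousMultilinearMap.ext fun x => ?_)
  have h1 := key P x
  rw [hPQ, key Q x] at h1
  have h0 : (k.factorial : ℂ) ≠ 0 := by exact_mod_cast k.factorial_ne_zero
  exact (smul_right_injective _ h0 h1).symm

end HomPoly

/-! ### Cancellation in the coefficient equations. -/

section Remainder

variable {n : ℕ} {A : Cn n →L[ℂ] Cn n}

/-- The rate of change along the flow that is left over once the coefficient equations hold. -/
noncomputable def flowRemainder (A : Cn n →L[ℂ] Cn n) (h : Cn n → ℝ → Cn n)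
    (F : ∀ k : ℕ, ℝ → HomPoly n k) (N : ℕ) (t : ℝ) (w : Cn n) : Cn n :=
  A (w + ∑ k ∈ Finset.Icc 2 N, homDiag (F k t) w) +
    (-(h w t) + ∑ k ∈ Finset.Icc 2 N, (coeffB A (F k t) w + coeffN h F k t w +
      (k : ℂ) • homPolar (F k t) (-(h w t)) w))

theorem homPolar_sub' {k : ℕ} (hk : 2 ≤ k) (Q : HomPoly n k) (w w' z : Cn n) :
    homPolar Q (w - w') z = homPolar Q w z - homPolar Q w' z := by
  obtain ⟨k, rfl⟩ := Nat.exists_eq_add_of_le' hk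
  exact homPolar_sub Q w w' z

theorem homPolar_sum' {k : ℕ} (hk : 2 ≤ k) (Q : HomPoly n k) {ι : Type*} (S : Finset ι)
    (f : ι → Cn n) (z : Cn n) :
    homPolar Q (∑ i ∈ S, f i) z = ∑ i ∈ S, homPolar Q (f i) z := by
  obtain ⟨k, rfl⟩ := Nat.exists_eq_add_of_le' hk
  exact homPolar_sum Q S f z

theorem homPolar_neg' {k : ℕ} (hk : 2 ≤ k) (Q : HomPoly n k) (w z : Cn n) :
    homPolar Q (-w) z = -homPolar Q w z := by
  obtain ⟨k, rfl⟩ := Nat.exists_eq_add_of_le' hk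
  exact homPolar_neg Q w z

theorem sum_range_taylorTerm {f : Cn n → Cn n} (hf : IsClassN A f) (w : Cn n) (N : ℕ) :
    ∑ l ∈ Finset.range (N + 2), taylorTerm f l w =
      A w + ∑ l ∈ Finset.Icc 2 (N + 1), taylorTerm f l w := by
  rw [← Finset.sum_range_add_sum_Ico _ (by omega : 2 ≤ N + 2), Finset.sum_range_succ,
    Finset.sum_range_one, taylorTerm_zero, taylorTerm_one, hf.map_zero, hf.deriv_zero, zero_add]
  rfl

/-- The double sum in the N_k recombines into the Taylor polynomials of `h` inserted into the polar
forms, so only Taylor tails survive: one of order N + 1, and for each k one of order N - k + 2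
paired with z^{k-1}. Every surviving term thus has order at least N + 1. -/
theorem flowRemainder_eq {h : Cn n → ℝ → Cn n} {t : ℝ} (hh : IsClassN A fun z => h z t)
    (F : ∀ k : ℕ, ℝ → HomPoly n k) {N : ℕ} (hN : 1 ≤ N) (w : Cn n) :
    flowRemainder A h F N t w =
      -(h w t - ∑ l ∈ Finset.range (N + 1), taylorTerm (fun z => h z t) l w) -
        ∑ k ∈ Finset.Icc 2 N, (k : ℂ) • homPolar (F k t)
          (h w t - ∑ l ∈ Finset.range (N - k + 2), taylorTerm (fun z => h z t) l w) w := by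
  set T := fun l => taylorTerm (fun z => h z t) l w with hT
  have hswap : ∑ k ∈ Finset.Icc 2 N, ∑ j ∈ Finset.Ico 2 k,
      (j : ℂ) • homPolar (F j t) (T (k - j + 1)) w =
      ∑ j ∈ Finset.Icc 2 N, ∑ k ∈ Finset.Ioc j N,
        (j : ℂ) • homPolar (F j t) (T (k - j + 1)) w := by
    refine Finset.sum_comm' fun k j => ?_
    simp only [Finset.mem_Icc, Finset.mem_Ico, Finset.mem_Ioc]
    omega
  -- Substitution l = k - j + 1, the degree of the Taylor term of `h`.
  have hshift : ∀ j ∈ Finset.Icc 2 N, ∑ k ∈ Finset.Ioc j N,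
      (j : ℂ) • homPolar (F j t) (T (k - j + 1)) w =
      (j : ℂ) • homPolar (F j t) (∑ l ∈ Finset.Icc 2 (N - j + 1), T l) w := by
    intro j hj
    rw [Finset.mem_Icc] at hj
    rw [homPolar_sum' hj.1, Finset.smul_sum]
    refine Finset.sum_bij' (fun k _ => k - j + 1) (fun l _ => l + j - 1) ?_ ?_ ?_ ?_ ?_
    · intro k hk
      simp only [Finset.mem_Icc, Finset.mem_Ioc] at hk ⊢
      omega
    · intro k hk
      simp only [Finset.mem_Icc, Finset.mem_Ioc] at hk ⊢
      omega
    · intro k hk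
      simp only [Finset.mem_Ioc] at hk ⊢
      omega
    · intro k hk
      simp only [Finset.mem_Icc] at hk ⊢
      omega
    · intro k hk
      rfl
  have hterm : ∀ k ∈ Finset.Icc 2 N, (k : ℂ) • homPolar (F k t)
      (h w t - ∑ l ∈ Finset.range (N - k + 2), T l) w =
      (k : ℂ) • homPolar (F k t) (h w t) w - (k : ℂ) • homPolar (F k t) (A w) w -
        ∑ i ∈ Finset.Ioc k N, (k : ℂ) • homPolar (F k t) (T (i - k + 1)) w := by
    intro k hk
    rw [hshift k hk]
    rw [Finset.mem_Icc] at hk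
    rw [sum_range_taylorTerm hh, ← sub_sub, homPolar_sub' hk.1, homPolar_sub' hk.1, smul_sub,
      smul_sub]
  have hterm2 : ∀ k ∈ Finset.Icc 2 N, coeffB A (F k t) w + coeffN h F k t w +
      (k : ℂ) • homPolar (F k t) (-(h w t)) w =
      (k : ℂ) • homPolar (F k t) (A w) w - A (homDiag (F k t) w) + (T k +
        ∑ j ∈ Finset.Ico 2 k, (j : ℂ) • homPolar (F j t) (T (k - j + 1)) w) -
        (k : ℂ) • homPolar (F k t) (h w t) w := by
    intro k hk
    rw [Finset.mem_Icc] at hk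
    rw [homPolar_neg' hk.1, smul_neg, ← sub_eq_add_neg]
    rfl
  obtain ⟨N', rfl⟩ := Nat.exists_eq_add_of_le' hN
  rw [flowRemainder, Finset.sum_congr rfl hterm2, Finset.sum_congr rfl hterm,
    sum_range_taylorTerm hh, map_add, map_sum]
  simp only [Finset.sum_add_distrib, Finset.sum_sub_distrib]
  rw [hswap]
  abel

theorem exists_norm_flowRemainder_le (hA : 0 < lowerIndex A) {N : ℕ} (hN : 1 ≤ N) :
    ∃ C : ℝ, 0 ≤ C ∧ ∀ (h : Cn n → ℝ → Cn n) (t : ℝ) (F : ∀ k : ℕ, ℝ → HomPoly n k) (B : ℝ),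
      IsClassN A (fun z => h z t) → 0 ≤ B → (∀ k, 2 ≤ k → k ≤ N → ‖F k t‖ ≤ B) →
      ∀ w : Cn n, ‖w‖ ≤ 1 / 2 → ‖flowRemainder A h F N t w‖ ≤ C * (1 + B) * ‖w‖ ^ (N + 1) := by
  obtain ⟨C₀, hC₀, H⟩ := IsClassN.exists_taylor_bound (A := A) hA
  set C₁ := C₀ * (3 / 2) ^ (N + 1) with hC₁
  refine ⟨C₁ + N * N * C₁, by positivity, fun h t F B hh hB hF w hw => ?_⟩
  have h1 := H _ hh w hw (N + 1) (by omega)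
  rw [mul_pow, ← mul_assoc] at h1
  have h2 : ∀ k ∈ Finset.Icc 2 N, ‖(k : ℂ) • homPolar (F k t)
      (h w t - ∑ l ∈ Finset.range (N - k + 2), taylorTerm (fun z => h z t) l w) w‖ ≤
      N * (B * (C₁ * ‖w‖ ^ (N + 1))) := by
    intro k hk
    rw [Finset.mem_Icc] at hk
    have h3 := H _ hh w hw (N - k + 2) (by omega)
    have h4 := hF k hk.1 hk.2
    rw [norm_smul, Complex.norm_natCast]
    obtain ⟨j, rfl⟩ := Nat.exists_eq_add_of_le' (show 1 ≤ k by omega)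
    refine mul_le_mul (by exact_mod_cast hk.2) ?_ (norm_nonneg _) (Nat.cast_nonneg _)
    refine (norm_homPolar_le _ _ _).trans (mul_le_mul h4 ?_ (by positivity) hB)
    calc ‖h w t - ∑ l ∈ Finset.range (N - (j + 1) + 2), taylorTerm (fun z => h z t) l w‖ * ‖w‖ ^ j
        ≤ C₀ * (3 / 2 * ‖w‖) ^ (N - (j + 1) + 2) * ‖w‖ ^ j := by gcongr
      _ = C₀ * (3 / 2) ^ (N - (j + 1) + 2) * ‖w‖ ^ (N + 1) := by
        rw [mul_pow, mul_assoc, mul_assoc, mul_assoc, ← pow_add,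
          show N - (j + 1) + 2 + j = N + 1 by omega]
      _ ≤ C₀ * (3 / 2) ^ (N + 1) * ‖w‖ ^ (N + 1) := by
        have : N - (j + 1) + 2 ≤ N + 1 := by omega
        gcongr
        norm_num
  rw [flowRemainder_eq hh F hN]
  refine (norm_sub_le _ _).trans ?_
  rw [norm_neg]
  have h5 := (norm_sum_le _ _).trans (Finset.sum_le_card_nsmul _ _ _ h2)
  rw [nsmul_eq_mul, Nat.card_Icc] at h5
  have h6 : ((N + 1 - 2 : ℕ) : ℝ) ≤ N := by exact_mod_cast (by omega)
  have hX : 0 ≤ C₁ * ‖w‖ ^ (N + 1) := by positivity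
  have h7 : ((N + 1 - 2 : ℕ) : ℝ) * (N * (B * (C₁ * ‖w‖ ^ (N + 1)))) ≤
      N * (N * (B * (C₁ * ‖w‖ ^ (N + 1)))) :=
    mul_le_mul_of_nonneg_right h6 (by positivity)
  have h8 : 0 ≤ (N : ℝ) * N * (C₁ * ‖w‖ ^ (N + 1)) := by positivity
  have h9 : 0 ≤ B * (C₁ * ‖w‖ ^ (N + 1)) := by positivity
  calc _ ≤ C₁ * ‖w‖ ^ (N + 1) + N * (N * (B * (C₁ * ‖w‖ ^ (N + 1)))) :=
        add_le_add h1 (h5.trans h7)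
    _ ≤ (C₁ + N * N * C₁) * (1 + B) * ‖w‖ ^ (N + 1) := by nlinarith

end Remainder

theorem hasDerivAt_clm_apply {E G : Type*} [NormedAddCommGroup E] [NormedSpace ℂ E]
    [NormedSpace ℝ E] [IsScalarTower ℝ ℂ E] [NormedAddCommGroup G] [NormedSpace ℂ G]
    [NormedSpace ℝ G] [IsScalarTower ℝ ℂ G] {T : ℝ → E →L[ℂ] G} {T' : E →L[ℂ] G} {x : ℝ → E}
    {x' : E} {t : ℝ} (hT : HasDerivAt T T' t) (hx : HasDerivAt x x' t) :
    HasDerivAt (fun τ => T τ (x τ)) (T t x' + T' (x t)) t := by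
  have h1 := (((isBoundedBilinearMap_apply (𝕜 := ℂ) (E := E) (F := G)).hasFDerivAt
    (T t, x t)).restrictScalars ℝ).comp_hasDerivAt t (hT.prodMk hx)
  exact h1.congr_deriv (by simp)

/-! ### Convergence of the approximations e^{tA}(v + ∑ F_k(v^k, t)). -/

section ChainData

variable {n : ℕ} {A : Cn n →L[ℂ] Cn n} {h : Cn n → ℝ → Cn n} {v : Cn n → ℝ → ℝ → Cn n}
  {F : ∀ k : ℕ, ℝ → HomPoly n k} {B : ℝ} {d : ℕ} {g : Cn n → ℝ → Cn n}

/-- A generator, its transition mappings, and solutions of the coefficient equations that grow at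
most like `B (1 + t)^d`. -/
structure ChainData (A : Cn n →L[ℂ] Cn n) (h : Cn n → ℝ → Cn n) (v : Cn n → ℝ → ℝ → Cn n)
    (F : ∀ k : ℕ, ℝ → HomPoly n k) (B : ℝ) (d : ℕ) : Prop where
  gen : IsGenerator A h
  trans : IsTransitionSolution h v
  coeff : IsCoeffSolution A h (criticalDegree A) F
  bound : ∀ k : ℕ, 2 ≤ k → k ≤ criticalDegree A → ∀ t : ℝ, 0 ≤ t → ‖F k t‖ ≤ B * (1 + t) ^ d

/-- `z + ∑_{k=2}^{n₀} F_k(z^k, t)`. -/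
noncomputable def polyApprox (A : Cn n →L[ℂ] Cn n) (F : ∀ k : ℕ, ℝ → HomPoly n k) (t : ℝ)
    (z : Cn n) : Cn n :=
  z + ∑ k ∈ Finset.Icc 2 (criticalDegree A), homDiag (F k t) z

/-- The approximations of the Loewner chain. -/
noncomputable def chainApprox (A : Cn n →L[ℂ] Cn n) (v : Cn n → ℝ → ℝ → Cn n)
    (F : ∀ k : ℕ, ℝ → HomPoly n k) (z : Cn n) (s t : ℝ) : Cn n :=
  expOp A t (polyApprox A F t (v z s t))

theorem differentiable_polyApprox (F : ∀ k : ℕ, ℝ → HomPoly n k) (t : ℝ) :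
    Differentiable ℂ (polyApprox A F t) :=
  differentiable_id.add (Differentiable.fun_sum fun k _ => differentiable_homDiag (F k t))

theorem ChainData.norm_polyApprox_le (hD : ChainData A h v F B d) (hB : 0 ≤ B) {t : ℝ}
    (ht : 0 ≤ t) {z : Cn n} (hz : ‖z‖ ≤ 1) :
    ‖polyApprox A F t z‖ ≤ (1 + criticalDegree A * B) * (1 + t) ^ d := by
  have h1 : 1 ≤ (1 + t) ^ d := one_le_pow₀ (by linarith)
  refine (norm_add_le _ _).trans ?_
  have h2 : ∀ k ∈ Finset.Icc 2 (criticalDegree A), ‖homDiag (F k t) z‖ ≤ B * (1 + t) ^ d := by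
    intro k hk
    rw [Finset.mem_Icc] at hk
    refine (norm_homDiag_le _ _).trans ?_
    refine (mul_le_of_le_one_right (norm_nonneg (F k t)) (pow_le_one₀ (norm_nonneg z) hz)).trans ?_
    exact hD.bound k hk.1 hk.2 t ht
  have h3 := (norm_sum_le (Finset.Icc 2 (criticalDegree A)) fun k => homDiag (F k t) z).trans
    (Finset.sum_le_card_nsmul _ _ _ h2)
  rw [nsmul_eq_mul, Nat.card_Icc] at h3
  have h4 : ((criticalDegree A + 1 - 2 : ℕ) : ℝ) ≤ criticalDegree A := by
    exact_mod_cast (by omega)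
  have h5 : ((criticalDegree A + 1 - 2 : ℕ) : ℝ) * (B * (1 + t) ^ d) ≤
      criticalDegree A * (B * (1 + t) ^ d) :=
    mul_le_mul_of_nonneg_right h4 (by positivity)
  calc _ ≤ 1 + criticalDegree A * (B * (1 + t) ^ d) := add_le_add hz (h3.trans h5)
    _ ≤ (1 + criticalDegree A * B) * (1 + t) ^ d := by nlinarith

theorem absolutelyContinuousOnInterval_clm_apply {T : ℝ → Cn n →L[ℂ] Cn n} {x : ℝ → Cn n}
    {a b : ℝ} (hT : AbsolutelyContinuousOnInterval T a b)
    (hx : AbsolutelyContinuousOnInterval x a b) :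
    AbsolutelyContinuousOnInterval (fun t => T t (x t)) a b :=
  absolutelyContinuousOnInterval_comp_prod
    (Ψ := fun p : (Cn n →L[ℂ] Cn n) × Cn n => p.1 p.2)
    (fun p => ⟨_, isBoundedBilinearMap_apply.hasStrictFDerivAt p⟩) hT hx

theorem ChainData.absolutelyContinuous (hD : ChainData A h v F B d) {z : Cn n}
    (hz : z ∈ unitBall n) {s a b : ℝ} (hs : 0 ≤ s) (hsa : s ≤ a) (hab : a ≤ b) (σ : ℝ) :
    AbsolutelyContinuousOnInterval (fun t => expOp A (t - σ) (polyApprox A F t (v z s t))) a b := by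
  have hv := (hD.trans.isFlowLine hz hs hsa hab).ac
  have hF : ∀ S : Finset ℕ, S ⊆ Finset.Icc 2 (criticalDegree A) →
      AbsolutelyContinuousOnInterval (fun t => ∑ k ∈ S, homDiag (F k t) (v z s t)) a b := by
    intro S
    induction S using Finset.induction_on with
    | empty =>
      intro _
      rw [absolutelyContinuousOnInterval_iff]
      exact fun ε hε => ⟨1, one_pos, fun I _ _ => by simpa using hε⟩
    | insert k S hk ih =>
      intro hS
      simp only [Finset.sum_insert hk]
      have hk2 := Finset.mem_Icc.1 (hS (Finset.mem_insert_self k S))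
      have hb : 0 ≤ b := hs.trans (hsa.trans hab)
      have h1 : AbsolutelyContinuousOnInterval (F k) a b := by
        refine ((hD.coeff k hk2.1 hk2.2).1 b hb).mono ?_
        rw [uIcc_of_le hab, uIcc_of_le hb]
        exact Icc_subset_Icc_left (hs.trans hsa)
      exact (absolutelyContinuousOnInterval_homDiag h1 hv).add
        (ih ((Finset.subset_insert k S).trans hS))
  have hexp : ContDiff ℝ 1 (fun t => expOp A (t - σ)) :=
    (contDiff_expOp A).comp (contDiff_id.sub contDiff_const)
  exact absolutelyContinuousOnInterval_clm_apply
    hexp.contDiffOn.absolutelyContinuousOnInterval (hv.add (hF _ subset_rfl))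

/-- Here the differential equations for v and the F_k are combined. The shift σ normalizes by
e^{-σA}; taking σ = s later keeps the constants independent of the starting time. -/
theorem ChainData.ae_hasDerivAt (hD : ChainData A h v F B d) {z : Cn n}
    (hz : z ∈ unitBall n) {s : ℝ} (hs : 0 ≤ s) (σ : ℝ) :
    ∀ᵐ t : ℝ, s ≤ t → HasDerivAt (fun t => expOp A (t - σ) (polyApprox A F t (v z s t)))
      (expOp A (t - σ) (flowRemainder A h F (criticalDegree A) t (v z s t))) t := by
  have hF : ∀ᵐ t : ℝ, ∀ k : ℕ, 2 ≤ k → k ≤ criticalDegree A → 0 ≤ t →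
      DifferentiableAt ℝ (F k) t ∧
        ∀ z : Cn n, homDiag (deriv (F k) t) z = coeffB A (F k t) z + coeffN h F k t z := by
    rw [ae_all_iff]
    intro k
    by_cases hk : 2 ≤ k ∧ k ≤ criticalDegree A
    · filter_upwards [(hD.coeff k hk.1 hk.2).2] with t ht _ _ h0
      exact ht h0
    · exact Eventually.of_forall fun t h2 h3 => absurd ⟨h2, h3⟩ hk
  filter_upwards [hF, hD.trans.ode z hz s hs] with t h1 h2 hst
  have hx := h2 hst
  have hsum : HasDerivAt (fun τ => ∑ k ∈ Finset.Icc 2 (criticalDegree A),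
      homDiag (F k τ) (v z s τ)) (∑ k ∈ Finset.Icc 2 (criticalDegree A),
      (coeffB A (F k t) (v z s t) + coeffN h F k t (v z s t) +
        (k : ℂ) • homPolar (F k t) (-(h (v z s t) t)) (v z s t))) t := by
    refine HasDerivAt.fun_sum fun k hk => ?_
    rw [Finset.mem_Icc] at hk
    obtain ⟨hd, hval⟩ := h1 k hk.1 hk.2 (hs.trans hst)
    rw [← hval]
    exact hasDerivAt_homDiag hd hx
  have hexp : HasDerivAt (fun t => expOp A (t - σ)) (expOp A (t - σ) * A) t := by
    simpa using (hasDerivAt_expOp A (t - σ)).comp_sub_const t σ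
  refine (hasDerivAt_clm_apply hexp (hx.add hsum)).congr_deriv ?_
  rw [add_comm]
  exact (map_add (expOp A (t - σ)) _ _).symm

theorem exists_one_add_pow_le {η : ℝ} (hη : 0 < η) (d : ℕ) :
    ∃ C : ℝ, 0 < C ∧ ∀ t : ℝ, 0 ≤ t → (1 + t) ^ d ≤ C * Real.exp (η * t) := by
  refine ⟨d.factorial / η ^ d * Real.exp η, by positivity, fun t ht => ?_⟩
  have h1 := Real.pow_div_factorial_le_exp (η * (1 + t)) (by positivity) d
  have h2 : Real.exp (η * (1 + t)) = Real.exp η * Real.exp (η * t) := by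
    rw [← Real.exp_add]; ring_nf
  rw [div_le_iff₀ (by positivity), mul_pow, h2] at h1
  rw [mul_assoc, div_mul_eq_mul_div, le_div_iff₀ (by positivity)]
  linarith

theorem one_add_pow_le_mul {s t : ℝ} (hs : 0 ≤ s) (hst : s ≤ t) (d : ℕ) :
    (1 + t) ^ d ≤ (1 + s) ^ d * (1 + (t - s)) ^ d := by
  rw [← mul_pow]
  have : 1 + t ≤ (1 + s) * (1 + (t - s)) := by nlinarith [mul_nonneg hs (sub_nonneg.2 hst)]
  exact pow_le_pow_left₀ (by linarith) this d

/-- The central estimate. Its constants depend only on A, B and d, which (ii) requires; the power of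
‖z‖ yields the coefficients, and the factor (1+s)^d keeps the degree of the bound on the F_k. -/
theorem exists_norm_chainApprox_sub_le (hA : 0 < lowerIndex A) (hB : 0 ≤ B) (d : ℕ) :
    ∃ C : ℝ, 0 ≤ C ∧ ∃ η : ℝ, 0 < η ∧ ∀ (h : Cn n → ℝ → Cn n) (v : Cn n → ℝ → ℝ → Cn n)
      (F : ∀ k : ℕ, ℝ → HomPoly n k), ChainData A h v F B d → ∀ z : Cn n, ‖z‖ ≤ 1 / 2 →
      ∀ s a b : ℝ, 0 ≤ s → s ≤ a → a ≤ b →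
        ‖expOp A (-s) (chainApprox A v F z s b) - expOp A (-s) (chainApprox A v F z s a)‖ ≤
          C * (1 + s) ^ d * ‖z‖ ^ (criticalDegree A + 1) * Real.exp (-(η * (a - s))) := by
  set N := criticalDegree A with hN
  set m := lowerIndex A with hm
  -- A third of the spectral gap: one η is lost in the growth of e^{tA}, one absorbs the polynomial
  -- growth of the F_k, and one remains as decay.
  obtain ⟨η, hη, hηeq⟩ : ∃ η : ℝ, 0 < η ∧ upperIndex A + 3 * η = m * (N + 1) :=
    ⟨(m * (N + 1) - upperIndex A) / 3, by linarith [upperIndex_lt hA], by ring⟩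
  obtain ⟨C₁, hC₁, H₁⟩ := exists_norm_expOp_le hA hη
  obtain ⟨C₂, hC₂, H₂⟩ := exists_norm_flowRemainder_le hA (one_le_criticalDegree hA)
  obtain ⟨C₃, hC₃, H₃⟩ := exists_one_add_pow_le hη d
  set C₄ := C₁ * (C₂ * (1 + B) * C₃ * 4 ^ (N + 1)) with hC₄
  have hC₄0 : 0 ≤ C₄ := by
    have : 0 ≤ C₁ := by linarith
    positivity
  refine ⟨C₄ / η, by positivity, η, hη, fun h v F hD z hz s a b hs hsa hab => ?_⟩
  have hzb : z ∈ unitBall n := by rw [mem_ball_zero_iff]; linarith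
  have hs1 : 1 ≤ (1 + s) ^ d := one_le_pow₀ (by linarith)
  set D := C₄ * (1 + s) ^ d * ‖z‖ ^ (N + 1) with hDdef
  have hD0 : 0 ≤ D := by positivity
  have hconv : ∀ t, expOp A (-s) (chainApprox A v F z s t) =
      expOp A (t - s) (polyApprox A F t (v z s t)) := by
    intro t
    rw [chainApprox, ← expOp_add_apply]
    congr 2
    ring
  rw [hconv, hconv]
  have hB' : ∀ t, HasDerivAt (fun t => -(D / η) * Real.exp (-(η * (t - s))))
      (D * Real.exp (-(η * (t - s)))) t := by
    intro t
    have h1 : HasDerivAt (fun t => Real.exp (-(η * (t - s))))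
        (Real.exp (-(η * (t - s))) * (-(η * 1))) t :=
      ((((hasDerivAt_id t).sub_const s).const_mul η).neg).exp
    refine (h1.const_mul (-(D / η))).congr_deriv ?_
    field_simp
  have key := (hD.absolutelyContinuous hzb hs hsa hab s).norm_sub_le hab (by fun_prop) hB' (by
    filter_upwards [hD.ae_hasDerivAt hzb hs s] with t ht hmem
    have hst : s ≤ t := hsa.trans hmem.1.le
    have ht0 : 0 ≤ t := hs.trans hst
    refine ⟨_, ht hst, ?_⟩
    have hvz : ‖v z s t‖ ≤ 1 / 2 := (hD.trans.norm_le hA hD.gen hzb hs hst).trans hz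
    -- The 4 bounds (1 - ‖z‖)⁻² on the half ball.
    have hvexp : ‖v z s t‖ ≤ 4 * ‖z‖ * Real.exp (-(m * (t - s))) := by
      refine (hD.trans.norm_le_exp hA hD.gen hzb hs hst).trans ?_
      rw [mul_comm]
      refine mul_le_mul_of_nonneg_right ?_ (Real.exp_pos _).le
      rw [div_le_iff₀ (by have : 0 < 1 - ‖z‖ := by linarith
                          positivity)]
      have h4 : 1 ≤ 4 * (1 - ‖z‖) ^ 2 := by nlinarith [norm_nonneg z]
      nlinarith [norm_nonneg z, mul_le_mul_of_nonneg_left h4 (norm_nonneg z)]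
    have hR := H₂ h t F (B * (1 + t) ^ d) (hD.gen.classN t ht0) (by positivity)
      (fun k h2 h3 => hD.bound k h2 h3 t ht0) _ hvz
    have ht1 : 1 ≤ (1 + t) ^ d := one_le_pow₀ (by linarith)
    have hts : 0 ≤ t - s := by linarith
    have hpow : (1 + t) ^ d ≤ (1 + s) ^ d * (C₃ * Real.exp (η * (t - s))) :=
      (one_add_pow_le_mul hs hst d).trans (mul_le_mul_of_nonneg_left (H₃ _ hts) (by positivity))
    have hR2 : ‖flowRemainder A h F N t (v z s t)‖ ≤
        C₂ * ((1 + B) * ((1 + s) ^ d * (C₃ * Real.exp (η * (t - s))))) *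
          (4 * ‖z‖ * Real.exp (-(m * (t - s)))) ^ (N + 1) := by
      refine hR.trans (mul_le_mul (mul_le_mul_of_nonneg_left ?_ hC₂)
        (pow_le_pow_left₀ (norm_nonneg _) hvexp _) (by positivity) (by positivity))
      calc 1 + B * (1 + t) ^ d ≤ (1 + B) * (1 + t) ^ d := by nlinarith
        _ ≤ _ := mul_le_mul_of_nonneg_left hpow (by positivity)
    refine ((expOp A (t - s)).le_opNorm _).trans ?_
    refine (mul_le_mul (H₁ _ hts) hR2 (norm_nonneg _) (by positivity)).trans_eq ?_
    have hexp : Real.exp (-(η * (t - s))) = Real.exp ((upperIndex A + η) * (t - s)) *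
        Real.exp (η * (t - s)) * Real.exp (-(m * (t - s))) ^ (N + 1) := by
      rw [← Real.exp_nat_mul, ← Real.exp_add, ← Real.exp_add]
      congr 1
      push_cast
      linear_combination (s - t) * hηeq
    rw [hDdef, hC₄, hexp, mul_pow, mul_pow]
    ring)
  refine key.trans ?_
  have hpos : 0 ≤ D / η * Real.exp (-(η * (b - s))) := by positivity
  have : C₄ / η * (1 + s) ^ d * ‖z‖ ^ (N + 1) * Real.exp (-(η * (a - s))) =
      D / η * Real.exp (-(η * (a - s))) := by rw [hDdef]; ring
  rw [this]
  linarith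

theorem ChainData.chainApprox_semigroup (hA : 0 < lowerIndex A) (hD : ChainData A h v F B d)
    {z : Cn n} (hz : z ∈ unitBall n) {s τ t : ℝ} (hs : 0 ≤ s) (hsτ : s ≤ τ) (hτt : τ ≤ t) :
    chainApprox A v F (v z s τ) τ t = chainApprox A v F z s t := by
  rw [chainApprox, chainApprox, hD.trans.semigroup hA hD.gen hz hs hsτ hτt]

/-- The time after which the flow has moved the ball of radius `r` into that of radius `1/2`. -/
noncomputable def halfTime (A : Cn n →L[ℂ] Cn n) (r : ℝ) : ℝ :=
  Real.log (2 / (1 - r) ^ 2) / lowerIndex A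

theorem halfTime_nonneg (hA : 0 < lowerIndex A) {r : ℝ} (hr0 : 0 ≤ r) (hr : r < 1) :
    0 ≤ halfTime A r := by
  refine div_nonneg (Real.log_nonneg ?_) hA.le
  have : 0 < 1 - r := by linarith
  rw [le_div_iff₀ (by positivity)]
  nlinarith

theorem ChainData.norm_le_half (hA : 0 < lowerIndex A) (hD : ChainData A h v F B d) {r : ℝ}
    (hr : r < 1) {z : Cn n} (hz : ‖z‖ ≤ r) {s : ℝ} (hs : 0 ≤ s) :
    ‖v z s (s + halfTime A r)‖ ≤ 1 / 2 := by
  have hzb : z ∈ unitBall n := mem_ball_zero_iff.2 (hz.trans_lt hr)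
  have hr0 := (norm_nonneg z).trans hz
  have h0 := halfTime_nonneg hA hr0 hr
  refine (hD.trans.norm_le_exp hA hD.gen hzb hs (by linarith)).trans ?_
  have h1 : lowerIndex A * (s + halfTime A r - s) = Real.log (2 / (1 - r) ^ 2) := by
    rw [halfTime]; field_simp; ring
  have hr1 : 0 < 1 - r := by linarith
  have hz1 : 0 < 1 - ‖z‖ := by linarith
  rw [h1, Real.exp_neg, Real.exp_log (by positivity), inv_div, div_mul_div_comm,
    div_le_div_iff₀ (by positivity) (by norm_num)]
  have h2 : (1 - r) ^ 2 ≤ (1 - ‖z‖) ^ 2 := pow_le_pow_left₀ hr1.le (by linarith) 2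
  nlinarith [mul_le_mul h2 (hz.trans hr.le) (norm_nonneg z) (by positivity)]

/-- After the waiting time `halfTime A r` the trajectory is in the half ball, and the semigroup
property restarts the central estimate from there. -/
theorem ChainData.exists_uniform_cauchy (hA : 0 < lowerIndex A) (hB : 0 ≤ B)
    (hD : ChainData A h v F B d) :
    ∃ η : ℝ, 0 < η ∧ ∀ s : ℝ, 0 ≤ s → ∀ r : ℝ, 0 ≤ r → r < 1 → ∃ K σ : ℝ,
      ∀ z : Cn n, ‖z‖ ≤ r → ∀ a b : ℝ, σ ≤ a → a ≤ b →
        ‖chainApprox A v F z s b - chainApprox A v F z s a‖ ≤ K * Real.exp (-(η * a)) := by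
  obtain ⟨C, hC, η, hη, H⟩ := exists_norm_chainApprox_sub_le hA hB d
  refine ⟨η, hη, fun s hs r hr0 hr => ?_⟩
  set σ := s + halfTime A r with hσ
  have hsσ : s ≤ σ := by linarith [halfTime_nonneg hA hr0 hr]
  refine ⟨‖expOp A σ‖ * (C * (1 + σ) ^ d * Real.exp (η * σ)), σ, fun z hz a b ha hab => ?_⟩
  have hzb : z ∈ unitBall n := mem_ball_zero_iff.2 (hz.trans_lt hr)
  have hhalf := hD.norm_le_half hA hr hz hs
  have key := H h v F hD _ hhalf σ a b (hs.trans hsσ) ha hab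
  rw [hD.chainApprox_semigroup hA hzb hs hsσ ha,
    hD.chainApprox_semigroup hA hzb hs hsσ (ha.trans hab), ← map_sub] at key
  have hσ0 : 0 ≤ 1 + σ := by linarith
  have h1 : ‖v z s σ‖ ^ (criticalDegree A + 1) ≤ 1 :=
    pow_le_one₀ (norm_nonneg _) (by linarith)
  rw [← expOp_apply_neg A σ (chainApprox A v F z s b - chainApprox A v F z s a)]
  refine ((expOp A σ).le_opNorm _).trans ?_
  rw [mul_assoc]
  refine mul_le_mul_of_nonneg_left (key.trans ?_) (norm_nonneg _)
  have h2 : Real.exp (-(η * (a - σ))) = Real.exp (η * σ) * Real.exp (-(η * a)) := by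
    rw [← Real.exp_add]; ring_nf
  rw [h2, ← mul_assoc]
  refine mul_le_mul_of_nonneg_right (mul_le_mul_of_nonneg_right ?_ (Real.exp_pos _).le)
    (Real.exp_pos _).le
  exact mul_le_of_le_one_right (by positivity) h1

theorem exists_norm_le_of_isCompact {S : Set (Cn n)} (hS : S ⊆ unitBall n) (hSc : IsCompact S) :
    ∃ r : ℝ, 0 ≤ r ∧ r < 1 ∧ ∀ z ∈ S, ‖z‖ ≤ r := by
  rcases S.eq_empty_or_nonempty with rfl | hne
  · exact ⟨0, le_rfl, one_pos, fun z hz => absurd hz (notMem_empty z)⟩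
  · obtain ⟨w, hw, hmax⟩ := hSc.exists_isMaxOn hne continuous_norm.continuousOn
    exact ⟨‖w‖, norm_nonneg w, mem_ball_zero_iff.1 (hS hw), fun z hz => hmax hz⟩

theorem tendsto_mul_exp_neg (K : ℝ) {η : ℝ} (hη : 0 < η) :
    Tendsto (fun a : ℝ => K * Real.exp (-(η * a))) atTop (𝓝 0) := by
  have h1 : Tendsto (fun a : ℝ => -(η * a)) atTop atBot :=
    tendsto_neg_atTop_atBot.comp (tendsto_id.const_mul_atTop hη)
  simpa using (Real.tendsto_exp_atBot.comp h1).const_mul K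

theorem ChainData.exists_isLimitChain (hA : 0 < lowerIndex A) (hB : 0 ≤ B)
    (hD : ChainData A h v F B d) : ∃ g, IsLimitChain A v (criticalDegree A) F g := by
  obtain ⟨η, hη, H⟩ := hD.exists_uniform_cauchy hA hB
  have hpt : ∀ s : ℝ, 0 ≤ s → ∀ z ∈ unitBall n, ∃ l,
      Tendsto (fun t => chainApprox A v F z s t) atTop (𝓝 l) := by
    intro s hs z hz
    obtain ⟨K, σ, hK⟩ := H s hs ‖z‖ (norm_nonneg z) (mem_ball_zero_iff.1 hz)
    refine cauchySeq_tendsto_of_complete ?_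
    refine Metric.cauchySeq_iff'.2 fun ε hε => ?_
    obtain ⟨a, ha, haσ⟩ := (((tendsto_mul_exp_neg K hη).eventually_lt_const hε).and
      (eventually_ge_atTop σ)).exists
    refine ⟨a, fun b hab => ?_⟩
    rw [dist_eq_norm]
    exact (hK z le_rfl a b haσ hab).trans_lt ha
  choose! g hg using hpt
  refine ⟨fun z s => g s z, fun s hs => ?_⟩
  rw [tendstoLocallyUniformlyOn_iff_forall_isCompact Metric.isOpen_ball]
  intro S hS hSc
  obtain ⟨r, hr0, hr, hSr⟩ := exists_norm_le_of_isCompact hS hSc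
  obtain ⟨K, σ, hK⟩ := H s hs r hr0 hr
  rw [Metric.tendstoUniformlyOn_iff]
  intro ε hε
  filter_upwards [(tendsto_mul_exp_neg K hη).eventually_lt_const hε, eventually_ge_atTop σ]
    with a ha haσ z hz
  refine lt_of_le_of_lt ?_ ha
  rw [dist_eq_norm]
  refine le_of_tendsto (((hg s hs z (hS hz)).sub_const _).norm) ?_
  filter_upwards [eventually_ge_atTop a] with b hab
  exact hK z (hSr z hz) a b haσ hab

end ChainData

/-! ### The limit chain: subordination, holomorphy and growth. -/

section Limit

variable {n : ℕ} {A : Cn n →L[ℂ] Cn n} {h : Cn n → ℝ → Cn n} {v : Cn n → ℝ → ℝ → Cn n}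
  {F : ∀ k : ℕ, ℝ → HomPoly n k} {B : ℝ} {d : ℕ} {g : Cn n → ℝ → Cn n}

theorem IsLimitChain.tendsto (hg : IsLimitChain A v (criticalDegree A) F g) {z : Cn n}
    (hz : z ∈ unitBall n) {s : ℝ} (hs : 0 ≤ s) :
    Tendsto (fun t => chainApprox A v F z s t) atTop (𝓝 (g z s)) :=
  (hg s hs).tendsto_at hz

theorem IsLimitChain.comp_transition (hg : IsLimitChain A v (criticalDegree A) F g)
    (hA : 0 < lowerIndex A) (hD : ChainData A h v F B d) {z : Cn n} (hz : z ∈ unitBall n)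
    {s t : ℝ} (hs : 0 ≤ s) (hst : s ≤ t) : g (v z s t) t = g z s := by
  refine tendsto_nhds_unique (hg.tendsto (hD.trans.mem_ball z hz s t hs hst) (hs.trans hst))
    ((hg.tendsto hz hs).congr' ?_)
  filter_upwards [eventually_ge_atTop t] with τ hτ
  exact (hD.chainApprox_semigroup hA hz hs hst hτ).symm

theorem IsLimitChain.differentiableOn (hg : IsLimitChain A v (criticalDegree A) F g)
    (hA : 0 < lowerIndex A) (hD : ChainData A h v F B d) {s : ℝ} (hs : 0 ≤ s) :
    DifferentiableOn ℂ (fun z => g z s) (unitBall n) := by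
  refine differentiableOn_of_tendstoLocallyUniformlyOn Metric.isOpen_ball (hg s hs) ?_
  filter_upwards [eventually_ge_atTop s] with t hst
  exact (expOp A t).differentiable.comp_differentiableOn
    ((differentiable_polyApprox (A := A) F t).comp_differentiableOn
      (hD.trans.differentiableOn hA hD.gen hs hst))

/-- The central estimate with a = s and b → ∞: at time s the approximation is the polynomial itself,
so g agrees with it up to order n₀ + 1. -/
theorem exists_norm_sub_polyApprox_le (hA : 0 < lowerIndex A) (hB : 0 ≤ B) (d : ℕ) :
    ∃ C : ℝ, 0 ≤ C ∧ ∀ (h : Cn n → ℝ → Cn n) (v : Cn n → ℝ → ℝ → Cn n)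
      (F : ∀ k : ℕ, ℝ → HomPoly n k) (g : Cn n → ℝ → Cn n), ChainData A h v F B d →
      IsLimitChain A v (criticalDegree A) F g → ∀ z : Cn n, ‖z‖ ≤ 1 / 2 → ∀ s : ℝ, 0 ≤ s →
        ‖expOp A (-s) (g z s) - polyApprox A F s z‖ ≤
          C * (1 + s) ^ d * ‖z‖ ^ (criticalDegree A + 1) := by
  obtain ⟨C, hC, η, hη, H⟩ := exists_norm_chainApprox_sub_le hA hB d
  refine ⟨C, hC, fun h v F g hD hg z hz s hs => ?_⟩
  have hzb : z ∈ unitBall n := by rw [mem_ball_zero_iff]; linarith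
  have h0 : expOp A (-s) (chainApprox A v F z s s) = polyApprox A F s z := by
    rw [chainApprox, hD.trans.initial z hzb s hs, expOp_neg_apply]
  have h1 : Tendsto (fun t => ‖expOp A (-s) (chainApprox A v F z s t) - polyApprox A F s z‖) atTop
      (𝓝 ‖expOp A (-s) (g z s) - polyApprox A F s z‖) :=
    ((((expOp A (-s)).continuous.tendsto _).comp (hg.tendsto hzb hs)).sub_const _).norm
  refine le_of_tendsto h1 ?_
  filter_upwards [eventually_ge_atTop s] with b hb
  have := H h v F hD z hz s s b hs le_rfl hb
  rw [h0, sub_self, mul_zero, neg_zero, Real.exp_zero, mul_one] at this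
  exact this

theorem exists_norm_le_of_norm_le_half (hA : 0 < lowerIndex A) (hB : 0 ≤ B) (d : ℕ) :
    ∃ C : ℝ, 1 ≤ C ∧ ∀ (h : Cn n → ℝ → Cn n) (v : Cn n → ℝ → ℝ → Cn n)
      (F : ∀ k : ℕ, ℝ → HomPoly n k) (g : Cn n → ℝ → Cn n), ChainData A h v F B d →
      IsLimitChain A v (criticalDegree A) F g → ∀ z : Cn n, ‖z‖ ≤ 1 / 2 → ∀ s : ℝ, 0 ≤ s →
        ‖expOp A (-s) (g z s)‖ ≤ C * (1 + s) ^ d := by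
  obtain ⟨C, hC, H⟩ := exists_norm_sub_polyApprox_le hA hB d
  have hNB : 0 ≤ (criticalDegree A : ℝ) * B := by positivity
  refine ⟨C + (1 + criticalDegree A * B), by linarith, fun h v F g hD hg z hz s hs => ?_⟩
  have h1 := H h v F g hD hg z hz s hs
  have h2 := hD.norm_polyApprox_le hB hs (z := z) (by linarith)
  have h3 : ‖z‖ ^ (criticalDegree A + 1) ≤ 1 := pow_le_one₀ (norm_nonneg _) (by linarith)
  have h4 : C * (1 + s) ^ d * ‖z‖ ^ (criticalDegree A + 1) ≤ C * (1 + s) ^ d :=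
    mul_le_of_le_one_right (by positivity) h3
  have h5 := norm_le_norm_add_norm_sub' (expOp A (-s) (g z s)) (polyApprox A F s z)
  linarith

theorem exp_mul_halfTime {r : ℝ} (hr : r < 1) (c : ℝ) :
    Real.exp (c * halfTime A r) =
      2 ^ (c / lowerIndex A) / (1 - r) ^ (2 * (c / lowerIndex A)) := by
  have hr1 : 0 < 1 - r := by linarith
  have h1 : c * halfTime A r = Real.log (2 / (1 - r) ^ 2) * (c / lowerIndex A) := by
    rw [halfTime]; ring
  rw [h1, ← Real.rpow_def_of_pos (by positivity), Real.div_rpow (by norm_num) (by positivity),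
    Real.rpow_mul hr1.le, Real.rpow_two]

/-- Let τ be the time that brings z into the half ball, where g is already bounded. Undoing the flow
costs e^{(k₊+η)τ} from e^{τA} and e^{ητ} from (1+s+τ)^d, and e^{cτ} is a constant times
(1-‖z‖)^{-2c/m}. -/
theorem exists_growth_bound (hA : 0 < lowerIndex A) (hB : 0 ≤ B) (d : ℕ) {ε : ℝ} (hε : 0 < ε) :
    ∃ C : ℝ, 0 < C ∧ ∀ (h : Cn n → ℝ → Cn n) (v : Cn n → ℝ → ℝ → Cn n)
      (F : ∀ k : ℕ, ℝ → HomPoly n k) (g : Cn n → ℝ → Cn n), ChainData A h v F B d →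
      IsLimitChain A v (criticalDegree A) F g → ∀ z ∈ unitBall n, ∀ s : ℝ, 0 ≤ s →
        ‖expOp A (-s) (g z s)‖ ≤
          C * (1 + s) ^ d / (1 - ‖z‖) ^ (2 * (upperIndex A / lowerIndex A) + ε) := by
  have hη : 0 < ε * lowerIndex A / 4 := by positivity
  -- With c = k₊ + 2η the exponent 2c/m equals 2k₊/m + 4η/m, which forces η = εm/4.
  obtain ⟨η, hη, hηeq⟩ : ∃ η : ℝ, 0 < η ∧ η = ε * lowerIndex A / 4 := ⟨_, hη, rfl⟩
  obtain ⟨C₁, hC₁, H₁⟩ := exists_norm_expOp_le hA hη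
  obtain ⟨C₂, hC₂, H₂⟩ := exists_norm_le_of_norm_le_half hA hB d
  obtain ⟨C₃, hC₃, H₃⟩ := exists_one_add_pow_le hη d
  set c := upperIndex A + 2 * η with hc
  have hC₁0 : 0 < C₁ := by linarith
  have hC₂0 : 0 < C₂ := by linarith
  refine ⟨C₁ * C₂ * C₃ * 2 ^ (c / lowerIndex A), by positivity,
    fun h v F g hD hg z hz s hs => ?_⟩
  have hz1 : ‖z‖ < 1 := mem_ball_zero_iff.1 hz
  set τ := halfTime A ‖z‖ with hτ
  have hτ0 : 0 ≤ τ := halfTime_nonneg hA (norm_nonneg z) hz1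
  have hsτ : s ≤ s + τ := by linarith
  have h1 := H₂ h v F g hD hg _ (hD.norm_le_half hA hz1 le_rfl hs) (s + τ) (hs.trans hsτ)
  rw [hg.comp_transition hA hD hz hs hsτ] at h1
  have h2 : expOp A (-s) (g z s) = expOp A τ (expOp A (-(s + τ)) (g z s)) := by
    rw [← expOp_add_apply]; congr 2; ring
  have h3 : (1 + (s + τ)) ^ d ≤ (1 + s) ^ d * (C₃ * Real.exp (η * τ)) := by
    refine (one_add_pow_le_mul hs hsτ d).trans ?_
    rw [add_sub_cancel_left]
    exact mul_le_mul_of_nonneg_left (H₃ τ hτ0) (by positivity)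
  have h4 : Real.exp (c * τ) = Real.exp ((upperIndex A + η) * τ) * Real.exp (η * τ) := by
    rw [← Real.exp_add, hc]; ring_nf
  have h5 : 2 * (upperIndex A / lowerIndex A) + ε = 2 * (c / lowerIndex A) := by
    rw [hc, hηeq]; field_simp; ring
  rw [h2]
  refine ((expOp A τ).le_opNorm _).trans ?_
  calc _ ≤ C₁ * Real.exp ((upperIndex A + η) * τ) *
        (C₂ * ((1 + s) ^ d * (C₃ * Real.exp (η * τ)))) :=
        mul_le_mul (H₁ τ hτ0) (h1.trans (mul_le_mul_of_nonneg_left h3 hC₂0.le)) (norm_nonneg _)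
          (by positivity)
    _ = C₁ * C₂ * C₃ * (1 + s) ^ d * Real.exp (c * τ) := by rw [h4]; ring
    _ = _ := by rw [hτ, exp_mul_halfTime hz1, h5]; ring

theorem exists_eval_le (P : Polynomial ℝ) :
    ∃ B : ℝ, 0 ≤ B ∧ ∀ t : ℝ, 0 ≤ t → P.eval t ≤ B * (1 + t) ^ P.natDegree := by
  refine ⟨∑ i ∈ Finset.range (P.natDegree + 1), |P.coeff i|,
    Finset.sum_nonneg fun i _ => abs_nonneg _, fun t ht => ?_⟩
  rw [Polynomial.eval_eq_sum_range, Finset.sum_mul]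
  refine Finset.sum_le_sum fun i hi => ?_
  rw [Finset.mem_range] at hi
  refine mul_le_mul (le_abs_self _) ?_ (by positivity) (abs_nonneg _)
  exact (pow_le_pow_left₀ ht (by linarith) i).trans
    (pow_le_pow_right₀ (by linarith) (by omega))

theorem IsCoeffPolyBounded.exists_common_bound {N : ℕ} (hF : IsCoeffPolyBounded N F) :
    ∃ (B : ℝ) (d : ℕ), 0 ≤ B ∧
      ∀ k : ℕ, 2 ≤ k → k ≤ N → ∀ t : ℝ, 0 ≤ t → ‖F k t‖ ≤ B * (1 + t) ^ d := by
  choose! P hP using hF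
  choose b hb0 hb using fun k => exists_eval_le (P k)
  refine ⟨∑ k ∈ Finset.range (N + 1), b k, ∑ k ∈ Finset.range (N + 1), (P k).natDegree,
    Finset.sum_nonneg fun k _ => hb0 k, fun k h2 hN t ht => ?_⟩
  have hk : k ∈ Finset.range (N + 1) := Finset.mem_range.2 (by omega)
  refine (hP k h2 hN t ht).trans ((hb k t ht).trans (mul_le_mul ?_ ?_ (by positivity) ?_))
  · exact Finset.single_le_sum (fun k _ => hb0 k) hk
  · exact pow_le_pow_right₀ (by linarith)
      (Finset.single_le_sum (f := fun k => (P k).natDegree) (fun k _ => Nat.zero_le _) hk)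
  · exact Finset.sum_nonneg fun k _ => hb0 k

theorem IsLimitChain.exists_norm_le (hg : IsLimitChain A v (criticalDegree A) F g)
    (hA : 0 < lowerIndex A) (hB : 0 ≤ B) (hD : ChainData A h v F B d) {r : ℝ} (hr : r < 1) :
    ∃ C : ℝ, 0 ≤ C ∧ ∀ z : Cn n, ‖z‖ ≤ r → ∀ t : ℝ, 0 ≤ t →
      ‖expOp A (-t) (g z t)‖ ≤ C * (1 + t) ^ d := by
  obtain ⟨C, hC, H⟩ := exists_growth_bound hA hB d one_pos
  have hr1 : 0 < 1 - r := by linarith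
  set p := 2 * (upperIndex A / lowerIndex A) + 1 with hp
  have hp0 : 0 ≤ p := by
    have := lowerIndex_le_upperIndex hA
    have : 0 ≤ upperIndex A := by linarith
    positivity
  refine ⟨C / (1 - r) ^ p, by positivity, fun z hz t ht => ?_⟩
  refine (H h v F g hD hg z (mem_ball_zero_iff.2 (hz.trans_lt hr)) t ht).trans ?_
  rw [div_mul_eq_mul_div]
  refine div_le_div_of_nonneg_left (by positivity) (by positivity) ?_
  exact Real.rpow_le_rpow hr1.le (by linarith) hp0

theorem IsLimitChain.isPolyBounded (hg : IsLimitChain A v (criticalDegree A) F g)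
    (hA : 0 < lowerIndex A) (hB : 0 ≤ B) (hD : ChainData A h v F B d) : IsPolyBounded A g := by
  intro K hK hKc
  obtain ⟨r, -, hr, hKr⟩ := exists_norm_le_of_isCompact hK hKc
  obtain ⟨C, -, H⟩ := hg.exists_norm_le hA hB hD hr
  refine ⟨C, (1 + Polynomial.X) ^ d, fun z hz t ht => ?_⟩
  simpa using H z (hKr z hz) t ht

end Limit

/-! ### Univalence, and Lipschitz dependence of the chain on time. -/

section Chain

variable {n : ℕ} {A : Cn n →L[ℂ] Cn n} {h : Cn n → ℝ → Cn n} {v : Cn n → ℝ → ℝ → Cn n}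
  {F : ∀ k : ℕ, ℝ → HomPoly n k} {B : ℝ} {d : ℕ} {g : Cn n → ℝ → Cn n}

theorem ChainData.norm_polyApprox_sub_le (hD : ChainData A h v F B d) (hB : 0 ≤ B) {t : ℝ}
    (ht : 0 ≤ t) {z : Cn n} (hz : ‖z‖ ≤ 1) :
    ‖polyApprox A F t z - z‖ ≤ criticalDegree A * B * (1 + t) ^ d * ‖z‖ ^ 2 := by
  have h2 : ∀ k ∈ Finset.Icc 2 (criticalDegree A),
      ‖homDiag (F k t) z‖ ≤ B * (1 + t) ^ d * ‖z‖ ^ 2 := by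
    intro k hk
    rw [Finset.mem_Icc] at hk
    refine (norm_homDiag_le _ _).trans (mul_le_mul (hD.bound k hk.1 hk.2 t ht) ?_ (by positivity)
      (by positivity))
    exact pow_le_pow_of_le_one (norm_nonneg z) hz hk.1
  have h3 := (norm_sum_le (Finset.Icc 2 (criticalDegree A)) fun k => homDiag (F k t) z).trans
    (Finset.sum_le_card_nsmul _ _ _ h2)
  rw [nsmul_eq_mul, Nat.card_Icc] at h3
  have h4 : ((criticalDegree A + 1 - 2 : ℕ) : ℝ) ≤ criticalDegree A := by
    exact_mod_cast (by omega)
  rw [polyApprox, add_sub_cancel_left]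
  refine h3.trans ((mul_le_mul_of_nonneg_right h4 (by positivity)).trans_eq (by ring))

theorem IsLimitChain.exists_norm_sub_self_le (hg : IsLimitChain A v (criticalDegree A) F g)
    (hA : 0 < lowerIndex A) (hB : 0 ≤ B) (hD : ChainData A h v F B d) :
    ∃ K : ℝ, 0 < K ∧ ∀ z : Cn n, ‖z‖ ≤ 1 / 2 → ∀ t : ℝ, 0 ≤ t →
      ‖expOp A (-t) (g z t) - z‖ ≤ K * (1 + t) ^ d * ‖z‖ ^ 2 := by
  obtain ⟨C, hC, H⟩ := exists_norm_sub_polyApprox_le hA hB d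
  refine ⟨C + criticalDegree A * B + 1, by positivity, fun z hz t ht => ?_⟩
  have h1 := H h v F g hD hg z hz t ht
  have h2 := hD.norm_polyApprox_sub_le hB ht (z := z) (by linarith)
  have h3 : ‖z‖ ^ (criticalDegree A + 1) ≤ ‖z‖ ^ 2 :=
    pow_le_pow_of_le_one (norm_nonneg z) (by linarith)
      (by have := one_le_criticalDegree hA; omega)
  have h4 : C * (1 + t) ^ d * ‖z‖ ^ (criticalDegree A + 1) ≤ C * (1 + t) ^ d * ‖z‖ ^ 2 :=
    mul_le_mul_of_nonneg_left h3 (by positivity)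
  have h5 := norm_sub_le_norm_sub_add_norm_sub (expOp A (-t) (g z t)) (polyApprox A F t z) z
  have h6 : 0 ≤ (1 + t) ^ d * ‖z‖ ^ 2 := by positivity
  linarith

theorem IsLimitChain.differentiableOn_expOp (hg : IsLimitChain A v (criticalDegree A) F g)
    (hA : 0 < lowerIndex A) (hD : ChainData A h v F B d) {t : ℝ} (ht : 0 ≤ t) :
    DifferentiableOn ℂ (fun z => expOp A (-t) (g z t)) (unitBall n) :=
  (expOp A (-t)).differentiable.comp_differentiableOn (hg.differentiableOn hA hD ht)

/-- The map e^{-tA}g(·, t) - id is quadratically small; a Cauchy estimate from radius 2ρ to ρ gives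
it Lipschitz constant 8K(1+t)^d ρ, and a perturbation of the identity with constant below 1 is
injective. -/
theorem IsLimitChain.exists_injOn_closedBall (hg : IsLimitChain A v (criticalDegree A) F g)
    (hA : 0 < lowerIndex A) (hB : 0 ≤ B) (hD : ChainData A h v F B d) :
    ∃ K : ℝ, 0 < K ∧ ∀ t ρ : ℝ, 0 ≤ t → 0 < ρ → ρ ≤ 1 / 4 → K * (1 + t) ^ d * ρ < 1 →
      InjOn (fun z => g z t) (Metric.closedBall 0 ρ) := by
  obtain ⟨K, hK, H⟩ := hg.exists_norm_sub_self_le hA hB hD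
  refine ⟨8 * K, by positivity, fun t ρ ht hρ hρ4 hlt x hx y hy hxy => ?_⟩
  have hsub : Metric.ball (0 : Cn n) (ρ + ρ) ⊆ unitBall n :=
    Metric.ball_subset_ball (by linarith)
  have hM : ∀ z ∈ Metric.ball (0 : Cn n) (ρ + ρ),
      ‖expOp A (-t) (g z t) - z‖ ≤ K * (1 + t) ^ d * (ρ + ρ) ^ 2 := by
    intro z hz
    rw [mem_ball_zero_iff] at hz
    refine (H z (by linarith) t ht).trans (mul_le_mul_of_nonneg_left ?_ (by positivity))
    exact pow_le_pow_left₀ (norm_nonneg z) hz.le 2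
  have key := norm_sub_le_of_closedBall (f := fun z => expOp A (-t) (g z t) - z) hρ
    (((hg.differentiableOn_expOp hA hD ht).sub differentiableOn_id).mono hsub) hM hx hy
  have h1 : expOp A (-t) (g y t) - y - (expOp A (-t) (g x t) - x) = -(y - x) := by
    simp only at hxy
    rw [hxy]; abel
  have h2 : 2 * (K * (1 + t) ^ d * (ρ + ρ) ^ 2) / ρ = 8 * K * (1 + t) ^ d * ρ := by
    field_simp; ring
  simp only [h1, norm_neg, h2] at key
  by_contra hne
  have hpos : 0 < ‖y - x‖ := norm_pos_iff.2 (sub_ne_zero.2 (Ne.symm hne))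
  nlinarith

/-- The flow brings two given points into a ball of radius O(e^{-mt}), which eventually lies inside
the ball of injectivity of radius of order (1+t)^{-d}. Injectivity of the transition mapping then
separates the original points. -/
theorem IsLimitChain.injOn (hg : IsLimitChain A v (criticalDegree A) F g)
    (hA : 0 < lowerIndex A) (hB : 0 ≤ B) (hD : ChainData A h v F B d) {s : ℝ} (hs : 0 ≤ s) :
    InjOn (fun z => g z s) (unitBall n) := by
  obtain ⟨K, hK, H⟩ := hg.exists_injOn_closedBall hA hB hD
  intro x hx y hy hxy
  set m := lowerIndex A with hm
  obtain ⟨C, hC, HC⟩ := exists_one_add_pow_le (half_pos hA) d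
  set c := ‖x‖ / (1 - ‖x‖) ^ 2 + ‖y‖ / (1 - ‖y‖) ^ 2 + 1 with hc
  have hx0 : 0 ≤ ‖x‖ / (1 - ‖x‖) ^ 2 := by positivity
  have hy0 : 0 ≤ ‖y‖ / (1 - ‖y‖) ^ 2 := by positivity
  have hc0 : 0 < c := by positivity
  have hlim1 := (tendsto_mul_exp_neg (c * Real.exp (m * s)) hA).eventually_lt_const
    (show (0 : ℝ) < 1 / 4 by norm_num)
  have hlim2 := (tendsto_mul_exp_neg (K * C * (c * Real.exp (m * s))) (half_pos hA)
    ).eventually_lt_const one_pos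
  obtain ⟨t, ⟨h1, h2⟩, hst⟩ := ((hlim1.and hlim2).and (eventually_ge_atTop s)).exists
  have ht : 0 ≤ t := hs.trans hst
  have hexp : Real.exp (m * s) * Real.exp (-(m * t)) = Real.exp (-(m * (t - s))) := by
    rw [← Real.exp_add]; ring_nf
  have hexp2 : Real.exp (m / 2 * t) * Real.exp (-(m * t)) = Real.exp (-(m / 2 * t)) := by
    rw [← Real.exp_add]; ring_nf
  set ρ := c * Real.exp (m * s) * Real.exp (-(m * t)) with hρ
  have hmem : ∀ w ∈ unitBall n, ‖w‖ / (1 - ‖w‖) ^ 2 ≤ c → v w s t ∈ Metric.closedBall 0 ρ := by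
    intro w hw hwc
    rw [mem_closedBall_zero_iff]
    refine (hD.trans.norm_le_exp hA hD.gen hw hs hst).trans ?_
    rw [hρ, mul_assoc, hexp, mul_comm]
    exact mul_le_mul_of_nonneg_right hwc (Real.exp_pos _).le
  have hinj := H t ρ ht (by positivity) h1.le (by
    refine lt_of_le_of_lt ?_ h2
    calc K * (1 + t) ^ d * ρ ≤ K * (C * Real.exp (m / 2 * t)) * ρ :=
          mul_le_mul_of_nonneg_right (mul_le_mul_of_nonneg_left (HC t ht) hK.le) (by positivity)
      _ = K * C * (c * Real.exp (m * s)) * (Real.exp (m / 2 * t) * Real.exp (-(m * t))) := by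
          rw [hρ]; ring
      _ = _ := by rw [hexp2])
  refine hD.trans.injOn hA hD.gen hs hst hx hy
    (hinj (hmem x hx (by linarith)) (hmem y hy (by linarith)) ?_)
  have hx2 := hg.comp_transition hA hD hx hs hst
  have hy2 := hg.comp_transition hA hD hy hs hst
  exact hx2.trans (hxy.trans hy2.symm)

theorem IsLimitChain.isLoewnerChain (hg : IsLimitChain A v (criticalDegree A) F g)
    (hA : 0 < lowerIndex A) (hB : 0 ≤ B) (hD : ChainData A h v F B d) : IsLoewnerChain g where
  holo _ ht := hg.differentiableOn hA hD ht
  inj _ ht := hg.injOn hA hB hD ht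
  subord s t hs hst := ⟨fun z => v z s t, hD.trans.differentiableOn hA hD.gen hs hst,
    fun z hz => hD.trans.mem_ball z hz s t hs hst, hD.trans.map_zero hA hD.gen hs hst,
    fun _ hz => (hg.comp_transition hA hD hz hs hst).symm⟩

theorem IsLimitChain.exists_norm_le_Icc (hg : IsLimitChain A v (criticalDegree A) F g)
    (hA : 0 < lowerIndex A) (hB : 0 ≤ B) (hD : ChainData A h v F B d) {r : ℝ} (hr : r < 1)
    (T : ℝ) : ∃ M : ℝ, 0 ≤ M ∧ ∀ z : Cn n, ‖z‖ ≤ r → ∀ t ∈ Icc 0 T, ‖g z t‖ ≤ M := by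
  obtain ⟨C, hC, H⟩ := hg.exists_norm_le hA hB hD hr
  obtain ⟨E, hE⟩ := isCompact_Icc.exists_bound_of_continuousOn
    (continuous_expOp A).continuousOn (s := Icc 0 T)
  refine ⟨|E| * (C * (1 + |T|) ^ d), by positivity, fun z hz t ht => ?_⟩
  rw [← expOp_apply_neg A t (g z t)]
  refine ((expOp A t).le_opNorm _).trans (mul_le_mul ((hE t ht).trans (le_abs_self E))
    ((H z hz t ht.1).trans (mul_le_mul_of_nonneg_left ?_ hC)) (norm_nonneg _) (abs_nonneg _))
  have h0 := ht.1
  exact pow_le_pow_left₀ (by linarith) (by linarith [ht.2, le_abs_self T]) d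

/-- Since g(z, s) = g(v(z, s, t), t), a change of time is a change of point by at most a multiple of
t - s, and g(·, t) is Lipschitz on smaller balls by Cauchy. -/
theorem IsLimitChain.exists_lipschitz_time (hg : IsLimitChain A v (criticalDegree A) F g)
    (hA : 0 < lowerIndex A) (hB : 0 ≤ B) (hD : ChainData A h v F B d) {r : ℝ} (hr : r < 1)
    (T : ℝ) : ∃ L : ℝ, 0 ≤ L ∧ ∀ z : Cn n, ‖z‖ ≤ r → ∀ s ∈ Icc 0 T, ∀ t ∈ Icc 0 T,
      ‖g z t - g z s‖ ≤ L * |t - s| := by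
  obtain ⟨r', hr', hr'1⟩ := exists_between hr
  obtain ⟨M, hM, HM⟩ := hg.exists_norm_le_Icc hA hB hD hr'1 T
  have hρ : 0 < r' - r := by linarith
  set L := 2 * M / (r' - r) * (8 * ‖A‖ / (1 - r) ^ 2) with hL
  have hL0 : 0 ≤ L := by positivity
  have main : ∀ z : Cn n, ‖z‖ ≤ r → ∀ s t : ℝ, 0 ≤ s → s ≤ t → t ≤ T →
      ‖g z t - g z s‖ ≤ L * (t - s) := by
    intro z hz s t hs hst htT
    have hzb : z ∈ unitBall n := mem_ball_zero_iff.2 (hz.trans_lt hr)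
    have ht : 0 ≤ t := hs.trans hst
    have h1 := norm_sub_le_of_closedBall (f := fun w => g w t) (c := 0) (r := r) (M := M) hρ
      ((hg.differentiableOn hA hD ht).mono (Metric.ball_subset_ball (by linarith)))
      (fun w hw => HM w (by rw [mem_ball_zero_iff] at hw; linarith) t ⟨ht, htT⟩)
      (x := v z s t) (y := z)
      (by rw [mem_closedBall_zero_iff]; exact (hD.trans.norm_le hA hD.gen hzb hs hst).trans hz)
      (by rwa [mem_closedBall_zero_iff])
    have h2 := hD.trans.norm_sub_le hA hD.gen hr hz hs le_rfl hst
    rw [hD.trans.initial z hzb s hs, norm_sub_rev] at h2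
    simp only [hg.comp_transition hA hD hzb hs hst] at h1
    refine h1.trans ?_
    rw [hL, mul_assoc]
    exact mul_le_mul_of_nonneg_left h2 (by positivity)
  refine ⟨L, hL0, fun z hz s hs t ht => ?_⟩
  rcases le_total s t with hst | hst
  · rw [abs_of_nonneg (by linarith)]
    exact main z hz s t hs.1 hst ht.2
  · rw [norm_sub_rev, abs_sub_comm, abs_of_nonneg (by linarith)]
    exact main z hz t s ht.1 hst hs.2

/-- A time increment of g is holomorphic in the point and O(|t - s|) on a larger ball, so the Cauchy
estimate adds the factor ‖y - x‖. This mixed bound drives the proof of the differential equation. -/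
theorem IsLimitChain.exists_norm_increment_sub_le
    (hg : IsLimitChain A v (criticalDegree A) F g)
    (hA : 0 < lowerIndex A) (hB : 0 ≤ B) (hD : ChainData A h v F B d) {r : ℝ} (hr : r < 1)
    (T : ℝ) : ∃ L : ℝ, 0 ≤ L ∧ ∀ s ∈ Icc 0 T, ∀ t ∈ Icc 0 T,
      ∀ x ∈ Metric.closedBall (0 : Cn n) r, ∀ y ∈ Metric.closedBall (0 : Cn n) r,
        ‖(g y t - g y s) - (g x t - g x s)‖ ≤ L * ‖y - x‖ * |t - s| := by
  obtain ⟨r', hr', hr'1⟩ := exists_between hr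
  obtain ⟨L, hL, HL⟩ := hg.exists_lipschitz_time hA hB hD hr'1 T
  have hρ : 0 < r' - r := by linarith
  refine ⟨2 * L / (r' - r), by positivity, fun s hs t ht x hx y hy => ?_⟩
  have hsub : Metric.ball (0 : Cn n) (r + (r' - r)) ⊆ unitBall n :=
    Metric.ball_subset_ball (by linarith)
  refine (norm_sub_le_of_closedBall (f := fun w => g w t - g w s) hρ
    (((hg.differentiableOn hA hD ht.1).sub (hg.differentiableOn hA hD hs.1)).mono hsub)
    (fun w hw => HL w (by rw [mem_ball_zero_iff] at hw; linarith) s hs t ht) hx hy).trans_eq ?_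
  ring

theorem IsLimitChain.isLocallyAC (hg : IsLimitChain A v (criticalDegree A) F g)
    (hA : 0 < lowerIndex A) (hB : 0 ≤ B) (hD : ChainData A h v F B d) : IsLocallyAC g 0 := by
  intro K hK hKc T hT ε hε
  obtain ⟨r, -, hr, hKr⟩ := exists_norm_le_of_isCompact hK hKc
  obtain ⟨L, hL, HL⟩ := hg.exists_lipschitz_time hA hB hD hr T
  refine ⟨ε / (L + 1), by positivity, fun I hI hsum z hz => ?_⟩
  have hterm : ∀ i ∈ Finset.range I.1,
      dist (g z (I.2 i).1) (g z (I.2 i).2) ≤ L * dist (I.2 i).1 (I.2 i).2 := by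
    intro i hi
    obtain ⟨h1, h2⟩ := hI.1 i hi
    rw [uIcc_of_le hT] at h1 h2
    rw [dist_eq_norm, Real.dist_eq]
    exact HL z (hKr z hz) _ h2 _ h1
  refine (Finset.sum_le_sum hterm).trans_lt ?_
  rw [← Finset.mul_sum]
  rw [lt_div_iff₀ (by positivity)] at hsum
  have : 0 ≤ ∑ i ∈ Finset.range I.1, dist (I.2 i).1 (I.2 i).2 :=
    Finset.sum_nonneg fun i _ => dist_nonneg
  nlinarith

end Chain

/-! ### Two criteria for differentiability in time. -/

section Derivative

variable {E G : Type*} [NormedAddCommGroup E] [NormedAddCommGroup G] [NormedSpace ℝ G]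

theorem hasDerivAt_zero_of_norm_sub_le_sq {φ : ℝ → G} {t C : ℝ}
    (h : ∀ᶠ τ in 𝓝 t, ‖φ τ - φ t‖ ≤ C * |τ - t| ^ 2) : HasDerivAt φ 0 t := by
  rw [hasDerivAt_iff_isLittleO]
  simp only [smul_zero, sub_zero]
  have h1 : (fun τ => φ τ - φ t) =O[𝓝 t] fun τ => (τ - t) ^ 2 := by
    refine Asymptotics.IsBigO.of_bound C ?_
    filter_upwards [h] with τ hτ
    simpa using hτ
  refine h1.trans_isLittleO ?_
  have h2 : (fun x : ℝ => x ^ 2) =o[𝓝 0] fun x : ℝ => x := by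
    simpa using Asymptotics.isLittleO_pow_pow (𝕜 := ℝ) one_lt_two
  have h3 : Tendsto (fun τ : ℝ => τ - t) (𝓝 t) (𝓝 0) := by
    have : ContinuousAt (fun τ : ℝ => τ - t) t := by fun_prop
    simpa using this.tendsto
  exact h2.comp_tendsto h3

/-- A derivative with respect to a parameter extends from a dense set of points when the
increments are Lipschitz in the point. -/
theorem hasDerivAt_of_frequently {f : E → ℝ → G} {p : E → G} {w : E} {t L : ℝ}
    (hL : ∀ᶠ x in 𝓝 w, ∀ᶠ τ in 𝓝 t,
      ‖(f w τ - f w t) - (f x τ - f x t)‖ ≤ L * ‖w - x‖ * |τ - t|)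
    (hp : ContinuousAt p w) (hf : ∃ᶠ x in 𝓝 w, HasDerivAt (f x) (p x) t) :
    HasDerivAt (f w) (p w) t := by
  rw [hasDerivAt_iff_isLittleO, Asymptotics.isLittleO_iff]
  intro c hc
  have hc3 : 0 < c / 3 := by positivity
  have hp1 : ∀ᶠ x in 𝓝 w, ‖p x - p w‖ < c / 3 := by
    filter_upwards [hp (Metric.ball_mem_nhds (p w) hc3)] with x hx
    rw [← dist_eq_norm]
    exact hx
  have hL1 : ∀ᶠ x in 𝓝 w, L * ‖w - x‖ < c / 3 := by
    have : ContinuousAt (fun x => L * ‖w - x‖) w := by fun_prop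
    exact this.eventually_lt_const (by simpa using hc3)
  obtain ⟨x, hx, ⟨h1, h2⟩, h3⟩ := (hf.and_eventually ((hL.and hp1).and hL1)).exists
  rw [hasDerivAt_iff_isLittleO, Asymptotics.isLittleO_iff] at hx
  filter_upwards [h1, hx hc3] with τ h4 h5
  have h6 : f w τ - f w t - (τ - t) • p w =
      ((f w τ - f w t) - (f x τ - f x t)) + (f x τ - f x t - (τ - t) • p x) +
        (τ - t) • (p x - p w) := by
    rw [smul_sub]; abel
  rw [h6]
  refine norm_add₃_le.trans ?_
  rw [norm_smul]
  rw [Real.norm_eq_abs] at h5 ⊢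
  have h7 : 0 ≤ |τ - t| := abs_nonneg _
  have h8 := mul_le_mul_of_nonneg_right h3.le h7
  have h9 := mul_le_mul_of_nonneg_left h2.le h7
  linarith

end Derivative

/-! ### The Loewner differential equation. -/

section Pde

variable {n : ℕ} {A : Cn n →L[ℂ] Cn n} {h : Cn n → ℝ → Cn n} {v : Cn n → ℝ → ℝ → Cn n}
  {F : ∀ k : ℕ, ℝ → HomPoly n k} {B : ℝ} {d : ℕ} {g : Cn n → ℝ → Cn n}

theorem hasDerivAt_comp_of_differentiableAt {E G : Type*} [NormedAddCommGroup E]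
    [NormedSpace ℂ E] [NormedSpace ℝ E] [IsScalarTower ℝ ℂ E] [NormedAddCommGroup G]
    [NormedSpace ℂ G] [NormedSpace ℝ G] [IsScalarTower ℝ ℂ G] {f : E → G} {x : ℝ → E} {x' : E}
    {t : ℝ} (hf : DifferentiableAt ℂ f (x t)) (hx : HasDerivAt x x' t) :
    HasDerivAt (fun τ => f (x τ)) (fderiv ℂ f (x t) x') t :=
  (hf.hasFDerivAt.restrictScalars ℝ).comp_hasDerivAt t hx

/-- Because g(v(z, s, τ), τ) is constant in τ, the mixed increment bound makes g(v(z, s, t), τ) +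
g(v(z, s, τ), t) constant up to O(|τ - t|²). The first summand thus has minus the derivative of the
second, which the chain rule computes. -/
theorem IsLimitChain.hasDerivAt_transition (hg : IsLimitChain A v (criticalDegree A) F g)
    (hA : 0 < lowerIndex A) (hB : 0 ≤ B) (hD : ChainData A h v F B d) {z : Cn n}
    (hz : z ∈ unitBall n) {s t : ℝ} (hs : 0 ≤ s) (hst : s < t)
    (hv : HasDerivAt (fun τ => v z s τ) (-(h (v z s t) t)) t) :
    HasDerivAt (fun τ => g (v z s t) τ)
      (fderiv ℂ (fun w => g w t) (v z s t) (h (v z s t) t)) t := by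
  have ht : 0 < t := hs.trans_lt hst
  have hz1 := mem_ball_zero_iff.1 hz
  obtain ⟨L, hL, HL⟩ := hg.exists_norm_increment_sub_le hA hB hD hz1 (t + 1)
  have hwb : v z s t ∈ unitBall n := hD.trans.mem_ball z hz s t hs hst.le
  have h1 : HasDerivAt (fun τ => g (v z s τ) t)
      (fderiv ℂ (fun w => g w t) (v z s t) (-(h (v z s t) t))) t :=
    hasDerivAt_comp_of_differentiableAt (f := fun w => g w t) (x := fun τ => v z s τ)
      ((hg.differentiableOn hA hD ht.le).differentiableAt (Metric.isOpen_ball.mem_nhds hwb)) hv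
  set M := 8 * ‖A‖ / (1 - ‖z‖) ^ 2 with hM
  have hvM : ∀ τ, s ≤ τ → ‖v z s t - v z s τ‖ ≤ M * |τ - t| := by
    intro τ hτ
    rcases le_total τ t with hle | hle
    · rw [abs_sub_comm, abs_of_nonneg (by linarith)]
      exact hD.trans.norm_sub_le hA hD.gen hz1 le_rfl hs hτ hle
    · rw [norm_sub_rev, abs_of_nonneg (by linarith)]
      exact hD.trans.norm_sub_le hA hD.gen hz1 le_rfl hs hst.le hle
  have h2 : HasDerivAt (fun τ => g (v z s t) τ + g (v z s τ) t) 0 t := by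
    refine hasDerivAt_zero_of_norm_sub_le_sq (C := L * M) ?_
    filter_upwards [Ioo_mem_nhds hst (lt_add_one t)] with τ hτ
    have h3 := HL t ⟨ht.le, by linarith⟩ τ ⟨hs.trans hτ.1.le, hτ.2.le⟩ (v z s τ)
      (by rw [mem_closedBall_zero_iff]; exact hD.trans.norm_le hA hD.gen hz hs hτ.1.le)
      (v z s t)
      (by rw [mem_closedBall_zero_iff]; exact hD.trans.norm_le hA hD.gen hz hs hst.le)
    have h4 : g (v z s τ) τ = g (v z s t) t :=
      (hg.comp_transition hA hD hz hs hτ.1.le).trans (hg.comp_transition hA hD hz hs hst.le).symm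
    rw [h4] at h3
    have h5 : g (v z s t) τ + g (v z s τ) t - (g (v z s t) t + g (v z s t) t) =
        g (v z s t) τ - g (v z s t) t - (g (v z s t) t - g (v z s τ) t) := by abel
    rw [h5]
    refine h3.trans ?_
    have h6 := mul_le_mul_of_nonneg_right (mul_le_mul_of_nonneg_left (hvM τ hτ.1.le) hL)
      (abs_nonneg (τ - t))
    refine h6.trans_eq ?_
    ring
  have h3 := h2.sub h1
  refine (h3.congr_deriv ?_).congr_of_eventuallyEq (Eventually.of_forall fun τ => ?_)
  · rw [map_neg, zero_sub, neg_neg]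
  · simp

/-- The null set of bad times of a trajectory depends on its start. Dense starting points and
rational starting times give one null set; at any other t > 0 the positions v(z_i, q, t) accumulate
at every point of the ball, and the equation extends from them by continuity and the mixed increment
bound. -/
theorem IsLimitChain.pde (hg : IsLimitChain A v (criticalDegree A) F g)
    (hA : 0 < lowerIndex A) (hB : 0 ≤ B) (hD : ChainData A h v F B d) :
    ∀ᵐ t : ℝ, 0 ≤ t → ∀ z ∈ unitBall n,
      HasDerivAt (fun τ => g z τ) (fderiv ℂ (fun w => g w t) z (h z t)) t := by
  have hode : ∀ᵐ t : ℝ, ∀ (i : ℕ) (q : ℚ), TopologicalSpace.denseSeq (Cn n) i ∈ unitBall n →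
      (0 : ℝ) ≤ q → (q : ℝ) ≤ t → HasDerivAt (fun τ => v (TopologicalSpace.denseSeq (Cn n) i) q τ)
        (-(h (v (TopologicalSpace.denseSeq (Cn n) i) q t) t)) t := by
    rw [ae_all_iff]
    intro i
    rw [ae_all_iff]
    intro q
    by_cases hi : TopologicalSpace.denseSeq (Cn n) i ∈ unitBall n ∧ (0 : ℝ) ≤ q
    · filter_upwards [hD.trans.ode _ hi.1 q hi.2] with t ht _ _ hqt
      exact ht hqt
    · exact Eventually.of_forall fun t h1 h2 => absurd ⟨h1, h2⟩ hi
  -- Time 0 is discarded because a rational starting time in [0, t) is needed.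
  have hne : ∀ᵐ t : ℝ, t ≠ 0 := by
    rw [ae_iff]
    simp
  filter_upwards [hode, hne] with t hode ht0 ht w hw
  have htpos : 0 < t := lt_of_le_of_ne ht (Ne.symm ht0)
  obtain ⟨r, hwr, hr⟩ := exists_between (mem_ball_zero_iff.1 hw)
  obtain ⟨L, hL, HL⟩ := hg.exists_norm_increment_sub_le hA hB hD hr (t + 1)
  have hnhds : Metric.ball (0 : Cn n) r ∈ 𝓝 w :=
    Metric.isOpen_ball.mem_nhds (mem_ball_zero_iff.2 hwr)
  refine hasDerivAt_of_frequently (f := g) (L := L)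
    (p := fun x => fderiv ℂ (fun w => g w t) x (h x t)) ?_ ?_ ?_
  · filter_upwards [hnhds] with x hx
    filter_upwards [Ioo_mem_nhds htpos (lt_add_one t)] with τ hτ
    exact HL t ⟨ht, by linarith⟩ τ ⟨hτ.1.le, hτ.2.le⟩ x (Metric.ball_subset_closedBall hx) w
      (mem_closedBall_zero_iff.2 hwr.le)
  · have h1 : ContinuousAt (fun x => fderiv ℂ (fun w => g w t) x) w :=
      ((contDiffOn_of_differentiableOn Metric.isOpen_ball (hg.differentiableOn hA hD ht) 1
        ).contDiffAt (Metric.isOpen_ball.mem_nhds hw)).continuousAt_fderiv (by norm_num)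
    have h2 : ContinuousAt (fun x => h x t) w :=
      ((hD.gen.classN t ht).holo.differentiableAt
        (Metric.isOpen_ball.mem_nhds hw)).continuousAt
    exact h1.clm_apply h2
  · rw [Metric.nhds_basis_ball.frequently_iff]
    intro ε hε
    set M := 8 * ‖A‖ / (1 - r) ^ 2 with hM
    have hM0 : 0 ≤ M := by positivity
    obtain ⟨i, hi⟩ := (TopologicalSpace.denseRange_denseSeq (Cn n)).exists_mem_open
      Metric.isOpen_ball (⟨w, Metric.mem_ball_self (lt_min (half_pos hε) (sub_pos.2 hwr))⟩ :
        (Metric.ball w (min (ε / 2) (r - ‖w‖))).Nonempty)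
    set z := TopologicalSpace.denseSeq (Cn n) i with hz
    have hzw : ‖z - w‖ < min (ε / 2) (r - ‖w‖) := by rwa [← mem_ball_iff_norm]
    have hz1 : ‖z‖ ≤ r := by
      have := norm_le_norm_add_norm_sub' z w
      linarith [hzw.trans_le (min_le_right _ _)]
    have hzb : z ∈ unitBall n := mem_ball_zero_iff.2 (hz1.trans_lt hr)
    -- M bounds the speed, so between q and t the trajectory moves by less than ε/2; M + 1 avoids a
    -- zero denominator.
    obtain ⟨q, hq1, hq2⟩ := exists_rat_btwn
      (show max 0 (t - ε / (2 * (M + 1))) < t from max_lt htpos (by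
        have : 0 < ε / (2 * (M + 1)) := by positivity
        linarith))
    have hq0 : (0 : ℝ) ≤ q := (le_max_left _ _).trans hq1.le
    have hq3 : t - q < ε / (2 * (M + 1)) := by linarith [(le_max_right 0 _).trans_lt hq1]
    refine ⟨v z q t, ?_, ?_⟩
    · rw [mem_ball_iff_norm]
      have h1 := hD.trans.norm_sub_le hA hD.gen hr hz1 hq0 le_rfl hq2.le
      rw [hD.trans.initial z hzb q hq0] at h1
      have h2 := norm_sub_le_norm_sub_add_norm_sub (v z q t) z w
      have h3 := hzw.trans_le (min_le_left _ _)
      rw [lt_div_iff₀ (by positivity)] at hq3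
      have h4 : M * (t - q) < ε / 2 := by nlinarith
      linarith
    · exact hg.hasDerivAt_transition hA hB hD hzb hq0 hq2 (hode i q hzb hq0 hq2.le)

theorem IsLimitChain.isLoewnerSolution (hg : IsLimitChain A v (criticalDegree A) F g)
    (hA : 0 < lowerIndex A) (hB : 0 ≤ B) (hD : ChainData A h v F B d) :
    IsLoewnerSolution h g where
  holo _ ht := hg.differentiableOn hA hD ht
  locallyAC := hg.isLocallyAC hA hB hD
  pde := hg.pde hA hB hD

end Pde

/-! ### Order of vanishing of a power series. -/

section PowerSeries

/-- The coefficients of a power series vanish up to the order of its sum at the origin. -/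
theorem eq_zero_of_hasSum_pow_of_norm_le {G : Type*} [NormedAddCommGroup G] [NormedSpace ℂ G]
    {a : ℕ → G} {ψ : ℂ → G} {K : ℝ} {M : ℕ}
    (hs : ∀ ζ : ℂ, ‖ζ‖ ≤ 1 → HasSum (fun k => ζ ^ k • a k) (ψ ζ))
    (hψ : ∀ ζ : ℂ, ‖ζ‖ ≤ 1 / 2 → ‖ψ ζ‖ ≤ K * ‖ζ‖ ^ M) : ∀ k < M, a k = 0 := by
  -- Convergence at ζ = 1 makes the coefficients bounded, so tails are dominated by geometric
  -- series.
  obtain ⟨C, hC⟩ : ∃ C, ∀ k, ‖a k‖ ≤ C := by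
    have h1 := (hs 1 (by simp)).summable.tendsto_atTop_zero
    simp only [one_pow, one_smul] at h1
    obtain ⟨C, hC⟩ := (Metric.isBounded_range_of_tendsto a h1).exists_norm_le
    exact ⟨C, fun k => hC _ (mem_range_self k)⟩
  have hC0 : 0 ≤ C := (norm_nonneg _).trans (hC 0)
  intro k
  induction k using Nat.strong_induction_on with
  | _ k ih =>
    intro hk
    have key : ∀ r : ℝ, 0 < r → r ≤ 1 / 2 → ‖a k‖ ≤ (|K| + 2 * C) * r := by
      intro r hr hr2
      have hrn : ‖(r : ℂ)‖ = r := by rw [Complex.norm_real, Real.norm_of_nonneg hr.le]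
      have h1 := (hasSum_nat_add_iff' (k + 1)).2 (hs r (by rw [hrn]; linarith))
      have h2 : ∑ i ∈ Finset.range (k + 1), (r : ℂ) ^ i • a i = (r : ℂ) ^ k • a k := by
        rw [Finset.sum_range_succ, Finset.sum_eq_zero, zero_add]
        intro i hi
        rw [Finset.mem_range] at hi
        rw [ih i hi (hi.trans hk), smul_zero]
      rw [h2] at h1
      have h3 : HasSum (fun j : ℕ => C * r ^ (k + 1) * r ^ j) (C * r ^ (k + 1) * (1 - r)⁻¹) :=
        (hasSum_geometric_of_lt_one hr.le (by linarith)).mul_left _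
      have h4 := h1.norm_le_of_bounded h3 (fun j => by
        rw [norm_smul, norm_pow, hrn]
        calc r ^ (j + (k + 1)) * ‖a (j + (k + 1))‖ ≤ r ^ (j + (k + 1)) * C :=
              mul_le_mul_of_nonneg_left (hC _) (by positivity)
          _ = C * r ^ (k + 1) * r ^ j := by ring)
      have h5 : (1 - r)⁻¹ ≤ 2 := by
        rw [inv_le_comm₀ (by linarith) (by norm_num)]
        linarith
      have h6 : C * r ^ (k + 1) * (1 - r)⁻¹ ≤ C * r ^ (k + 1) * 2 :=
        mul_le_mul_of_nonneg_left h5 (by positivity)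
      have h7 : ‖ψ r‖ ≤ |K| * r ^ (k + 1) := by
        refine (hψ r (by rw [hrn]; exact hr2)).trans ?_
        rw [hrn]
        refine mul_le_mul (le_abs_self K) ?_ (by positivity) (abs_nonneg K)
        exact pow_le_pow_of_le_one hr.le (by linarith) hk
      have h8 : r ^ k * ‖a k‖ ≤ r ^ k * ((|K| + 2 * C) * r) := by
        calc r ^ k * ‖a k‖ = ‖(r : ℂ) ^ k • a k‖ := by rw [norm_smul, norm_pow, hrn]
          _ ≤ ‖ψ r‖ + ‖ψ r - (r : ℂ) ^ k • a k‖ := norm_le_norm_add_norm_sub _ _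
          _ ≤ |K| * r ^ (k + 1) + C * r ^ (k + 1) * 2 := add_le_add h7 (h4.trans h6)
          _ = _ := by ring
      exact le_of_mul_le_mul_left h8 (by positivity)
    have hlim : Tendsto (fun r : ℝ => (|K| + 2 * C) * r) (𝓝[>] 0) (𝓝 0) := by
      have : ContinuousAt (fun r : ℝ => (|K| + 2 * C) * r) 0 := by fun_prop
      simpa using this.tendsto.mono_left nhdsWithin_le_nhds
    refine norm_le_zero_iff.1 (ge_of_tendsto hlim ?_)
    filter_upwards [Ioc_mem_nhdsGT (show (0 : ℝ) < 1 / 2 by norm_num)] with r hr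
    exact key r hr.1 hr.2

end PowerSeries

/-! ### Existence of the expansion and identification of its coefficients. -/

section Expansion

variable {n : ℕ} {A : Cn n →L[ℂ] Cn n} {h : Cn n → ℝ → Cn n} {v : Cn n → ℝ → ℝ → Cn n}
  {F : ∀ k : ℕ, ℝ → HomPoly n k} {B : ℝ} {d : ℕ} {g : Cn n → ℝ → Cn n}

/-- Averaging over all permutations symmetrizes a multilinear mapping without changing its diagonal.
-/
theorem exists_homDiag_eq {k : ℕ} (M : Cn n [×k]→L[ℂ] Cn n) :
    ∃ Q : HomPoly n k, ∀ z, homDiag Q z = M (fun _ => z) := by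
  have hfac : (k.factorial : ℂ) ≠ 0 := by exact_mod_cast k.factorial_ne_zero
  refine ⟨⟨(k.factorial : ℂ)⁻¹ • ∑ σ : Equiv.Perm (Fin k), M.domDomCongr σ, fun τ x => ?_⟩,
    fun z => ?_⟩
  · simp only [smul_apply, sum_apply,
      ContinuousMultilinearMap.domDomCongr_apply]
    congr 1
    exact Equiv.sum_comp (Equiv.mulLeft τ) fun σ : Equiv.Perm (Fin k) => M fun i => x (σ i)
  · simp only [homDiag, smul_apply, sum_apply,
      ContinuousMultilinearMap.domDomCongr_apply, Finset.sum_const, Finset.card_univ,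
      Fintype.card_perm, Fintype.card_fin]
    rw [← Nat.cast_smul_eq_nsmul ℂ, inv_smul_smul₀ hfac]

theorem exists_homDiag_eq_taylorTerm (f : Cn n → Cn n) (k : ℕ) :
    ∃ Q : HomPoly n k, ∀ z, homDiag Q z = taylorTerm f k z := by
  obtain ⟨Q, hQ⟩ := exists_homDiag_eq ((k.factorial : ℂ)⁻¹ • iteratedFDeriv ℂ k f 0)
  exact ⟨Q, hQ⟩

theorem IsLimitChain.expOp_map_zero (hg : IsLimitChain A v (criticalDegree A) F g)
    (hA : 0 < lowerIndex A) (hB : 0 ≤ B) (hD : ChainData A h v F B d) {t : ℝ} (ht : 0 ≤ t) :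
    expOp A (-t) (g 0 t) = 0 := by
  obtain ⟨K, -, H⟩ := hg.exists_norm_sub_self_le hA hB hD
  have := H 0 (by simp) t ht
  simpa using this

theorem IsLimitChain.fderiv_zero (hg : IsLimitChain A v (criticalDegree A) F g)
    (hA : 0 < lowerIndex A) (hB : 0 ≤ B) (hD : ChainData A h v F B d) {t : ℝ} (ht : 0 ≤ t) :
    fderiv ℂ (fun z => expOp A (-t) (g z t)) 0 = ContinuousLinearMap.id ℂ (Cn n) := by
  obtain ⟨K, hK, H⟩ := hg.exists_norm_sub_self_le hA hB hD
  refine HasFDerivAt.fderiv ?_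
  rw [hasFDerivAt_iff_isLittleO_nhds_zero]
  simp only [zero_add, hg.expOp_map_zero hA hB hD ht, sub_zero, ContinuousLinearMap.id_apply]
  have h1 : (fun z : Cn n => expOp A (-t) (g z t) - z) =O[𝓝 0] fun z => ‖z‖ ^ 2 := by
    refine Asymptotics.IsBigO.of_bound (K * (1 + t) ^ d) ?_
    filter_upwards [Metric.closedBall_mem_nhds (0 : Cn n) (show (0 : ℝ) < 1 / 2 by norm_num)]
      with z hz
    rw [mem_closedBall_zero_iff] at hz
    simpa using H z hz t ht
  exact h1.trans_isLittleO (Asymptotics.isLittleO_norm_pow_id one_lt_two)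

theorem IsLimitChain.exists_hasExpansion (hg : IsLimitChain A v (criticalDegree A) F g)
    (hA : 0 < lowerIndex A) (hB : 0 ≤ B) (hD : ChainData A h v F B d) :
    ∃ G : ∀ k : ℕ, ℝ → HomPoly n k, HasExpansion A g G := by
  choose G hG using fun (k : ℕ) (t : ℝ) =>
    exists_homDiag_eq_taylorTerm (fun z => expOp A (-t) (g z t)) k
  refine ⟨G, fun t ht z hz => ⟨expOp A (-t) (g z t) - z, ?_, ?_⟩⟩
  · have h1 := (hasSum_nat_add_iff' 2).2
      (hasSum_taylorTerm (hg.differentiableOn_expOp hA hD ht) hz)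
    rw [Finset.sum_range_succ, Finset.sum_range_one, taylorTerm_zero, taylorTerm_one,
      hg.expOp_map_zero hA hB hD ht, hg.fderiv_zero hA hB hD ht, zero_add] at h1
    simp only [hG]
    exact h1
  · rw [add_sub_cancel, expOp_apply_neg]

/-- On the slice ζ ↦ ζz the difference between e^{-tA}g and the polynomial is a power series in ζ of
size O(|ζ|^{n₀+1}), so its coefficients of degree at most n₀ vanish. This applies to an arbitrary
expansion, with no appeal to Taylor coefficients. -/
theorem IsLimitChain.homDiag_eq (hg : IsLimitChain A v (criticalDegree A) F g)
    (hA : 0 < lowerIndex A) (hB : 0 ≤ B) (hD : ChainData A h v F B d)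
    {G : ∀ k : ℕ, ℝ → HomPoly n k} (hG : HasExpansion A g G) {k : ℕ} (hk : 2 ≤ k)
    (hkN : k ≤ criticalDegree A) {t : ℝ} (ht : 0 ≤ t) {z : Cn n} (hz : z ∈ unitBall n) :
    homDiag (G k t) z = homDiag (F k t) z := by
  obtain ⟨C, hC, H⟩ := exists_norm_sub_polyApprox_le hA hB d
  set N := criticalDegree A with hN
  rw [mem_ball_zero_iff] at hz
  have hs : ∀ ζ : ℂ, ‖ζ‖ ≤ 1 → HasSum (fun k => ζ ^ k • ((if 2 ≤ k then homDiag (G k t) z else 0) -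
      (if k ∈ Finset.Icc 2 N then homDiag (F k t) z else 0)))
      (expOp A (-t) (g (ζ • z) t) - polyApprox A F t (ζ • z)) := by
    intro ζ hζ
    have hζz : ζ • z ∈ unitBall n := by
      rw [mem_ball_zero_iff, norm_smul]
      exact (mul_le_of_le_one_left (norm_nonneg z) hζ).trans_lt hz
    obtain ⟨S, hS, hgS⟩ := hG t ht _ hζz
    have h1 : HasSum (fun k => if 2 ≤ k then homDiag (G k t) (ζ • z) else 0) S := by
      refine (hasSum_nat_add_iff' 2).1 ?_
      simpa [Finset.sum_range_succ] using hS
    have h2 := hasSum_sum_of_ne_finset_zero (L := SummationFilter.unconditional ℕ)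
      (f := fun k => if k ∈ Finset.Icc 2 N then homDiag (F k t) (ζ • z) else 0)
      (s := Finset.Icc 2 N) (fun k hk => if_neg hk)
    rw [Finset.sum_congr rfl (fun k hk => if_pos hk)] at h2
    have h3 := h1.sub h2
    have h4 : expOp A (-t) (g (ζ • z) t) - polyApprox A F t (ζ • z) =
        S - ∑ k ∈ Finset.Icc 2 N, homDiag (F k t) (ζ • z) := by
      rw [hgS, expOp_neg_apply, polyApprox, add_sub_add_left_eq_sub]
    rw [h4]
    refine h3.congr_fun fun k => ?_
    simp only [homDiag_smul, smul_sub, smul_ite, smul_zero]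
  have hψ : ∀ ζ : ℂ, ‖ζ‖ ≤ 1 / 2 →
      ‖expOp A (-t) (g (ζ • z) t) - polyApprox A F t (ζ • z)‖ ≤
        C * (1 + t) ^ d * ‖ζ‖ ^ (N + 1) := by
    intro ζ hζ
    have hle : ‖ζ • z‖ ≤ ‖ζ‖ := by
      rw [norm_smul]
      exact mul_le_of_le_one_right (norm_nonneg ζ) hz.le
    refine (H h v F g hD hg _ (hle.trans hζ) t ht).trans
      (mul_le_mul_of_nonneg_left ?_ (by positivity))
    exact pow_le_pow_left₀ (norm_nonneg _) hle _
  have key := eq_zero_of_hasSum_pow_of_norm_le hs hψ k (by omega)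
  rw [if_pos hk, if_pos (Finset.mem_Icc.2 ⟨hk, hkN⟩)] at key
  exact sub_eq_zero.1 key

theorem IsLimitChain.coeff_eq (hg : IsLimitChain A v (criticalDegree A) F g)
    (hA : 0 < lowerIndex A) (hB : 0 ≤ B) (hD : ChainData A h v F B d)
    {G : ∀ k : ℕ, ℝ → HomPoly n k} (hG : HasExpansion A g G) {k : ℕ} (hk : 2 ≤ k)
    (hkN : k ≤ criticalDegree A) {t : ℝ} (ht : 0 ≤ t) : G k t = F k t := by
  refine homPoly_ext fun z => ?_
  -- Homogeneity scales an arbitrary z into the ball.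
  set c : ℂ := ((1 + ‖z‖ : ℝ) : ℂ)⁻¹ with hc
  have hpos : 0 < 1 + ‖z‖ := by positivity
  have hc0 : c ≠ 0 := inv_ne_zero (Complex.ofReal_ne_zero.2 hpos.ne')
  have hcz : c • z ∈ unitBall n := by
    rw [mem_ball_zero_iff, norm_smul, hc, norm_inv, Complex.norm_real,
      Real.norm_of_nonneg hpos.le, inv_mul_lt_iff₀ hpos]
    linarith
  have := hg.homDiag_eq hA hB hD hG hk hkN ht hcz
  rw [homDiag_smul, homDiag_smul] at this
  exact smul_right_injective _ (pow_ne_zero k hc0) this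

end Expansion

end Loewner

/-! ### Assembly of the theorem. -/

theorem mainTheorem2 {n : ℕ} (A : Loewner.Cn n →L[ℂ] Loewner.Cn n)
    (hA : 0 < Loewner.lowerIndex A) :
    (∀ (h : Loewner.Cn n → ℝ → Loewner.Cn n) (v : Loewner.Cn n → ℝ → ℝ → Loewner.Cn n)
        (F : ∀ k : ℕ, ℝ → Loewner.HomPoly n k),
      Loewner.IsGenerator A h →
      Loewner.IsTransitionSolution h v →
      Loewner.IsCoeffSolution A h (Loewner.criticalDegree A) F →
      Loewner.IsCoeffPolyBounded (Loewner.criticalDegree A) F →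
      ∃ g : Loewner.Cn n → ℝ → Loewner.Cn n,
        Loewner.IsLimitChain A v (Loewner.criticalDegree A) F g ∧
        Loewner.IsLoewnerChain g ∧
        Loewner.IsLoewnerSolution h g ∧
        Loewner.IsPolyBounded A g ∧
        (∃ G : ∀ k : ℕ, ℝ → Loewner.HomPoly n k, Loewner.HasExpansion A g G) ∧
        ∀ G : ∀ k : ℕ, ℝ → Loewner.HomPoly n k, Loewner.HasExpansion A g G →
          ∀ k : ℕ, 2 ≤ k → k ≤ Loewner.criticalDegree A →
            ∀ t : ℝ, 0 ≤ t → G k t = F k t) ∧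
    (∀ (P : Polynomial ℝ) (ε : ℝ), 0 < ε →
      ∃ Q : Polynomial ℝ, Q.natDegree = P.natDegree ∧
        ∀ (h : Loewner.Cn n → ℝ → Loewner.Cn n) (v : Loewner.Cn n → ℝ → ℝ → Loewner.Cn n)
          (F : ∀ k : ℕ, ℝ → Loewner.HomPoly n k) (g : Loewner.Cn n → ℝ → Loewner.Cn n),
          Loewner.IsGenerator A h →
          Loewner.IsTransitionSolution h v →
          Loewner.IsCoeffSolution A h (Loewner.criticalDegree A) F →
          Loewner.IsCoeffBound (Loewner.criticalDegree A) F P →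
          Loewner.IsLimitChain A v (Loewner.criticalDegree A) F g →
          ∀ z ∈ Loewner.unitBall n, ∀ t : ℝ, 0 ≤ t →
            ‖Loewner.expOp A (-t) (g z t)‖ ≤
              Q.eval t / (1 - ‖z‖) ^
                (2 * (Loewner.upperIndex A / Loewner.lowerIndex A) + ε)) := by
  constructor
  · intro h v F hh hv hF hb
    obtain ⟨B, d, hB, hbound⟩ := hb.exists_common_bound
    have hD : Loewner.ChainData A h v F B d := ⟨hh, hv, hF, hbound⟩
    obtain ⟨g, hg⟩ := hD.exists_isLimitChain hA hB
    exact ⟨g, hg, hg.isLoewnerChain hA hB hD, hg.isLoewnerSolution hA hB hD,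
      hg.isPolyBounded hA hB hD, hg.exists_hasExpansion hA hB hD,
      fun G hG k hk hkN t ht => hg.coeff_eq hA hB hD hG hk hkN ht⟩
  · intro P ε hε
    obtain ⟨B, hB, hP⟩ := Loewner.exists_eval_le P
    obtain ⟨C, hC, H⟩ := Loewner.exists_growth_bound hA hB P.natDegree hε
    -- C depends only on A, ε and P and is positive, so the degree is exactly that of P, also when P
    -- is constant or zero.
    refine ⟨Polynomial.C C * (Polynomial.X + Polynomial.C 1) ^ P.natDegree, ?_, ?_⟩
    · rw [Polynomial.natDegree_C_mul hC.ne', Polynomial.natDegree_pow,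
        Polynomial.natDegree_X_add_C, mul_one]
    · intro h v F g hh hv hF hFP hg z hz t ht
      have hD : Loewner.ChainData A h v F B P.natDegree :=
        ⟨hh, hv, hF, fun k hk hkN t ht => (hFP k hk hkN t ht).trans (hP t ht)⟩
      have := H h v F g hD hg z hz t ht
      rw [add_comm 1 t] at this
      simpa using this
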